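/- Let $\mathbb T$ be the unit circle with normalized Lebesgue measure $m$, and let $L^0$ be the space of (classes of a.e. equal) measurable functions $\mathbb T\to\mathbb C$. A Banach function space is a linear subspace $X\subset L^0$ with a complete norm such that (a) if $f\in X$, $g\in L^0$ and $|g|\le|f|$ a.e., then $g\in X$ and $\|g\|_X\le\|f\|_X$; (b) $L^\infty\subset X$; (c) if $f_n,f\in X$ and $0\le f_n\uparrow f$ a.e., then $\|f\|_X=\sup_n\|f_n\|_X$. It is rearrangement invariant (r.i.) if, whenever $f\in X$, $g\in L^0$ and $m\{|f|>\lambda\}=m\{|g|>\lambda\}$ for all $\lambda\ge0$, then $g\in X$ and $\|g\|_X=\|f\|_X$. It has the Fatou property if $f_n\in X$, $f\in L^0$, $0\le f_n\uparrow f$ a.e. and $\sup_n\|f_n\|_X<\infty$ imply $f\in X$ and $\|f\|_X=\sup_n\|f_n\|_X$. For $s>0$ and $\theta\in[0,2\pi)$ put $(D_sf)(e^{i\theta})=f(e^{is\theta})$ if $s\theta\in[0,2\pi)$ and $0$ otherwise; the Boyd indices of an r.i. space $X$ are $$\alpha_X=\lim_{s\to0^+}\frac{\log\|D_{1/s}\|_{X\to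 X}}{\log s},\qquad \beta_X=\lim_{s\to\infty}\frac{\log\|D_{1/s}\|_{X\to X}}{\log s},$$ and they are nontrivial if $\alpha_X,\beta_X\in(0,1)$. Every r.i. Banach function space is contained in $L^1$, and $H[X]=\{f\in X:\widehat f(n)=0\text{ for all }n<0\}$ with the norm of $X$. For $f\in L^1$ let $Pf=\frac12\bigl(f+i\tilde f+\widehat f(0)\bigr)$ be its Riesz projection, where the conjugate function $\tilde f$ is the a.e. radial limit of the conjugate Poisson integral of $f$. Let $M(X,Y)=\{a\in L^0: ag\in Y\text{ for all }g\in X\}$ and $\|a\|_{M(X,Y)}=\sup_{\|g\|_X\le1}\|ag\|_Y$. For $a\in L^0$, the Toeplitz operator $T_a:f\mapsto P(af)$ is called bounded from $H[X]$ to $H[Y]$ if $af\in L^1$ and $P(af)\in H[Y]$ for every $f\in H[X]$, and $\|P(af)\|_Y\le C\|f\|_X$ with a constant $C<\infty$ independent of $f$; the least such $C$ is $\|T_a\|_{H[X]\to H[Y]}$. **Theorem.** Let $X,Y$ be r.i. Banach function spaces on $\mathbb T$ such that $X\subset Y$, and suppose that $Y$ has nontrivial Boyd indices and the Fatou property. Then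 $P$ is bounded on $Y$ and, for every $a\in L^0$, the Toeplitz operator $T_a:f\mapsto P(af)$ is bounded from $H[X]$ to $H[Y]$ if and only if $a\in M(X,Y)$, and in this case $$\|a\|_{M(X,Y)}\le\|T_a\|_{H[X]\to H[Y]}\le\|P\|_{Y\to Y}\,\|a\|_{M(X,Y)}.$$ -/

import Mathlib

open MeasureTheory Filter Topology
open scoped ENNReal NNReal Real ComplexOrder

noncomputable section

namespace ToeplitzRI

/-- The unit circle, written additively: `θ` modulo `2π` stands for the point `e^{iθ}`. -/
abbrev Torus : Type := AddCircle (2 * π)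

instance instFactTwoPi : Fact (0 < 2 * π) := ⟨Real.two_pi_pos⟩

/-- Normalized Lebesgue measure on the circle. -/
abbrev m : Measure Torus := AddCircle.haarAddCircle

/-- `L⁰`: complex-valued measurable functions on the circle modulo equality a.e. -/
abbrev L0 : Type := Torus →ₘ[m] ℂ

/-- `0 ≤ f_n ↑ f` a.e. (`≤` on `ℂ` is the order in which `0 ≤ z` means that `z` is real and
nonnegative). -/
def IncreasesTo (u : ℕ → L0) (f : L0) : Prop :=
  ∀ᵐ t ∂m, (∀ n, 0 ≤ u n t) ∧ Monotone (fun n => u n t) ∧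
    Tendsto (fun n => u n t) atTop (𝓝 (f t))

/-- A Banach function space on the circle, given by its norm, which is extended by the value `∞`
to all of `L⁰`; the space itself is `{f | N f < ∞}`. It is a complete normed space, has the ideal
property, contains `L^∞` and has the semi-Fatou property. -/
structure BanachFunctionSpace where
  /-- The norm, with value `∞` exactly off the space. -/
  N : L0 → ℝ≥0∞
  eq_zero_of_norm_eq_zero : ∀ f, N f = 0 → f = 0
  norm_smul : ∀ (c : ℂ) (f : L0), N (c • f) = ‖c‖ₑ * N f
  norm_add_le : ∀ f g, N (f + g) ≤ N f + N g
  complete : ∀ u : ℕ → L0, (∀ n, N (u n) < ∞) →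
    (∀ ε : ℝ≥0∞, 0 < ε → ∃ n₀, ∀ k ≥ n₀, ∀ l ≥ n₀, N (u k - u l) < ε) →
    ∃ f, N f < ∞ ∧ Tendsto (fun n => N (u n - f)) atTop (𝓝 0)
  ideal : ∀ f g : L0, (∀ᵐ t ∂m, ‖g t‖ ≤ ‖f t‖) → N g ≤ N f
  norm_lt_top_of_memLp_top : ∀ f : L0, MemLp f ∞ m → N f < ∞
  semiFatou : ∀ (u : ℕ → L0) (f : L0), (∀ n, N (u n) < ∞) → N f < ∞ →
    IncreasesTo u f → N f = ⨆ n, N (u n)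

namespace BanachFunctionSpace

/-- The underlying set of functions. -/
def space (X : BanachFunctionSpace) : Set L0 := {f | X.N f < ∞}

/-- The Fatou property. -/
def HasFatou (X : BanachFunctionSpace) : Prop :=
  ∀ (u : ℕ → L0) (f : L0), (∀ n, u n ∈ X.space) → IncreasesTo u f → (⨆ n, X.N (u n)) < ∞ →
    f ∈ X.space ∧ X.N f = ⨆ n, X.N (u n)

end BanachFunctionSpace

/-- The distribution function `λ ↦ m {|f| > λ}`. -/
def distribution (f : L0) (lam : ℝ) : ℝ≥0∞ := m {t | lam < ‖f t‖}

def Equimeasurable (f g : L0) : Prop :=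
  ∀ lam : ℝ, 0 ≤ lam → distribution f lam = distribution g lam

/-- Rearrangement invariance. -/
def BanachFunctionSpace.IsRI (X : BanachFunctionSpace) : Prop :=
  ∀ f g : L0, Equimeasurable f g → f ∈ X.space → g ∈ X.space ∧ X.N f = X.N g

/-- The representative in `[0, 2π)` of a point of the circle. -/
def arg (x : Torus) : ℝ := (AddCircle.equivIco (2 * π) 0 x : ℝ)

theorem measurable_arg : Measurable arg :=
  measurable_subtype_coe.comp (AddCircle.measurableEquivIco (2 * π) 0).measurable

/-- `(D_s f)(e^{iθ}) = f(e^{isθ})` if `sθ ∈ [0, 2π)` and `0` otherwise, for `θ ∈ [0, 2π)`. -/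
def dilationFun (s : ℝ) (f : L0) (x : Torus) : ℂ :=
  open Classical in
  if s * arg x ∈ Set.Ico 0 (2 * π) then f ((s * arg x : ℝ) : Torus) else 0

theorem measurable_dilationFun (s : ℝ) (f : L0) : Measurable (dilationFun s f) := by
  have h : Measurable fun x => s * arg x := measurable_arg.const_mul s
  exact Measurable.ite (h measurableSet_Ico)
    (f.stronglyMeasurable.measurable.comp (AddCircle.measurable_mk'.comp h)) measurable_const

/-- The dilation operator `D_s` on `L⁰`. -/
def dilation (s : ℝ) (f : L0) : L0 :=
  AEEqFun.mk (dilationFun s f) (measurable_dilationFun s f).aestronglyMeasurable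

namespace BanachFunctionSpace

/-- The operator norm of `D_s` on `X`. -/
def dilationNorm (X : BanachFunctionSpace) (s : ℝ) : ℝ≥0∞ :=
  ⨆ (f : L0) (_ : X.N f ≤ 1), X.N (dilation s f)

/-- `α` is the lower Boyd index of `X`. -/
def IsLowerBoydIndex (X : BanachFunctionSpace) (α : ℝ) : Prop :=
  Tendsto (fun s : ℝ => Real.log (X.dilationNorm (1 / s)).toReal / Real.log s) (𝓝[>] 0) (𝓝 α)

/-- `β` is the upper Boyd index of `X`. -/
def IsUpperBoydIndex (X : BanachFunctionSpace) (β : ℝ) : Prop :=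
  Tendsto (fun s : ℝ => Real.log (X.dilationNorm (1 / s)).toReal / Real.log s) atTop (𝓝 β)

/-- Both Boyd indices lie in `(0, 1)`. -/
def HasNontrivialBoydIndices (X : BanachFunctionSpace) : Prop :=
  ∃ α β : ℝ, X.IsLowerBoydIndex α ∧ X.IsUpperBoydIndex β ∧
    α ∈ Set.Ioo (0 : ℝ) 1 ∧ β ∈ Set.Ioo (0 : ℝ) 1

/-- The Hardy space `H[X]` of those `f ∈ X` (hence in `L¹`, when `X` is rearrangement invariant)
whose Fourier coefficients of negative index vanish. -/
def hardy (X : BanachFunctionSpace) : Set L0 :=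
  {f | f ∈ X.space ∧ ∀ n : ℤ, n < 0 → fourierCoeff f n = 0}

end BanachFunctionSpace

/-- The space `M(X, Y)` of pointwise multipliers. -/
def multipliers (X Y : BanachFunctionSpace) : Set L0 :=
  {a | ∀ g ∈ X.space, a * g ∈ Y.space}

/-- The norm of `M(X, Y)`. -/
def multiplierNorm (X Y : BanachFunctionSpace) (a : L0) : ℝ≥0∞ :=
  ⨆ (g : L0) (_ : X.N g ≤ 1), Y.N (a * g)

/-- The conjugate Poisson kernel `Q_r(θ) = 2 r sin θ / (1 - 2 r cos θ + r²)`, written as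
`Im ((1 + z) / (1 - z))` with `z = r e^{iθ}`. -/
def conjPoissonKernel (r : ℝ) (x : Torus) : ℝ :=
  ((1 + (r : ℂ) * fourier 1 x) / (1 - (r : ℂ) * fourier 1 x)).im

/-- The conjugate Poisson integral of `f` at the point `r e^{ix}` of the disc. -/
def conjPoisson (f : L0) (r : ℝ) (x : Torus) : ℂ :=
  ∫ t, (conjPoissonKernel r (x - t) : ℂ) * f t ∂m

/-- `g` is the conjugate function of the integrable function `f`: the radial boundary function of
the conjugate Poisson integral of `f`. -/
def IsConjugateFunction (f g : L0) : Prop :=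
  ∀ᵐ x ∂m, Tendsto (fun r : ℝ => conjPoisson f r x) (𝓝[<] 1) (𝓝 (g x))

/-- `g = P f` for the Riesz projection `P : f ↦ (f + i f~ + f^(0)) / 2`, `f ∈ L¹`, where `f~` is
the conjugate function of `f`. -/
def IsRieszProjection (f g : L0) : Prop :=
  Integrable f m ∧ ∃ h : L0, IsConjugateFunction f h ∧
    g = (1 / 2 : ℂ) • (f + Complex.I • h + AEEqFun.const Torus (fourierCoeff f 0))

/-- `C` bounds the Riesz projection on `Y`. -/
def RieszBoundedBy (Y : BanachFunctionSpace) (C : ℝ≥0∞) : Prop :=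
  ∀ f ∈ Y.space, ∃ g ∈ Y.space, IsRieszProjection f g ∧ Y.N g ≤ C * Y.N f

/-- `‖P‖_{Y → Y}`, the least bound (`∞` if `P` is not bounded on `Y`). -/
def rieszNorm (Y : BanachFunctionSpace) : ℝ≥0∞ := sInf {C | RieszBoundedBy Y C}

/-- `C` bounds the Toeplitz operator `T_a : f ↦ P (a f)` from `H[X]` to `H[Y]`; in particular
`a f ∈ L¹` and `P (a f) ∈ H[Y]` for every `f ∈ H[X]`. -/
def ToeplitzBoundedBy (X Y : BanachFunctionSpace) (a : L0) (C : ℝ≥0∞) : Prop :=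
  ∀ f ∈ X.hardy, ∃ g ∈ Y.hardy, IsRieszProjection (a * f) g ∧ Y.N g ≤ C * X.N f

/-- `T_a` is a bounded operator from `H[X]` to `H[Y]`. -/
def ToeplitzBounded (X Y : BanachFunctionSpace) (a : L0) : Prop :=
  ∃ C : ℝ≥0, ToeplitzBoundedBy X Y a C

/-- `‖T_a‖_{H[X] → H[Y]}`, the least bound (`∞` if `T_a` is not bounded). -/
def toeplitzNorm (X Y : BanachFunctionSpace) (a : L0) : ℝ≥0∞ :=
  sInf {C | ToeplitzBoundedBy X Y a C}

end ToeplitzRI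

end

noncomputable section

namespace ToeplitzRI

/-! ### The circle as the boundary of the disc -/

/-! Everything is carried by Cauchy integrals on circles |z| = r < 1. Since 2/(1-w) - 1 =
(1+w)/(1-w), whose real and imaginary parts are the Poisson and conjugate Poisson kernels, Fatou's
theorem on Poisson integrals identifies P f with the radial limit of the Cauchy integral of f
(`isRieszProjection_iff`).

Boundedness of P on Y. For f ≥ 0 the Herglotz integral F has nonnegative real part. The mean value
property of F/(F+λ) gives a weak type (1,1) estimate (`measure_le_norm_herglotz`), and that of
F^{2k} gives M. Riesz's L^{2k} estimate (`exists_integral_norm_cauchyInt_pow_le`). Cutting |f| at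
the height f*(t) of its decreasing rearrangement and using one estimate on each piece bounds the
rearrangement of the Cauchy integral by the dyadic Calderón sums ∑ 2^{-j} f*(2^{-j}t) + ∑ ρ^j f*(2^j
t), where ρ^{2k} = 2 (`exists_rearr_cauchyInt_le`). Nontrivial Boyd indices bound the norms of the
dilated rearrangements f*(2^j ·) and f*(2^{-j} ·) by multiples of θ^j and τ^j with θ < 1 and τ < 2.
For k large, ρθ < 1, so both series converge in Y, uniformly in r; the Fatou property lets r tend to
1. The condition τ < 2 also makes bounded subsets of Y uniformly integrable, so the vanishing of
negative Fourier coefficients survives the limit and P maps Y into H[Y].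

From T_a to the multiplier. For f in H[X] the functions e^{inx} f stay in H[X] with the same norm,
and e^{-inx} P(e^{inx} a f) tends to a f in measure: for trigonometric polynomials this is an
equality for large n, and the weak type estimate controls the rest (`tendstoInMeasure_shift`). The
Fatou property gives ‖a f‖_Y ≤ C ‖f‖_X on H[X]. Only |f| enters this inequality, and an outer
function has modulus min(|g|, n) + ε for any given g in X (`exists_outer`), so it extends to all of
X with the same constant.

From the multiplier to T_a. A multiplier has finite norm by a gliding hump argument resting on
completeness (`multiplierNorm_lt_top`), and T_a is multiplication by a followed by P. -/

theorem norm_fourier_apply (n : ℤ) (x : Torus) : ‖fourier n x‖ = 1 := by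
  rw [fourier_apply]; exact Circle.norm_coe _

theorem fourier_one_pow (n : ℕ) (x : Torus) : (fourier 1 x : ℂ) ^ n = fourier n x := by
  induction n with
  | zero => simp
  | succ k ih => rw [pow_succ, ih, Nat.cast_succ, fourier_add]

theorem fourier_neg_one_pow (n : ℕ) (x : Torus) :
    (fourier (-1) x : ℂ) ^ n = fourier (-(n : ℤ)) x := by
  rw [fourier_neg, fourier_neg, ← fourier_one_pow, map_pow]

theorem fourier_sub_apply (n : ℤ) (x t : Torus) :
    (fourier n (x - t) : ℂ) = fourier n x * fourier (-n) t := by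
  rw [fourier_apply, fourier_apply, fourier_apply, smul_sub, sub_eq_add_neg,
    AddCircle.toCircle_add, Circle.coe_mul, neg_smul]

theorem fourier_mul_fourier_neg (n : ℤ) (x : Torus) :
    (fourier n x : ℂ) * fourier (-n) x = 1 := by
  rw [← fourier_add]; simp

/-- The integral over the circle as an average over the circle of radius `r`. -/
theorem integral_comp_eq_circleAverage (Φ : ℂ → ℂ) (r : ℝ) :
    ∫ x, Φ (r * fourier 1 x) ∂m = Real.circleAverage Φ 0 r := by
  rw [AddCircle.integral_haarAddCircle, Real.circleAverage_def,
    ← AddCircle.intervalIntegral_preimage (2 * π) 0]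
  simp only [zero_add]
  congr 1
  refine intervalIntegral.integral_congr fun x _ => ?_
  refine congrArg Φ ?_
  rw [fourier_coe_apply, circleMap]
  push_cast
  field_simp
  simp

theorem norm_mul_fourier {r : ℝ} (hr : 0 ≤ r) (n : ℤ) (x : Torus) :
    ‖(r : ℂ) * fourier n x‖ = r := by
  rw [norm_mul, norm_fourier_apply, mul_one, Complex.norm_real, Real.norm_of_nonneg hr]

theorem mul_fourier_mem_ball {r : ℝ} (hr : r ∈ Set.Ico (0 : ℝ) 1) (n : ℤ) (x : Torus) :
    (r : ℂ) * fourier n x ∈ Metric.ball (0 : ℂ) 1 := by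
  rw [mem_ball_zero_iff, norm_mul_fourier hr.1]; exact hr.2

theorem integral_comp_mul_fourier {Φ : ℂ → ℂ} (hΦ : DifferentiableOn ℂ Φ (Metric.ball 0 1))
    {r : ℝ} (hr : r ∈ Set.Ico (0 : ℝ) 1) : ∫ x, Φ (r * fourier 1 x) ∂m = Φ 0 := by
  rw [integral_comp_eq_circleAverage]
  refine DiffContOnCl.circleAverage ?_
  refine (hΦ.mono ?_).diffContOnCl
  refine Metric.closure_ball_subset_closedBall.trans (Metric.closedBall_subset_ball ?_)
  rw [abs_of_nonneg hr.1]; exact hr.2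

/-- Mean value property of z^n Φ(z), which vanishes at the origin. The factor r^n is cancelled
afterwards, hence r > 0. This is the source of every vanishing negative Fourier coefficient below.
-/
theorem integral_fourier_mul_comp {Φ : ℂ → ℂ} (hΦ : DifferentiableOn ℂ Φ (Metric.ball 0 1))
    {r : ℝ} (hr : r ∈ Set.Ioo (0 : ℝ) 1) {n : ℕ} (hn : n ≠ 0) :
    ∫ x, fourier n x * Φ (r * fourier 1 x) ∂m = 0 := by
  have h := integral_comp_mul_fourier (Φ := fun z => z ^ n * Φ z)
    ((differentiableOn_id.pow n).mul hΦ) ⟨hr.1.le, hr.2⟩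
  simp only [mul_pow, fourier_one_pow, zero_pow hn, zero_mul] at h
  simp only [mul_assoc] at h
  rw [integral_const_mul] at h
  have hr' : ((r : ℂ) ^ n) ≠ 0 := pow_ne_zero _ (by exact_mod_cast hr.1.ne')
  exact (mul_eq_zero.1 h).resolve_left hr'

theorem continuous_comp_mul_fourier {Φ : ℂ → ℂ} (hΦ : ContinuousOn Φ (Metric.ball 0 1))
    {r : ℝ} (hr : r ∈ Set.Ico (0 : ℝ) 1) : Continuous fun x : Torus => Φ (r * fourier 1 x) :=
  hΦ.comp_continuous (continuous_const.mul (fourier 1).continuous)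
    fun x => mul_fourier_mem_ball hr 1 x

/-! ### Cauchy integrals -/

/-- The Cauchy integral `z ↦ ∫ f(t) / (1 - z e^{-it}) dm(t)`. -/
def cauchyInt (f : Torus → ℂ) (z : ℂ) : ℂ := ∫ t, (1 - z * fourier (-1) t)⁻¹ * f t ∂m

theorem norm_cauchyKernel_le {z : ℂ} (hz : ‖z‖ < 1) (t : Torus) :
    ‖(1 - z * fourier (-1) t)⁻¹‖ ≤ (1 - ‖z‖)⁻¹ := by
  rw [norm_inv]
  refine inv_anti₀ (by linarith) ?_
  have h := norm_sub_norm_le (1 : ℂ) (z * fourier (-1) t)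
  rw [norm_mul, norm_fourier_apply, norm_one, mul_one] at h
  exact h

theorem one_sub_mul_fourier_ne_zero {z : ℂ} (hz : ‖z‖ < 1) (n : ℤ) (t : Torus) :
    1 - z * fourier n t ≠ 0 := by
  intro h
  have h2 : z * fourier n t = 1 := (sub_eq_zero.1 h).symm
  have h3 := congrArg norm h2
  rw [norm_mul, norm_fourier_apply, norm_one, mul_one] at h3
  linarith

theorem continuous_cauchyKernel {z : ℂ} (hz : ‖z‖ < 1) :
    Continuous fun t : Torus => (1 - z * fourier (-1) t)⁻¹ :=
  (continuous_const.sub (continuous_const.mul (fourier (-1)).continuous)).inv₀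
    fun t => one_sub_mul_fourier_ne_zero hz (-1) t

theorem integrable_cauchyKernel_mul {f : Torus → ℂ} (hf : Integrable f m) {z : ℂ}
    (hz : ‖z‖ < 1) : Integrable (fun t => (1 - z * fourier (-1) t)⁻¹ * f t) m :=
  hf.bdd_mul (continuous_cauchyKernel hz).aestronglyMeasurable
    (Eventually.of_forall fun t => norm_cauchyKernel_le hz t)

/-- Geometric expansion of the kernel, integrated term by term: the Taylor coefficients at 0 are the
Fourier coefficients of nonnegative index. -/
theorem hasSum_cauchyInt {f : Torus → ℂ} (hf : Integrable f m) {z : ℂ} (hz : ‖z‖ < 1) :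
    HasSum (fun n : ℕ => fourierCoeff f n * z ^ n) (cauchyInt f z) := by
  have h := hasSum_integral_of_summable_integral_norm (μ := m)
    (F := fun (n : ℕ) (t : Torus) => (z * fourier (-1) t) ^ n * f t)
    (fun n => hf.bdd_mul (c := ‖z‖ ^ n)
      ((continuous_const.mul (fourier (-1)).continuous).pow n).aestronglyMeasurable
      (Eventually.of_forall fun t => by
        rw [norm_pow, norm_mul, norm_fourier_apply, mul_one])) ?_
  · have h1 : ∀ n : ℕ, ∫ t, (z * fourier (-1) t) ^ n * f t ∂m = fourierCoeff f n * z ^ n := by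
      intro n
      rw [fourierCoeff, mul_comm (integral _ _), ← integral_const_mul]
      refine integral_congr_ae (Eventually.of_forall fun t => ?_)
      simp only [mul_pow, fourier_neg_one_pow, smul_eq_mul]
      ring
    simp only [h1] at h
    have h2 : cauchyInt f z = ∫ t, ∑' n : ℕ, (z * fourier (-1) t) ^ n * f t ∂m := by
      refine integral_congr_ae (Eventually.of_forall fun t => ?_)
      simp only
      rw [tsum_mul_right, tsum_geometric_of_norm_lt_one]
      rw [norm_mul, norm_fourier_apply, mul_one]; exact hz
    rw [h2]; exact h
  · have h2 : ∀ n : ℕ, ∫ t, ‖(z * fourier (-1) t) ^ n * f t‖ ∂m = ‖z‖ ^ n * ∫ t, ‖f t‖ ∂m := by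
      intro n
      rw [← integral_const_mul]
      refine integral_congr_ae (Eventually.of_forall fun t => ?_)
      simp only [norm_mul, norm_pow, norm_fourier_apply, mul_one]
    simp only [h2]
    exact (summable_geometric_of_lt_one (norm_nonneg _) hz).mul_right _

theorem differentiableOn_cauchyInt {f : Torus → ℂ} (hf : Integrable f m) :
    DifferentiableOn ℂ (cauchyInt f) (Metric.ball 0 1) := by
  have hB : ∀ n : ℕ, ‖fourierCoeff f n‖ ≤ ∫ t, ‖f t‖ ∂m := fun n => by
    refine (norm_integral_le_integral_norm _).trans_eq ?_
    refine integral_congr_ae (Eventually.of_forall fun t => ?_)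
    simp only [norm_smul, norm_fourier_apply, one_mul]
  intro z hz
  rw [mem_ball_zero_iff] at hz
  obtain ⟨R, hR1, hR2⟩ := exists_between hz
  have hR0 : 0 ≤ R := (norm_nonneg z).trans hR1.le
  have key : DifferentiableOn ℂ (fun z => ∑' n : ℕ, fourierCoeff f n * z ^ n)
      (Metric.ball 0 R) := by
    refine Complex.differentiableOn_tsum_of_summable_norm
      (u := fun n => (∫ t, ‖f t‖ ∂m) * R ^ n)
      ((summable_geometric_of_lt_one hR0 hR2).mul_left _)
      (fun n => by fun_prop) Metric.isOpen_ball ?_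
    intro n w hw
    rw [mem_ball_zero_iff] at hw
    rw [norm_mul, norm_pow]
    gcongr
    exact hB n
  have hmem : Metric.ball (0 : ℂ) R ∈ 𝓝 z :=
    Metric.isOpen_ball.mem_nhds (mem_ball_zero_iff.2 hR1)
  refine ((key.differentiableAt hmem).congr_of_eventuallyEq ?_).differentiableWithinAt
  filter_upwards [hmem] with w hw
  exact (hasSum_cauchyInt hf ((mem_ball_zero_iff.1 hw).trans hR2)).tsum_eq.symm

theorem cauchyInt_zero (f : Torus → ℂ) : cauchyInt f 0 = fourierCoeff f 0 := by
  simp [cauchyInt, fourierCoeff]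

theorem cauchyInt_add {f g : Torus → ℂ} (hf : Integrable f m) (hg : Integrable g m) {z : ℂ}
    (hz : ‖z‖ < 1) : cauchyInt (fun t => f t + g t) z = cauchyInt f z + cauchyInt g z := by
  simp only [cauchyInt, mul_add]
  exact integral_add (integrable_cauchyKernel_mul hf hz) (integrable_cauchyKernel_mul hg hz)

theorem cauchyInt_const_mul (c : ℂ) (f : Torus → ℂ) (z : ℂ) :
    cauchyInt (fun t => c * f t) z = c * cauchyInt f z := by
  simp only [cauchyInt]
  rw [← integral_const_mul]
  congr 1; ext t; ring

theorem cauchyInt_congr {f g : Torus → ℂ} (h : f =ᵐ[m] g) (z : ℂ) :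
    cauchyInt f z = cauchyInt g z :=
  integral_congr_ae (h.mono fun t ht => by simp only [ht])

/-! ### The Poisson kernel -/

/-- The Poisson kernel `Re ((1 + z) / (1 - z))`, `z = r e^{ix}`. -/
def poissonKernel (r : ℝ) (x : Torus) : ℝ :=
  ((1 + (r : ℂ) * fourier 1 x) / (1 - (r : ℂ) * fourier 1 x)).re

/-- The norm on the quotient is the distance to the nearest multiple of 2π, and cosine is even and
periodic. This makes the Poisson kernel a function of ‖x‖ alone. -/
theorem re_fourier_one (x : Torus) : (fourier 1 x : ℂ).re = Real.cos ‖x‖ := by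
  induction x using QuotientAddGroup.induction_on with
  | H y =>
  rw [AddCircle.norm_eq, Real.cos_abs, Real.cos_sub_int_mul_two_pi, fourier_coe_apply]
  have : (2 * (π : ℂ) * Complex.I * (1 : ℤ) * y / ((2 * π : ℝ) : ℂ)) = y * Complex.I := by
    push_cast
    field_simp
  rw [this, Complex.exp_ofReal_mul_I_re]

theorem norm_le_pi (x : Torus) : ‖x‖ ≤ π := by
  have h := AddCircle.norm_le_half_period (2 * π) (x := x) Real.two_pi_pos.ne'
  rw [abs_of_pos Real.two_pi_pos] at h
  linarith

theorem normSq_one_sub_mul_fourier (r : ℝ) (x : Torus) :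
    Complex.normSq (1 - r * fourier 1 x) = 1 - 2 * r * Real.cos ‖x‖ + r ^ 2 := by
  have h1 : Complex.normSq (fourier 1 x : ℂ) = 1 := by
    rw [Complex.normSq_eq_norm_sq, norm_fourier_apply, one_pow]
  rw [← re_fourier_one]
  rw [Complex.normSq_apply] at h1 ⊢
  simp only [Complex.sub_re, Complex.sub_im, Complex.one_re, Complex.one_im,
    Complex.re_ofReal_mul, Complex.im_ofReal_mul]
  linear_combination r ^ 2 * h1

theorem poissonKernel_eq (r : ℝ) (x : Torus) :
    poissonKernel r x = (1 - r ^ 2) / (1 - 2 * r * Real.cos ‖x‖ + r ^ 2) := by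
  have h1 : Complex.normSq (fourier 1 x : ℂ) = 1 := by
    rw [Complex.normSq_eq_norm_sq, norm_fourier_apply, one_pow]
  rw [poissonKernel, Complex.div_re, ← normSq_one_sub_mul_fourier, ← add_div]
  congr 1
  rw [Complex.normSq_apply] at h1
  simp only [Complex.sub_re, Complex.sub_im, Complex.one_re, Complex.one_im, Complex.add_re,
    Complex.add_im, Complex.re_ofReal_mul, Complex.im_ofReal_mul]
  linear_combination (-r ^ 2) * h1

theorem poisson_denom_pos {r : ℝ} (hr : r ∈ Set.Ico (0 : ℝ) 1) (c : ℝ) :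
    0 < 1 - 2 * r * Real.cos c + r ^ 2 := by
  have h := Real.cos_le_one c
  nlinarith [hr.1, hr.2, mul_nonneg hr.1 (sub_nonneg.2 h), sq_pos_of_pos (sub_pos.2 hr.2)]

theorem poissonKernel_nonneg {r : ℝ} (hr : r ∈ Set.Ico (0 : ℝ) 1) (x : Torus) :
    0 ≤ poissonKernel r x := by
  rw [poissonKernel_eq]
  exact div_nonneg (by nlinarith [hr.1, hr.2]) (poisson_denom_pos hr _).le

theorem poissonKernel_anti {r : ℝ} (hr : r ∈ Set.Ico (0 : ℝ) 1) {x y : Torus}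
    (h : ‖x‖ ≤ ‖y‖) : poissonKernel r y ≤ poissonKernel r x := by
  rw [poissonKernel_eq, poissonKernel_eq]
  have hc := Real.cos_le_cos_of_nonneg_of_le_pi (norm_nonneg x) (norm_le_pi y) h
  refine div_le_div_of_nonneg_left (by nlinarith [hr.1, hr.2]) (poisson_denom_pos hr _) ?_
  nlinarith [mul_nonneg hr.1 (sub_nonneg.2 hc)]

theorem one_sub_ne_zero_of_mem {r : ℝ} (hr : r ∈ Set.Ico (0 : ℝ) 1) (x : Torus) :
    1 - (r : ℂ) * fourier 1 x ≠ 0 :=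
  one_sub_mul_fourier_ne_zero (z := r)
    (by rw [Complex.norm_real, Real.norm_of_nonneg hr.1]; exact hr.2) 1 x

theorem continuous_herglotzKernel {r : ℝ} (hr : r ∈ Set.Ico (0 : ℝ) 1) :
    Continuous fun x : Torus => (1 + (r : ℂ) * fourier 1 x) / (1 - (r : ℂ) * fourier 1 x) :=
  (continuous_const.add (continuous_const.mul (fourier 1).continuous)).div
    (continuous_const.sub (continuous_const.mul (fourier 1).continuous))
    (one_sub_ne_zero_of_mem hr)

theorem continuous_poissonKernel {r : ℝ} (hr : r ∈ Set.Ico (0 : ℝ) 1) :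
    Continuous (poissonKernel r) :=
  Complex.continuous_re.comp (continuous_herglotzKernel hr)

theorem continuous_conjPoissonKernel {r : ℝ} (hr : r ∈ Set.Ico (0 : ℝ) 1) :
    Continuous (conjPoissonKernel r) :=
  Complex.continuous_im.comp (continuous_herglotzKernel hr)

theorem integral_poissonKernel {r : ℝ} (hr : r ∈ Set.Ico (0 : ℝ) 1) :
    ∫ x, poissonKernel r x ∂m = 1 := by
  have h := integral_comp_mul_fourier (Φ := fun z => (1 + z) / (1 - z)) ?_ hr
  · have h2 := congrArg Complex.re h
    have h3 : Integrable (fun x : Torus =>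
        (1 + (r : ℂ) * fourier 1 x) / (1 - (r : ℂ) * fourier 1 x)) m :=
      (continuous_herglotzKernel hr).integrable_of_hasCompactSupport
        (HasCompactSupport.of_compactSpace _)
    have h4 := integral_re h3
    simp only [RCLike.re_to_complex] at h4
    rw [← h4] at h2
    simpa [poissonKernel] using h2
  · refine DifferentiableOn.div (by fun_prop) (by fun_prop) fun z hz h0 => ?_
    rw [mem_ball_zero_iff, ← sub_eq_zero.1 h0, norm_one] at hz
    exact lt_irrefl _ hz

theorem integral_poissonKernel_sub {r : ℝ} (hr : r ∈ Set.Ico (0 : ℝ) 1) (x : Torus) :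
    ∫ t, poissonKernel r (x - t) ∂m = 1 := by
  rw [integral_sub_left_eq_self (poissonKernel r) m x, integral_poissonKernel hr]

theorem integrable_of_continuous_torus {f : Torus → ℝ} (hf : Continuous f) : Integrable f m :=
  hf.integrable_of_hasCompactSupport (HasCompactSupport.of_compactSpace _)

/-- A continuous kernel against an integrable function. -/
theorem integrable_kernel_mul {k : Torus → ℂ} (hk : Continuous k) {f : Torus → ℂ}
    (hf : Integrable f m) (x : Torus) : Integrable (fun t => k (x - t) * f t) m := by
  obtain ⟨C, hC⟩ := isCompact_univ.exists_bound_of_continuousOn hk.continuousOn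
  exact hf.bdd_mul (c := C) (hk.comp (continuous_const.sub continuous_id)).aestronglyMeasurable
    (Eventually.of_forall fun t => hC _ (Set.mem_univ _))

/-- The Poisson integral. -/
def poissonInt (f : Torus → ℂ) (r : ℝ) (x : Torus) : ℂ :=
  ∫ t, (poissonKernel r (x - t) : ℂ) * f t ∂m

theorem mul_fourier_mul_fourier_neg (r : ℝ) (x t : Torus) :
    (r : ℂ) * fourier 1 x * fourier (-1) t = r * fourier 1 (x - t) := by
  rw [fourier_sub_apply, mul_assoc]

/-- The kernel identity 2/(1-w) - 1 = (1+w)/(1-w) with w = r e^{i(x-t)}: it ties the definition of P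
through the conjugate function to Cauchy integrals. -/
theorem two_mul_cauchyInt_sub {f : Torus → ℂ} (hf : Integrable f m) {r : ℝ}
    (hr : r ∈ Set.Ico (0 : ℝ) 1) (x : Torus) :
    2 * cauchyInt f (r * fourier 1 x) - fourierCoeff f 0 =
      poissonInt f r x +
        Complex.I * ∫ t, (conjPoissonKernel r (x - t) : ℂ) * f t ∂m := by
  have hz : ‖(r : ℂ) * fourier 1 x‖ < 1 := mem_ball_zero_iff.1 (mul_fourier_mem_ball hr 1 x)
  rw [cauchyInt, fourierCoeff, poissonInt, ← integral_const_mul, ← integral_const_mul,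
    ← integral_sub, ← integral_add]
  · refine integral_congr_ae (Eventually.of_forall fun t => ?_)
    have h1 := one_sub_ne_zero_of_mem hr (x - t)
    have h2 := Complex.re_add_im
      ((1 + (r : ℂ) * fourier 1 (x - t)) / (1 - (r : ℂ) * fourier 1 (x - t)))
    simp only [mul_fourier_mul_fourier_neg, neg_zero, fourier_zero, one_smul]
    rw [poissonKernel, conjPoissonKernel, mul_left_comm Complex.I, ← mul_assoc, ← mul_assoc,
      ← add_mul, h2]
    field_simp
    ring
  · exact integrable_kernel_mul
      (Complex.continuous_ofReal.comp (continuous_poissonKernel hr)) hf x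
  · exact (integrable_kernel_mul
      (Complex.continuous_ofReal.comp (continuous_conjPoissonKernel hr)) hf x).const_mul _
  · exact (integrable_cauchyKernel_mul hf hz).const_mul _
  · simpa using hf

/-! ### Lebesgue points and Fatou's theorem on Poisson integrals -/

theorem ae_m_iff {p : Torus → Prop} : (∀ᵐ x ∂m, p x) ↔ ∀ᵐ x ∂(volume : Measure Torus), p x := by
  rw [AddCircle.volume_eq_smul_haarAddCircle]
  rw [Measure.ae_ennreal_smul_measure_iff]
  simp [Real.pi_pos]

theorem measure_closedBall_eq_ball (x : Torus) (ρ : ℝ) :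
    m (Metric.closedBall x ρ) = m (Metric.ball x ρ) := by
  refine measure_congr ?_
  exact ae_m_iff.2 AddCircle.closedBall_ae_eq_ball

/-- At a Lebesgue point, the integral of `‖f - f x‖` over small balls is small. -/
theorem ae_lebesgue_point {f : Torus → ℂ} (hf : Integrable f m) :
    ∀ᵐ x ∂m, ∀ ε : ℝ≥0∞, 0 < ε → ∃ δ > 0, ∀ ρ ≤ δ,
      ∫⁻ t in Metric.closedBall x ρ, ‖f t - f x‖ₑ ∂m ≤ ε * m (Metric.closedBall x ρ) := by
  have hT : ENNReal.ofReal (2 * π) ≠ 0 := by simp [Real.pi_pos]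
  have hvol : Integrable f volume := by
    rw [AddCircle.volume_eq_smul_haarAddCircle]
    exact hf.smul_measure ENNReal.ofReal_ne_top
  rw [ae_m_iff]
  filter_upwards [IsUnifLocDoublingMeasure.ae_tendsto_average_norm_sub volume
    hvol.locallyIntegrable 1] with x hx ε hε
  have h1 := hx (l := 𝓝[>] (0 : ℝ)) (fun _ => x) id tendsto_id (by
    filter_upwards [self_mem_nhdsWithin] with ρ hρ
    simpa using (Set.mem_Ioi.1 hρ).le)
  obtain ⟨η, hη0, hη⟩ : ∃ η : ℝ, 0 < η ∧ ENNReal.ofReal η ≤ ε := by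
    rcases eq_or_ne ε ∞ with rfl | h
    · exact ⟨1, one_pos, le_top⟩
    · exact ⟨ε.toReal, ENNReal.toReal_pos hε.ne' h, ENNReal.ofReal_toReal_le⟩
  have h2 := (h1.eventually (gt_mem_nhds hη0))
  obtain ⟨δ, hδ0, hδ⟩ := (mem_nhdsGT_iff_exists_Ioc_subset.1 h2)
  refine ⟨δ, hδ0, fun ρ hρ => ?_⟩
  -- Balls of nonpositive radius are null, so no sign condition on the radius is needed when it is
  -- later chosen as a supremum.
  rcases le_or_gt ρ 0 with h0 | h0
  · have : m (Metric.closedBall x ρ) = 0 := by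
      rw [measure_closedBall_eq_ball, Metric.ball_eq_empty.2 h0, measure_empty]
    rw [Measure.restrict_eq_zero.2 this]; simp
  have h3 : ⨍ y in Metric.closedBall x ρ, ‖f y - f x‖ < η := hδ ⟨h0, hρ⟩
  have hvpos : 0 < (volume (Metric.closedBall x ρ)).toReal := by
    rw [AddCircle.volume_closedBall, ENNReal.toReal_ofReal]
    · have := Real.pi_pos; positivity
    · have := Real.pi_pos; positivity
  have hInt : IntegrableOn (fun y => ‖f y - f x‖) (Metric.closedBall x ρ) volume :=
    ((hvol.sub (integrable_const _)).norm).integrableOn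
  rw [setAverage_eq, smul_eq_mul, Measure.real, inv_mul_lt_iff₀ hvpos] at h3
  have h4 : ∫⁻ t in Metric.closedBall x ρ, ‖f t - f x‖ₑ ≤
      ε * volume (Metric.closedBall x ρ) := by
    calc ∫⁻ t in Metric.closedBall x ρ, ‖f t - f x‖ₑ
        = ENNReal.ofReal (∫ t in Metric.closedBall x ρ, ‖f t - f x‖) := by
          rw [ofReal_integral_eq_lintegral_ofReal hInt
            (Eventually.of_forall fun _ => norm_nonneg _)]
          simp only [ofReal_norm]
      _ ≤ ENNReal.ofReal ((volume (Metric.closedBall x ρ)).toReal * η) :=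
          ENNReal.ofReal_le_ofReal h3.le
      _ = volume (Metric.closedBall x ρ) * ENNReal.ofReal η := by
          rw [ENNReal.ofReal_mul hvpos.le, ENNReal.ofReal_toReal (measure_ne_top _ _)]
      _ ≤ ε * volume (Metric.closedBall x ρ) := by rw [mul_comm]; gcongr
  rw [AddCircle.volume_eq_smul_haarAddCircle] at h4
  simp only [Measure.restrict_smul, lintegral_smul_measure, Measure.smul_apply, smul_eq_mul] at h4
  rw [mul_left_comm] at h4
  exact (ENNReal.mul_le_mul_iff_right hT ENNReal.ofReal_ne_top).1 h4

/-- A radially decreasing kernel sees a function only through its integrals over balls. -/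
theorem lintegral_radial_le {k : Torus → ℝ} (hk : Continuous k) (hk0 : ∀ t, 0 ≤ k t)
    {x : Torus} (hanti : ∀ s t, ‖x - s‖ ≤ ‖x - t‖ → k t ≤ k s) {h : Torus → ℝ≥0∞}
    (hh : AEMeasurable h m) {ε : ℝ≥0∞} (hε : ε ≠ ∞) {δ : ℝ}
    (hball : ∀ ρ ≤ δ, ∫⁻ t in Metric.closedBall x ρ, h t ∂m ≤ ε * m (Metric.closedBall x ρ)) :
    ∫⁻ t in Metric.ball x δ, ENNReal.ofReal (k t) * h t ∂m ≤
      ε * ∫⁻ t, ENNReal.ofReal (k t) ∂m := by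
  -- Layer-cake formula: integrating k against h dm on the ball reduces the claim to one superlevel
  -- set of k at a time.
  set μ : Measure Torus := (m.restrict (Metric.ball x δ)).withDensity h with hμ
  have h1 : ∫⁻ t in Metric.ball x δ, ENNReal.ofReal (k t) * h t ∂m =
      ∫⁻ t, ENNReal.ofReal (k t) ∂μ := by
    rw [hμ, lintegral_withDensity_eq_lintegral_mul₀ hh.restrict
      hk.measurable.ennreal_ofReal.aemeasurable]
    simp only [Pi.mul_apply, mul_comm]
  rw [h1, lintegral_eq_lintegral_meas_lt μ (Eventually.of_forall hk0) hk.aemeasurable,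
    lintegral_eq_lintegral_meas_lt m (Eventually.of_forall hk0) hk.aemeasurable,
    ← lintegral_const_mul' _ _ hε]
  refine lintegral_mono fun lam => ?_
  set A : Set Torus := {t | lam < k t} ∩ Metric.ball x δ with hA
  have hAopen : IsOpen A := (isOpen_lt continuous_const hk).inter Metric.isOpen_ball
  have h2 : μ {t | lam < k t} = ∫⁻ t in A, h t ∂m := by
    rw [hμ, withDensity_apply _ (isOpen_lt continuous_const hk).measurableSet,
      Measure.restrict_restrict (isOpen_lt continuous_const hk).measurableSet]
  rw [h2]
  refine le_trans ?_ (mul_le_mul_right (measure_mono (Set.inter_subset_left :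
    A ⊆ {t | lam < k t})) ε)
  rcases A.eq_empty_or_nonempty with hAe | hAne
  · rw [hAe]; simp
  set S := (fun t => ‖x - t‖) '' A
  have hSb : BddAbove S := ⟨δ, by
    rintro _ ⟨t, ht, rfl⟩
    have := ht.2
    rw [Metric.mem_ball, dist_comm, dist_eq_norm] at this
    exact this.le⟩
  -- By radial monotonicity A lies between the open and the closed ball of radius ρ, and these have
  -- equal measure.
  set ρ := sSup S
  have hρδ : ρ ≤ δ := csSup_le (hAne.image _) (by
    rintro _ ⟨t, ht, rfl⟩
    have := ht.2
    rw [Metric.mem_ball, dist_comm, dist_eq_norm] at this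
    exact this.le)
  have hA1 : A ⊆ Metric.closedBall x ρ := fun t ht => by
    rw [Metric.mem_closedBall, dist_comm, dist_eq_norm]
    exact le_csSup hSb ⟨t, ht, rfl⟩
  have hA2 : Metric.ball x ρ ⊆ A := fun t ht => by
    rw [Metric.mem_ball, dist_comm, dist_eq_norm] at ht
    obtain ⟨_, ⟨s, hs, rfl⟩, hlt⟩ := exists_lt_of_lt_csSup (hAne.image _) ht
    refine ⟨lt_of_lt_of_le (Set.mem_ofPred.1 hs.1) (hanti t s hlt.le), ?_⟩
    rw [Metric.mem_ball, dist_comm, dist_eq_norm]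
    exact ht.trans_le hρδ
  calc ∫⁻ t in A, h t ∂m ≤ ∫⁻ t in Metric.closedBall x ρ, h t ∂m := lintegral_mono_set hA1
    _ ≤ ε * m (Metric.closedBall x ρ) := hball ρ hρδ
    _ = ε * m (Metric.ball x ρ) := by rw [measure_closedBall_eq_ball]
    _ ≤ ε * m A := by gcongr

theorem tendsto_poisson_bound {δ : ℝ} (hδ0 : 0 < δ) (hδ : δ ≤ π) :
    Tendsto (fun r : ℝ => (1 - r ^ 2) / (1 - 2 * r * Real.cos δ + r ^ 2)) (𝓝[<] 1) (𝓝 0) := by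
  have hc : Real.cos δ < 1 := by
    have := Real.cos_lt_cos_of_nonneg_of_le_pi le_rfl hδ hδ0
    rwa [Real.cos_zero] at this
  have h : ContinuousAt (fun r : ℝ => (1 - r ^ 2) / (1 - 2 * r * Real.cos δ + r ^ 2)) 1 := by
    refine ContinuousAt.div (by fun_prop) (by fun_prop) ?_
    intro h
    nlinarith
  have h2 := h.tendsto.mono_left (nhdsWithin_le_nhds (s := Set.Iio 1))
  simpa using h2

theorem eventually_mem_Ioo : ∀ᶠ r : ℝ in 𝓝[<] 1, r ∈ Set.Ioo (0 : ℝ) 1 :=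
  Ioo_mem_nhdsLT one_pos

/-- Fatou's theorem: Poisson integrals converge radially a.e. -/
theorem ae_tendsto_poissonInt {f : Torus → ℂ} (hf : Integrable f m) :
    ∀ᵐ x ∂m, Tendsto (fun r => poissonInt f r x) (𝓝[<] 1) (𝓝 (f x)) := by
  filter_upwards [ae_lebesgue_point hf] with x hx
  rw [tendsto_iff_edist_tendsto_0, ENNReal.tendsto_nhds_zero]
  intro ε hε
  obtain ⟨ε', hε'0, hε'⟩ := exists_between (ENNReal.half_pos hε.ne')
  have hε'top : ε' ≠ ∞ := hε'.ne_top
  obtain ⟨δ₀, hδ₀, hball₀⟩ := hx ε' hε'0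
  set δ := min δ₀ π with hδdef
  have hδ0 : 0 < δ := lt_min hδ₀ Real.pi_pos
  have hball : ∀ ρ ≤ δ, ∫⁻ t in Metric.closedBall x ρ, ‖f t - f x‖ₑ ∂m ≤
      ε' * m (Metric.closedBall x ρ) := fun ρ hρ => hball₀ ρ (hρ.trans (min_le_left _ _))
  have hInt : Integrable (fun t => f t - f x) m := hf.sub (integrable_const _)
  set I := ∫⁻ t, ‖f t - f x‖ₑ ∂m with hI
  have hIfin : I ≠ ∞ := hInt.2.ne
  have hsmall : ∀ᶠ r : ℝ in 𝓝[<] 1,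
      ENNReal.ofReal ((1 - r ^ 2) / (1 - 2 * r * Real.cos δ + r ^ 2)) * I ≤ ε / 2 := by
    have h1 := ENNReal.tendsto_ofReal (tendsto_poisson_bound hδ0 (min_le_right δ₀ π))
    have h2 := ENNReal.Tendsto.mul_const (b := I) h1 (Or.inr hIfin)
    rw [ENNReal.ofReal_zero, zero_mul] at h2
    exact (ENNReal.tendsto_nhds_zero.1 h2) _ (ENNReal.half_pos hε.ne')
  filter_upwards [hsmall, eventually_mem_Ioo] with r hr hr01
  have hr' : r ∈ Set.Ico (0 : ℝ) 1 := ⟨hr01.1.le, hr01.2⟩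
  have hcont : Continuous fun t => poissonKernel r (x - t) :=
    (continuous_poissonKernel hr').comp (continuous_const.sub continuous_id)
  have e1 : poissonInt f r x - f x = ∫ t, (poissonKernel r (x - t) : ℂ) * (f t - f x) ∂m := by
    simp only [mul_sub]
    rw [integral_sub, integral_mul_const, integral_complex_ofReal,
      integral_poissonKernel_sub hr' x, Complex.ofReal_one, one_mul, poissonInt]
    · exact integrable_kernel_mul
        (Complex.continuous_ofReal.comp (continuous_poissonKernel hr')) hf x
    · exact integrable_kernel_mul
        (Complex.continuous_ofReal.comp (continuous_poissonKernel hr')) (integrable_const _) x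
  rw [edist_eq_enorm_sub, e1]
  calc ‖∫ t, (poissonKernel r (x - t) : ℂ) * (f t - f x) ∂m‖ₑ
      ≤ ∫⁻ t, ‖(poissonKernel r (x - t) : ℂ) * (f t - f x)‖ₑ ∂m := enorm_integral_le_lintegral_enorm _
    _ = ∫⁻ t, ENNReal.ofReal (poissonKernel r (x - t)) * ‖f t - f x‖ₑ ∂m := by
        congr 1; ext t
        rw [enorm_mul, ← ofReal_norm (poissonKernel r (x - t) : ℂ), Complex.norm_real,
          Real.norm_of_nonneg (poissonKernel_nonneg hr' _)]
    _ = (∫⁻ t in Metric.ball x δ, ENNReal.ofReal (poissonKernel r (x - t)) * ‖f t - f x‖ₑ ∂m) +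
        ∫⁻ t in (Metric.ball x δ)ᶜ, ENNReal.ofReal (poissonKernel r (x - t)) * ‖f t - f x‖ₑ ∂m :=
        (lintegral_add_compl _ Metric.isOpen_ball.measurableSet).symm
    -- Near x the kernel is radially decreasing with total mass one, so the Lebesgue point estimate
    -- applies; away from x it is at most its value at distance δ, which tends to 0 as r tends to 1.
    _ ≤ ε / 2 + ε / 2 := by
        gcongr
        · refine (lintegral_radial_le hcont (fun t => poissonKernel_nonneg hr' _)
            (fun s t hst => poissonKernel_anti hr' hst) hInt.1.enorm hε'top hball).trans ?_
          rw [← ofReal_integral_eq_lintegral_ofReal (integrable_of_continuous_torus hcont)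
            (Eventually.of_forall fun t => poissonKernel_nonneg hr' _),
            integral_poissonKernel_sub hr' x, ENNReal.ofReal_one, mul_one]
          exact hε'.le
        · refine le_trans ?_ hr
          rw [hI, ← lintegral_const_mul' _ _ ENNReal.ofReal_ne_top]
          refine (setLIntegral_mono' Metric.isOpen_ball.measurableSet.compl ?_).trans
            (setLIntegral_le_lintegral _ _)
          intro t ht
          rw [Set.mem_compl_iff, Metric.mem_ball, not_lt, dist_comm, dist_eq_norm] at ht
          gcongr
          rw [poissonKernel_eq]
          have hc := Real.cos_le_cos_of_nonneg_of_le_pi hδ0.le (norm_le_pi (x - t)) ht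
          refine div_le_div_of_nonneg_left (by nlinarith [hr'.1, hr'.2])
            (poisson_denom_pos hr' _) ?_
          nlinarith [mul_nonneg hr'.1 (sub_nonneg.2 hc)]
    _ = ε := ENNReal.add_halves ε

/-! ### Radial limits of bounded analytic functions -/

theorem fourierCoeff_conj (g : Torus → ℂ) (n : ℤ) :
    fourierCoeff (fun t => starRingEnd ℂ (g t)) n = starRingEnd ℂ (fourierCoeff g (-n)) := by
  rw [fourierCoeff, fourierCoeff, ← integral_conj]
  refine integral_congr_ae (Eventually.of_forall fun t => ?_)
  simp only [smul_eq_mul, map_mul]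
  rw [fourier_neg, neg_neg]

/-- The Poisson integral of an analytic function is its Cauchy integral. -/
theorem poissonInt_eq_cauchyInt {g : Torus → ℂ} (hg : Integrable g m)
    (hneg : ∀ n : ℤ, n < 0 → fourierCoeff g n = 0) {r : ℝ} (hr : r ∈ Set.Ico (0 : ℝ) 1)
    (x : Torus) : poissonInt g r x = cauchyInt g (r * fourier 1 x) := by
  have hz : ‖(r : ℂ) * fourier 1 x‖ < 1 := mem_ball_zero_iff.1 (mul_fourier_mem_ball hr 1 x)
  have hgc : Integrable (fun t => starRingEnd ℂ (g t)) m := hg.congr' (by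
    exact Complex.continuous_conj.comp_aestronglyMeasurable hg.1) (by simp)
  -- The conjugate of g has no Fourier coefficients of positive index, so its Cauchy integral is
  -- constant.
  have h1 : cauchyInt (fun t => starRingEnd ℂ (g t)) (r * fourier 1 x) =
      starRingEnd ℂ (fourierCoeff g 0) := by
    refine (hasSum_cauchyInt hgc hz).unique ?_
    convert hasSum_ite_eq (0 : ℕ) (starRingEnd ℂ (fourierCoeff g 0)) using 2 with n
    rw [fourierCoeff_conj]
    split_ifs with h
    · subst h; simp
    · rw [hneg (-(n : ℤ)) (by omega)]; simp
  -- The Poisson kernel is 1/(1-w) plus its conjugate, minus 1.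
  have h2 : poissonInt g r x = cauchyInt g (r * fourier 1 x) +
      starRingEnd ℂ (cauchyInt (fun t => starRingEnd ℂ (g t)) (r * fourier 1 x)) -
        fourierCoeff g 0 := by
    have hInt2 : Integrable (fun t => starRingEnd ℂ
        ((1 - (r : ℂ) * fourier 1 x * fourier (-1) t)⁻¹ * starRingEnd ℂ (g t))) m :=
      (integrable_cauchyKernel_mul hgc hz).congr' (by
        exact Complex.continuous_conj.comp_aestronglyMeasurable
          (integrable_cauchyKernel_mul hgc hz).1)
        (Eventually.of_forall fun t => (RCLike.norm_conj _).symm)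
    rw [cauchyInt, cauchyInt, ← integral_conj, fourierCoeff, poissonInt, ← integral_add,
      ← integral_sub]
    · refine integral_congr_ae (Eventually.of_forall fun t => ?_)
      have h1 := one_sub_ne_zero_of_mem hr (x - t)
      simp only [mul_fourier_mul_fourier_neg, neg_zero, fourier_zero, one_smul, poissonKernel]
      rw [Complex.re_eq_add_conj]
      have h1c : 1 - (r : ℂ) * starRingEnd ℂ (fourier 1 (x - t)) ≠ 0 := by
        intro h; apply h1
        have := congrArg (starRingEnd ℂ) h
        simpa using this
      simp only [map_mul, map_inv₀, map_sub, map_one, map_div₀, map_add, Complex.conj_conj,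
        Complex.conj_ofReal]
      field_simp
      ring
    · exact (integrable_cauchyKernel_mul hg hz).add hInt2
    · simpa using hg
    · exact integrable_cauchyKernel_mul hg hz
    · exact hInt2
  rw [h2, h1, Complex.conj_conj]; ring

theorem fourierCoeff_comp_mul_fourier {Φ : ℂ → ℂ} {a : ℕ → ℂ} {r : ℝ}
    (hsum : Summable fun n => ‖a n‖ * r ^ n) (hr : 0 ≤ r)
    (ha : ∀ x : Torus, HasSum (fun n => a n * (r * fourier 1 x) ^ n) (Φ (r * fourier 1 x)))
    (k : ℤ) : fourierCoeff (fun x : Torus => Φ (r * fourier 1 x)) k =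
      if 0 ≤ k then a k.toNat * r ^ k.toNat else 0 := by
  have h := hasSum_integral_of_summable_integral_norm (μ := m)
    (F := fun (n : ℕ) (x : Torus) => fourier (-k) x * (a n * (r * fourier 1 x) ^ n))
    (fun n => (Continuous.integrable_of_hasCompactSupport
      (by fun_prop) (HasCompactSupport.of_compactSpace _))) ?_
  · have h1 : ∀ n : ℕ, ∫ x, fourier (-k) x * (a n * (r * fourier 1 x) ^ n) ∂m =
        if (n : ℤ) = k then a n * r ^ n else 0 := by
      intro n
      have h2 := congrFun (fourierCoeff_fourier (T := 2 * π) (n : ℤ)) k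
      rw [fourierCoeff] at h2
      have h3 : ∀ x : Torus, (fourier (-k) x * (a n * (r * fourier 1 x) ^ n) : ℂ) =
          (a n * r ^ n) * (fourier (-k) x • fourier n x) := fun x => by
        rw [mul_pow, fourier_one_pow, smul_eq_mul]; ring
      simp only [h3]
      rw [integral_const_mul, h2, Pi.single_apply]
      by_cases hk : k = n <;> simp [hk, eq_comm]
    simp only [h1] at h
    have h4 : fourierCoeff (fun x : Torus => Φ (r * fourier 1 x)) k =
        ∫ x, ∑' n : ℕ, fourier (-k) x * (a n * (r * fourier 1 x) ^ n) ∂m := by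
      rw [fourierCoeff]
      refine integral_congr_ae (Eventually.of_forall fun x => ?_)
      simp only [smul_eq_mul]
      rw [tsum_mul_left, (ha x).tsum_eq]
    rw [h4]
    refine h.unique ?_
    split_ifs with hk
    · have e : (fun n : ℕ => if (n : ℤ) = k then a n * (r : ℂ) ^ n else 0) =
          fun n => if n = k.toNat then a k.toNat * (r : ℂ) ^ k.toNat else 0 := by
        funext n
        by_cases hn : (n : ℤ) = k
        · have : n = k.toNat := by omega
          subst this; simp [hk]
        · have : n ≠ k.toNat := by omega
          simp [hn, this]
      rw [e]
      exact hasSum_ite_eq k.toNat _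
    · convert hasSum_zero using 2 with n
      rw [if_neg]; omega
  · have h2 : ∀ n : ℕ, ∫ x : Torus, ‖fourier (-k) x * (a n * (r * fourier 1 x) ^ n)‖ ∂m =
        ‖a n‖ * r ^ n := by
      intro n
      have : ∀ x : Torus, ‖(fourier (-k) x * (a n * (r * fourier 1 x) ^ n) : ℂ)‖ =
          ‖a n‖ * r ^ n := fun x => by
        rw [norm_mul, norm_mul, norm_pow, norm_mul_fourier hr, norm_fourier_apply, one_mul]
      simp only [this]
      simp
    simp only [h2]
    exact hsum

/-- Parseval on the circle of radius r bounds ∑ |a_n|² r^{2n} by M². Letting r tend to 1 puts the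
Taylor coefficients in ℓ², and Riesz–Fischer provides an L² function with these coefficients, whose
Poisson integral is Φ. -/
theorem exists_memLp_of_bounded {Φ : ℂ → ℂ} (hΦ : DifferentiableOn ℂ Φ (Metric.ball 0 1))
    {M : ℝ} (hM : ∀ z ∈ Metric.ball (0 : ℂ) 1, ‖Φ z‖ ≤ M) :
    ∃ g : Torus → ℂ, Integrable g m ∧ ∀ r ∈ Set.Ico (0 : ℝ) 1, ∀ x,
      Φ (r * fourier 1 x) = poissonInt g r x := by
  set a : ℕ → ℂ := fun n => (n.factorial : ℂ)⁻¹ * iteratedDeriv n Φ 0 with ha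
  have hs : ∀ z ∈ Metric.ball (0 : ℂ) 1, HasSum (fun n => a n * z ^ n) (Φ z) := fun z hz => by
    have h := Complex.hasSum_taylorSeries_on_ball (f := Φ) (c := 0) (r := 1) (by
      exact_mod_cast hΦ) (z := z) (by exact_mod_cast hz)
    have e : (fun n => a n * z ^ n) = fun n : ℕ =>
        (n.factorial : ℂ)⁻¹ • (z - 0) ^ n • iteratedDeriv n Φ 0 := by
      funext n
      simp only [ha, sub_zero, smul_eq_mul]; ring
    rw [e]; exact h
  have hsn : ∀ r ∈ Set.Ico (0 : ℝ) 1, Summable fun n => ‖a n‖ * r ^ n := fun r hr => by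
    have := (hs r (by rw [mem_ball_zero_iff, Complex.norm_real, Real.norm_of_nonneg hr.1]
                      exact hr.2)).summable.norm
    simpa [norm_mul, norm_pow, abs_of_nonneg hr.1] using this
  have hco : ∀ r ∈ Set.Ico (0 : ℝ) 1, ∀ k : ℤ,
      fourierCoeff (fun x : Torus => Φ (r * fourier 1 x)) k =
        if 0 ≤ k then a k.toNat * r ^ k.toNat else 0 := fun r hr k =>
    fourierCoeff_comp_mul_fourier (hsn r hr) hr.1
      (fun x => hs _ (mul_fourier_mem_ball hr 1 x)) k
  set b : ℤ → ℂ := fun k => if 0 ≤ k then a k.toNat else 0 with hb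
  have hbsum : ∀ s : Finset ℤ, ∑ k ∈ s, ‖b k‖ ^ 2 ≤ M ^ 2 := by
    intro s
    have h1 : ∀ r ∈ Set.Ico (0 : ℝ) 1, ∑ k ∈ s, ‖b k * r ^ k.toNat‖ ^ 2 ≤ M ^ 2 := by
      intro r hr
      let Φr : C(Torus, ℂ) := ⟨fun x => Φ (r * fourier 1 x),
        continuous_comp_mul_fourier hΦ.continuousOn hr⟩
      have h2 := hasSum_sq_fourierCoeff (ContinuousMap.toLp (E := ℂ) 2 m ℂ Φr)
      have h3 : ∀ k, fourierCoeff (ContinuousMap.toLp (E := ℂ) 2 m ℂ Φr) k =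
          b k * r ^ k.toNat := by
        intro k
        rw [fourierCoeff_toLp]
        refine (hco r hr k).trans ?_
        simp only [hb]; split_ifs <;> simp
      simp only [h3] at h2
      refine (sum_le_hasSum s (fun _ _ => by positivity) h2).trans ?_
      have h4 : ∀ᵐ x ∂m, ‖(ContinuousMap.toLp (E := ℂ) 2 m ℂ Φr) x‖ ^ 2 ≤ M ^ 2 := by
        filter_upwards [ContinuousMap.coeFn_toLp (E := ℂ) (p := 2) m (𝕜 := ℂ) Φr] with x hx
        rw [hx]
        gcongr
        exact hM _ (mul_fourier_mem_ball hr 1 x)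
      refine (integral_mono_of_nonneg (Eventually.of_forall fun x => by positivity)
        (integrable_const _) h4).trans ?_
      simp
    have h5 : Tendsto (fun r : ℝ => ∑ k ∈ s, ‖b k * r ^ k.toNat‖ ^ 2) (𝓝[<] 1)
        (𝓝 (∑ k ∈ s, ‖b k‖ ^ 2)) := by
      have : Continuous (fun r : ℝ => ∑ k ∈ s, ‖b k * r ^ k.toNat‖ ^ 2) := by fun_prop
      have h6 := (this.tendsto 1).mono_left (nhdsWithin_le_nhds (s := Set.Iio 1))
      simpa using h6
    refine le_of_tendsto h5 ?_
    filter_upwards [eventually_mem_Ioo] with r hr using h1 r ⟨hr.1.le, hr.2⟩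
  have hmem : Memℓp b 2 := memℓp_gen' (C := M ^ 2) (by simpa using hbsum)
  set g : Lp ℂ 2 m := (fourierBasis (T := 2 * π)).repr.symm ⟨b, hmem⟩ with hg
  have hgint : Integrable g m := (Lp.memLp g).integrable one_le_two
  have hgc : ∀ k, fourierCoeff g k = b k := fun k => by
    rw [← fourierBasis_repr, hg, LinearIsometryEquiv.apply_symm_apply]
  refine ⟨g, hgint, fun r hr x => ?_⟩
  rw [poissonInt_eq_cauchyInt hgint (fun n hn => by rw [hgc]; simp [hb, hn]) hr x]
  have hz := mul_fourier_mem_ball hr 1 x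
  refine (hs _ hz).unique ?_
  convert hasSum_cauchyInt hgint (mem_ball_zero_iff.1 hz) using 2 with n
  rw [hgc]; simp [hb]

/-- Bounded analytic functions have radial limits a.e. -/
theorem ae_exists_tendsto_of_bounded {Φ : ℂ → ℂ}
    (hΦ : DifferentiableOn ℂ Φ (Metric.ball 0 1))
    {M : ℝ} (hM : ∀ z ∈ Metric.ball (0 : ℂ) 1, ‖Φ z‖ ≤ M) :
    ∀ᵐ x ∂m, ∃ l, Tendsto (fun r : ℝ => Φ (r * fourier 1 x)) (𝓝[<] 1) (𝓝 l) := by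
  obtain ⟨g, hg, h⟩ := exists_memLp_of_bounded hΦ hM
  filter_upwards [ae_tendsto_poissonInt hg] with x hx
  refine ⟨g x, hx.congr' ?_⟩
  filter_upwards [eventually_mem_Ioo] with r hr using (h r ⟨hr.1.le, hr.2⟩ x).symm

theorem integrable_ofReal {f : Torus → ℝ} (hf : Integrable f m) :
    Integrable (fun t => (f t : ℂ)) m := hf.ofReal

/-- Fatou's lemma for sets. -/
theorem measure_le_of_eventually_mem {α : Type*} [MeasurableSpace α] {μ : Measure α}
    {A : Set α} {S : ℕ → Set α} {c : ℝ≥0∞} (hA : ∀ x ∈ A, ∀ᶠ n in atTop, x ∈ S n)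
    (hS : ∀ n, μ (S n) ≤ c) : μ A ≤ c := by
  have h1 : A ⊆ ⋃ k, ⋂ n ≥ k, S n := fun x hx => by
    obtain ⟨k, hk⟩ := eventually_atTop.1 (hA x hx)
    exact Set.mem_iUnion.2 ⟨k, Set.mem_iInter₂.2 hk⟩
  have hmono : Monotone fun k => ⋂ n ≥ k, S n := fun i j hij =>
    Set.biInter_subset_biInter_left fun n hn => le_trans hij hn
  refine (measure_mono h1).trans ?_
  rw [hmono.measure_iUnion]
  exact iSup_le fun k => (measure_mono (Set.biInter_subset_of_mem le_rfl)).trans (hS k)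

/-- A sequence in `(0, 1)` increasing to `1`. -/
theorem exists_seq_tendsto_one : ∃ u : ℕ → ℝ, (∀ n, u n ∈ Set.Ioo (0 : ℝ) 1) ∧
    Tendsto u atTop (𝓝[<] 1) := by
  obtain ⟨u, -, hu1, hu⟩ := exists_seq_strictMono_tendsto' (show (0 : ℝ) < 1 from one_pos)
  exact ⟨u, hu1, tendsto_nhdsWithin_iff.2 ⟨hu, Eventually.of_forall fun n => (hu1 n).2⟩⟩

/-! ### Herglotz integrals of nonnegative functions -/

/-- The Herglotz integral `z ↦ ∫ (e^{it} + z) / (e^{it} - z) f(t) dm(t)` of a real function. -/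
def herglotz (f : Torus → ℝ) (z : ℂ) : ℂ :=
  2 * cauchyInt (fun t => (f t : ℂ)) z - fourierCoeff (fun t => (f t : ℂ)) 0

theorem fourierCoeff_ofReal_zero (f : Torus → ℝ) :
    fourierCoeff (fun t => (f t : ℂ)) 0 = ((∫ t, f t ∂m : ℝ) : ℂ) := by
  simp only [fourierCoeff, neg_zero, fourier_zero, one_smul]
  exact integral_ofReal

theorem herglotz_zero (f : Torus → ℝ) : herglotz f 0 = ((∫ t, f t ∂m : ℝ) : ℂ) := by
  rw [herglotz, cauchyInt_zero, fourierCoeff_ofReal_zero]; ring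

theorem differentiableOn_herglotz {f : Torus → ℝ} (hf : Integrable f m) :
    DifferentiableOn ℂ (herglotz f) (Metric.ball 0 1) :=
  ((differentiableOn_cauchyInt (integrable_ofReal hf)).const_mul 2).sub_const _

theorem herglotz_eq_integral {f : Torus → ℝ} (hf : Integrable f m) {z : ℂ} (hz : ‖z‖ < 1) :
    herglotz f z = ∫ t, (2 * (1 - z * fourier (-1) t)⁻¹ - 1) * f t ∂m := by
  rw [herglotz, cauchyInt, fourierCoeff, ← integral_const_mul, ← integral_sub]
  · refine integral_congr_ae (Eventually.of_forall fun t => ?_)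
    simp only [neg_zero, fourier_zero, one_smul]
    ring
  · exact (integrable_cauchyKernel_mul (integrable_ofReal hf) hz).const_mul _
  · simpa using integrable_ofReal hf

theorem re_herglotz_nonneg {f : Torus → ℝ} (hf : Integrable f m) (hf0 : ∀ t, 0 ≤ f t) {z : ℂ}
    (hz : ‖z‖ < 1) : 0 ≤ (herglotz f z).re := by
  have hInt : Integrable (fun t => (2 * (1 - z * fourier (-1) t)⁻¹ - 1) * (f t : ℂ)) m := by
    have h := ((integrable_cauchyKernel_mul (integrable_ofReal hf) hz).const_mul 2).sub
      (integrable_ofReal hf)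
    refine h.congr (Eventually.of_forall fun t => ?_)
    simp only [Pi.sub_apply]
    simp; ring
  rw [herglotz_eq_integral hf hz]
  have h2 := integral_re hInt
  simp only [RCLike.re_to_complex] at h2
  rw [← h2]
  refine integral_nonneg fun t => ?_
  have h1 := one_sub_mul_fourier_ne_zero hz (-1) t
  have hw : ‖z * fourier (-1) t‖ < 1 := by rw [norm_mul, norm_fourier_apply, mul_one]; exact hz
  set w := z * fourier (-1) t
  have e : (2 * (1 - w)⁻¹ - 1 : ℂ) = (1 + w) / (1 - w) := by field_simp; ring
  simp only [Pi.zero_apply, Complex.re_mul_ofReal]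
  refine mul_nonneg ?_ (hf0 t)
  rw [e, Complex.div_re, ← add_div]
  refine div_nonneg ?_ (Complex.normSq_nonneg _)
  have hw2 : Complex.normSq w < 1 := by
    rw [Complex.normSq_eq_norm_sq]; nlinarith [norm_nonneg w]
  rw [Complex.normSq_apply] at hw2
  simp only [Complex.sub_re, Complex.sub_im, Complex.one_re, Complex.one_im, Complex.add_re,
    Complex.add_im]
  nlinarith

theorem re_herglotz_eq {f : Torus → ℝ} (hf : Integrable f m) {r : ℝ}
    (hr : r ∈ Set.Ico (0 : ℝ) 1) (x : Torus) :
    (herglotz f (r * fourier 1 x)).re = ∫ t, poissonKernel r (x - t) * f t ∂m := by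
  rw [herglotz, two_mul_cauchyInt_sub (integrable_ofReal hf) hr, poissonInt]
  simp only [← Complex.ofReal_mul]
  rw [integral_complex_ofReal, integral_complex_ofReal]
  simp

/-- After clearing denominators the inequality is |F|² ≥ λ²: the Möbius map F ↦ F/(F+λ) carries the
part |F| ≥ λ of the right half-plane into Re ≥ 1/2. It converts size of F into positivity, to which
the mean value property applies. -/
theorem half_le_re_div {F : ℂ} {lam : ℝ} (hl : 0 < lam) (hF : 0 ≤ F.re) (h : lam ≤ ‖F‖) :
    1 / 2 ≤ (F / (F + lam)).re := by
  have h1 : lam ^ 2 ≤ Complex.normSq F := by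
    rw [Complex.normSq_eq_norm_sq]; gcongr
  have h2 : 0 < Complex.normSq (F + lam) := by
    rw [Complex.normSq_pos]; intro h0
    have := congrArg Complex.re h0
    simp at this; linarith
  rw [Complex.div_re, ← add_div, le_div_iff₀ h2]
  rw [Complex.normSq_apply] at h1 ⊢
  simp only [Complex.add_re, Complex.add_im, Complex.ofReal_re, Complex.ofReal_im, add_zero]
  nlinarith

theorem re_div_nonneg {F : ℂ} {lam : ℝ} (hl : 0 < lam) (hF : 0 ≤ F.re) :
    0 ≤ (F / (F + lam)).re := by
  rw [Complex.div_re, ← add_div]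
  refine div_nonneg ?_ (Complex.normSq_nonneg _)
  simp only [Complex.add_re, Complex.add_im, Complex.ofReal_re, Complex.ofReal_im, add_zero]
  nlinarith [mul_nonneg hF hl.le]

theorem add_ofReal_ne_zero {F : ℂ} {lam : ℝ} (hl : 0 < lam) (hF : 0 ≤ F.re) :
    F + lam ≠ 0 := fun h0 => by
  have := congrArg Complex.re h0
  simp at this; linarith

/-- The weak type `(1, 1)` estimate for the Herglotz integral. -/
theorem measure_le_norm_herglotz {f : Torus → ℝ} (hf : Integrable f m) (hf0 : ∀ t, 0 ≤ f t)
    {r : ℝ} (hr : r ∈ Set.Ico (0 : ℝ) 1) {lam : ℝ} (hl : 0 < lam) :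
    m {x : Torus | lam ≤ ‖herglotz f (r * fourier 1 x)‖} ≤
      ENNReal.ofReal (2 * (∫ t, f t ∂m) / lam) := by
  -- The mean of Re Φ over the circle is Φ(0) ≤ (∫ f)/λ; Chebyshev's inequality at height 1/2 yields
  -- the factor 2.
  set Φ : ℂ → ℂ := fun z => herglotz f z / (herglotz f z + lam)
  have hre : ∀ z ∈ Metric.ball (0 : ℂ) 1, 0 ≤ (herglotz f z).re := fun z hz =>
    re_herglotz_nonneg hf hf0 (mem_ball_zero_iff.1 hz)
  have hΦ : DifferentiableOn ℂ Φ (Metric.ball 0 1) :=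
    (differentiableOn_herglotz hf).div ((differentiableOn_herglotz hf).add_const _)
      fun z hz => add_ofReal_ne_zero hl (hre z hz)
  have hcont := continuous_comp_mul_fourier hΦ.continuousOn hr
  have hInt : Integrable (fun x : Torus => Φ (r * fourier 1 x)) m :=
    hcont.integrable_of_hasCompactSupport (HasCompactSupport.of_compactSpace _)
  have h1 := integral_re hInt
  simp only [RCLike.re_to_complex] at h1
  rw [integral_comp_mul_fourier hΦ hr] at h1
  have hF0 : 0 ≤ ∫ t, f t ∂m := integral_nonneg hf0
  have h2 : (Φ 0).re ≤ (∫ t, f t ∂m) / lam := by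
    simp only [Φ, herglotz_zero]
    rw [← Complex.ofReal_add, ← Complex.ofReal_div, Complex.ofReal_re]
    gcongr; linarith
  have h3 := mul_meas_ge_le_integral_of_nonneg (μ := m)
    (f := fun x : Torus => (Φ (r * fourier 1 x)).re)
    (Eventually.of_forall fun x => re_div_nonneg hl (hre _ (mul_fourier_mem_ball hr 1 x)))
    hInt.re (1 / 2)
  rw [← ENNReal.ofReal_toReal (measure_ne_top m
    {x : Torus | lam ≤ ‖herglotz f (r * fourier 1 x)‖})]
  refine ENNReal.ofReal_le_ofReal ?_
  have h4 : m.real {x : Torus | lam ≤ ‖herglotz f (r * fourier 1 x)‖} ≤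
      m.real {x : Torus | 1 / 2 ≤ (Φ (r * fourier 1 x)).re} :=
    measureReal_mono fun x hx => half_le_re_div hl (hre _ (mul_fourier_mem_ball hr 1 x)) hx
  rw [Measure.real] at h4
  rw [mul_div_assoc]
  linarith

/-- The weak type `(1, 1)` estimate for the Cauchy integral. -/
theorem measure_lt_norm_cauchyInt {f : Torus → ℝ} (hf : Integrable f m) (hf0 : ∀ t, 0 ≤ f t)
    {r : ℝ} (hr : r ∈ Set.Ico (0 : ℝ) 1) {lam : ℝ} (hl : 0 < lam) :
    m {x : Torus | lam < ‖cauchyInt (fun t => (f t : ℂ)) (r * fourier 1 x)‖} ≤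
      ENNReal.ofReal (2 * (∫ t, f t ∂m) / lam) := by
  have hF0 : 0 ≤ ∫ t, f t ∂m := integral_nonneg hf0
  -- If λ ≤ ∫ f the bound is at least 2 and hence trivial. Otherwise twice the Cauchy integral is F
  -- + ∫ f, so a Cauchy integral larger than λ forces |F| > 2λ - ∫ f > λ.
  rcases le_or_gt lam (∫ t, f t ∂m) with h | h
  · refine prob_le_one.trans ?_
    rw [← ENNReal.ofReal_one]
    refine ENNReal.ofReal_le_ofReal ?_
    rw [le_div_iff₀ hl]; linarith
  · refine le_trans (measure_mono fun x hx => ?_) (measure_le_norm_herglotz hf hf0 hr hl)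
    rw [Set.mem_ofPred_eq] at hx ⊢
    rw [herglotz, fourierCoeff_ofReal_zero]
    have h1 := norm_sub_norm_le (2 * cauchyInt (fun t => (f t : ℂ)) (r * fourier 1 x))
      ((∫ t, f t ∂m : ℝ) : ℂ)
    rw [norm_mul, Complex.norm_real, Real.norm_of_nonneg hF0, Complex.norm_ofNat] at h1
    linarith

/-- Cauchy integrals of nonnegative integrable functions have radial limits a.e. -/
theorem ae_exists_tendsto_cauchyInt_of_nonneg {f : Torus → ℝ} (hf : Integrable f m)
    (hf0 : ∀ t, 0 ≤ f t) : ∀ᵐ x ∂m, ∃ l,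
      Tendsto (fun r : ℝ => cauchyInt (fun t => (f t : ℂ)) (r * fourier 1 x)) (𝓝[<] 1) (𝓝 l) := by
  -- F itself is unbounded, but 1/(F+1) is bounded by 1 and so has radial limits; these can be
  -- inverted wherever they are nonzero.
  set G : ℂ → ℂ := fun z => (herglotz f z + (1 : ℝ))⁻¹
  have hre : ∀ z ∈ Metric.ball (0 : ℂ) 1, 0 ≤ (herglotz f z).re := fun z hz =>
    re_herglotz_nonneg hf hf0 (mem_ball_zero_iff.1 hz)
  have hne : ∀ z ∈ Metric.ball (0 : ℂ) 1, herglotz f z + (1 : ℝ) ≠ 0 := fun z hz =>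
    add_ofReal_ne_zero one_pos (hre z hz)
  have hG : DifferentiableOn ℂ G (Metric.ball 0 1) :=
    ((differentiableOn_herglotz hf).add_const _).inv hne
  have hGb : ∀ z ∈ Metric.ball (0 : ℂ) 1, ‖G z‖ ≤ 1 := fun z hz => by
    simp only [G]
    rw [norm_inv]
    refine inv_le_one_of_one_le₀ ?_
    refine le_trans ?_ (Complex.re_le_norm _)
    simp only [Complex.add_re, Complex.ofReal_re]
    linarith [hre z hz]
  -- A zero limit of G means that |F| tends to infinity along the radius, which the weak type
  -- estimate, at every height N + 1, confines to a null set.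
  have hnull : ∀ᵐ x ∂m, ¬ Tendsto (fun r : ℝ => G (r * fourier 1 x)) (𝓝[<] 1) (𝓝 0) := by
    obtain ⟨u, hu1, hu⟩ := exists_seq_tendsto_one
    have hbound : ∀ N : ℕ,
        m {x | ¬ ¬ Tendsto (fun r : ℝ => G (r * fourier 1 x)) (𝓝[<] 1) (𝓝 0)} ≤
          ENNReal.ofReal (2 * (∫ t, f t ∂m) / ((N : ℝ) + 1)) := by
      intro N
      refine measure_le_of_eventually_mem
        (S := fun n => {x : Torus | (N : ℝ) + 1 ≤ ‖herglotz f (u n * fourier 1 x)‖}) ?_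
        fun n => measure_le_norm_herglotz hf hf0 ⟨(hu1 n).1.le, (hu1 n).2⟩ (by positivity)
      intro x hx
      rw [Set.mem_ofPred_eq, not_not] at hx
      have h1 := (hx.comp hu).norm
      rw [norm_zero] at h1
      filter_upwards [h1.eventually (gt_mem_nhds (show (0 : ℝ) < ((N : ℝ) + 2)⁻¹ by positivity))]
        with n hn
      simp only [Function.comp, G, norm_inv] at hn
      have hpos := norm_pos_iff.2 (hne _ (mul_fourier_mem_ball ⟨(hu1 n).1.le, (hu1 n).2⟩ 1 x))
      rw [inv_lt_inv₀ hpos (by positivity)] at hn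
      have h2 := norm_add_le (herglotz f (u n * fourier 1 x)) ((1 : ℝ) : ℂ)
      rw [Complex.norm_real, norm_one] at h2
      linarith
    have hlim : Tendsto (fun N : ℕ => ENNReal.ofReal (2 * (∫ t, f t ∂m) / ((N : ℝ) + 1))) atTop
        (𝓝 0) := by
      rw [← ENNReal.ofReal_zero]
      refine ENNReal.tendsto_ofReal (Tendsto.div_atTop tendsto_const_nhds ?_)
      exact tendsto_atTop_add_const_right _ _ tendsto_natCast_atTop_atTop
    rw [ae_iff]
    exact le_antisymm (ge_of_tendsto' hlim hbound) bot_le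
  filter_upwards [ae_exists_tendsto_of_bounded hG hGb, hnull] with x ⟨l, hl⟩ hx
  have hl0 : l ≠ 0 := fun h => hx (h ▸ hl)
  have h1 := (hl.inv₀ hl0)
  refine ⟨(l⁻¹ - (1 : ℝ) + fourierCoeff (fun t => (f t : ℂ)) 0) / 2, ?_⟩
  refine (((h1.sub_const ((1 : ℝ) : ℂ)).add_const
    (fourierCoeff (fun t => (f t : ℂ)) 0)).div_const 2).congr fun r => ?_
  simp only [G, inv_inv, herglotz]
  ring

/-! ### The `L^p` estimate for even `p` -/

theorem norm_pow_sub_pow_le_mul {a b : ℂ} {R : ℝ} (ha : ‖a‖ ≤ R) (hb : ‖b‖ ≤ R) (n : ℕ) :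
    ‖a ^ n - b ^ n‖ ≤ n * ‖a - b‖ * R ^ (n - 1) := by
  have hR : 0 ≤ R := (norm_nonneg a).trans ha
  rw [← Commute.geom_sum₂_mul (Commute.all a b), norm_mul]
  have : ‖∑ i ∈ Finset.range n, a ^ i * b ^ (n - 1 - i)‖ ≤ n * R ^ (n - 1) := by
    refine (norm_sum_le _ _).trans ?_
    refine (Finset.sum_le_card_nsmul _ _ (R ^ (n - 1)) fun i hi => ?_).trans_eq (by simp)
    rw [Finset.mem_range] at hi
    rw [norm_mul, norm_pow, norm_pow]
    calc ‖a‖ ^ i * ‖b‖ ^ (n - 1 - i) ≤ R ^ i * R ^ (n - 1 - i) := by gcongr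
      _ = R ^ (n - 1) := by rw [← pow_add]; congr 1; omega
  calc _ ≤ (n * R ^ (n - 1)) * ‖a - b‖ := by gcongr
    _ = _ := by ring

/-- If |Re z| is small against |z|, then z^{2k} is close to (i Im z)^{2k} = (-1)^k (Im z)^{2k}. The
threshold 8k makes each of the two errors at most |z|^{2k}/4, so (-1)^k Re z^{2k} ≥ |z|^{2k}/2.
Otherwise |z| ≤ 8k |Re z|, and the factor 3 also pays for a possibly negative first term. -/
theorem norm_pow_le_re_pow_add (k : ℕ) (hk : 1 ≤ k) (z : ℂ) :
    ‖z‖ ^ (2 * k) ≤ 2 * ((-1) ^ k * (z ^ (2 * k)).re) +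
      3 * (8 * k) ^ (2 * k) * z.re ^ (2 * k) := by
  set R := ‖z‖ with hR
  have hR0 : 0 ≤ R := norm_nonneg z
  have hpowre : |(z ^ (2 * k)).re| ≤ R ^ (2 * k) := by
    rw [hR, ← norm_pow]; exact Complex.abs_re_le_norm _
  have hsgn : |(-1 : ℝ) ^ k * (z ^ (2 * k)).re| ≤ R ^ (2 * k) := by
    rw [abs_mul, abs_pow, abs_neg, abs_one, one_pow, one_mul]; exact hpowre
  have hx0 : 0 ≤ z.re ^ (2 * k) := by rw [pow_mul]; positivity
  rcases le_or_gt (8 * k * |z.re|) R with h | h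
  · have him : ‖(z.im : ℂ) * Complex.I‖ ≤ R := by simpa using Complex.abs_im_le_norm z
    have hdiff : z - (z.im : ℂ) * Complex.I = (z.re : ℂ) := by
      nth_rewrite 1 [← Complex.re_add_im z]; ring
    have h1 := norm_pow_sub_pow_le_mul (le_refl R) him (2 * k)
    rw [hdiff, Complex.norm_real, Real.norm_eq_abs] at h1
    have hIpow : ((z.im : ℂ) * Complex.I) ^ (2 * k) = (((-1) ^ k * z.im ^ (2 * k) : ℝ) : ℂ) := by
      rw [mul_pow, pow_mul Complex.I, Complex.I_sq]; push_cast; ring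
    have h2 := (Complex.abs_re_le_norm (z ^ (2 * k) - ((z.im : ℂ) * Complex.I) ^ (2 * k))).trans h1
    rw [hIpow, Complex.sub_re, Complex.ofReal_re] at h2
    have h3 : |(-1 : ℝ) ^ k * (z ^ (2 * k)).re - z.im ^ (2 * k)| ≤
        (2 * k : ℕ) * |z.re| * R ^ (2 * k - 1) := by
      refine le_trans (le_of_eq ?_) h2
      have e : (-1 : ℝ) ^ k * (z ^ (2 * k)).re - z.im ^ (2 * k) =
          (-1 : ℝ) ^ k * ((z ^ (2 * k)).re - (-1) ^ k * z.im ^ (2 * k)) := by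
        have : ((-1 : ℝ) ^ k) * (-1) ^ k = 1 := by rw [← mul_pow]; simp
        rw [mul_sub, ← mul_assoc, this, one_mul]
      rw [e, abs_mul, abs_pow, abs_neg, abs_one, one_pow, one_mul]
    have h4 := norm_pow_sub_pow_le_mul (a := (R : ℂ)) (b := (|z.im| : ℝ)) (R := R)
      (by simp [abs_of_nonneg hR0]) (by simpa using Complex.abs_im_le_norm z) (2 * k)
    have h5 : R ^ (2 * k) - z.im ^ (2 * k) ≤ (2 * k : ℕ) * |z.re| * R ^ (2 * k - 1) := by
      rw [← Complex.ofReal_sub, ← Complex.ofReal_pow, ← Complex.ofReal_pow, ← Complex.ofReal_sub,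
        Complex.norm_real, Complex.norm_real, Real.norm_eq_abs, Real.norm_eq_abs] at h4
      have h6 : abs (R - |z.im|) ≤ |z.re| := by
        rw [abs_of_nonneg (sub_nonneg.2 (Complex.abs_im_le_norm z))]
        linarith [Complex.norm_le_abs_re_add_abs_im z]
      have h7 : |z.im| ^ (2 * k) = z.im ^ (2 * k) := by rw [pow_mul, pow_mul, sq_abs]
      rw [h7] at h4
      refine (le_abs_self _).trans (h4.trans ?_)
      gcongr
    have h8 : (2 * k : ℕ) * |z.re| * R ^ (2 * k - 1) ≤ R ^ (2 * k) / 4 := by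
      have e : R ^ (2 * k) = R * R ^ (2 * k - 1) := by
        rw [← pow_succ']; congr 1; omega
      rw [e]; push_cast
      have : 0 ≤ R ^ (2 * k - 1) := by positivity
      nlinarith
    have h9 := (abs_le.1 h3).1
    have : 0 ≤ 3 * (8 * (k : ℝ)) ^ (2 * k) * z.re ^ (2 * k) := by positivity
    linarith
  · have h1 : R ^ (2 * k) ≤ (8 * k) ^ (2 * k) * z.re ^ (2 * k) := by
      rw [← Even.pow_abs (even_two_mul k) z.re, ← mul_pow]
      gcongr
    have h2 := (abs_le.1 hsgn).1
    linarith

/-- The graph of s^p lies above its tangent at a; this is Bernoulli's inequality for s/a.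
Integrated, with a the mean, it gives Jensen's inequality. -/
theorem pow_add_mul_sub_le_pow {s a : ℝ} (hs : 0 ≤ s) (ha : 0 ≤ a) (p : ℕ) :
    a ^ p + p * a ^ (p - 1) * (s - a) ≤ s ^ p := by
  rcases Nat.eq_zero_or_pos p with rfl | hp
  · simp
  rcases ha.eq_or_lt with rfl | ha
  · rcases Nat.lt_or_ge 1 p with h | h
    · rw [zero_pow (by omega), zero_pow (by omega)]; simpa using pow_nonneg hs p
    · have : p = 1 := by omega
      subst this; simp
  have h := one_add_mul_le_pow (a := s / a - 1) (by have := div_nonneg hs ha.le; linarith) p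
  rw [add_sub_cancel, div_pow, le_div_iff₀ (by positivity)] at h
  have e : a ^ p = a * a ^ (p - 1) := by rw [← pow_succ']; congr 1; omega
  refine le_trans (le_of_eq ?_) h
  rw [add_mul, one_mul]
  congr 1
  rw [e]; field_simp

/-- Jensen's inequality for powers, with a weight. -/
theorem pow_integral_le {k f : Torus → ℝ} (hk : Continuous k) (hk0 : ∀ t, 0 ≤ k t)
    (hk1 : ∫ t, k t ∂m = 1) (hf : Measurable f) {M : ℝ} (hf0 : ∀ t, 0 ≤ f t)
    (hfM : ∀ t, f t ≤ M) (p : ℕ) :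
    (∫ t, k t * f t ∂m) ^ p ≤ ∫ t, k t * f t ^ p ∂m := by
  set a := ∫ t, k t * f t ∂m
  have ha : 0 ≤ a := integral_nonneg fun t => mul_nonneg (hk0 t) (hf0 t)
  have hki := integrable_of_continuous_torus hk
  have hi1 : Integrable (fun t => k t * f t) m := hki.mul_bdd (c := M)
    hf.aestronglyMeasurable (Eventually.of_forall fun t => by
      rw [Real.norm_of_nonneg (hf0 t)]; exact hfM t)
  have hi2 : Integrable (fun t => k t * f t ^ p) m := hki.mul_bdd (c := M ^ p)
    (hf.pow_const p).aestronglyMeasurable (Eventually.of_forall fun t => by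
      rw [norm_pow, Real.norm_of_nonneg (hf0 t)]; have := hf0 t; gcongr; exact hfM t)
  have e : ∫ t, k t * (a ^ p + p * a ^ (p - 1) * (f t - a)) ∂m = a ^ p := by
    have : ∀ t, k t * (a ^ p + p * a ^ (p - 1) * (f t - a)) =
        (a ^ p - p * a ^ (p - 1) * a) * k t + p * a ^ (p - 1) * (k t * f t) := fun t => by ring
    simp only [this]
    rw [integral_add (hki.const_mul _) (hi1.const_mul _), integral_const_mul, integral_const_mul,
      hk1]
    ring
  rw [← e]
  refine integral_mono ?_ hi2 fun t =>
    mul_le_mul_of_nonneg_left (pow_add_mul_sub_le_pow (hf0 t) ha p) (hk0 t)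
  have : ∀ t, k t * (a ^ p + p * a ^ (p - 1) * (f t - a)) =
      (a ^ p - p * a ^ (p - 1) * a) * k t + p * a ^ (p - 1) * (k t * f t) := fun t => by ring
  simp only [this]
  exact (hki.const_mul _).add (hi1.const_mul _)

/-- The real part is a Poisson integral: Jensen's inequality holds at each x, and Fubini finishes
because the kernel has mass one in either variable. -/
theorem integral_pow_re_herglotz_le {f : Torus → ℝ} (hf : Measurable f) {M : ℝ}
    (hf0 : ∀ t, 0 ≤ f t) (hfM : ∀ t, f t ≤ M) (p : ℕ) {r : ℝ} (hr : r ∈ Set.Ico (0 : ℝ) 1) :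
    ∫ x, (herglotz f (r * fourier 1 x)).re ^ p ∂m ≤ ∫ t, f t ^ p ∂m := by
  have hfi : Integrable f m := Integrable.of_bound hf.aestronglyMeasurable M
    (Eventually.of_forall fun t => by rw [Real.norm_of_nonneg (hf0 t)]; exact hfM t)
  have hcont : ∀ x, Continuous fun t => poissonKernel r (x - t) := fun x =>
    (continuous_poissonKernel hr).comp (continuous_const.sub continuous_id)
  obtain ⟨C, hC⟩ := isCompact_univ.exists_bound_of_continuousOn
    (continuous_poissonKernel hr).continuousOn
  have hprod : Integrable (Function.uncurry fun x t => poissonKernel r (x - t) * f t ^ p)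
      (m.prod m) := by
    refine Integrable.of_bound (C := C * M ^ p) ?_ (Eventually.of_forall fun y => ?_)
    · refine Measurable.aestronglyMeasurable ?_
      exact ((continuous_poissonKernel hr).measurable.comp
        (measurable_fst.sub measurable_snd)).mul ((hf.comp measurable_snd).pow_const p)
    · simp only [Function.uncurry]
      rw [norm_mul, norm_pow, Real.norm_of_nonneg (hf0 _)]
      have h1 := hC (y.1 - y.2) (Set.mem_univ _)
      have h2 := hf0 y.2
      have h3 := hfM y.2
      have h4 : 0 ≤ C := (norm_nonneg _).trans h1
      gcongr
  calc ∫ x, (herglotz f (r * fourier 1 x)).re ^ p ∂m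
      ≤ ∫ x, (∫ t, poissonKernel r (x - t) * f t ^ p ∂m) ∂m := by
        refine integral_mono ?_ hprod.integral_prod_left fun x => ?_
        · refine integrable_of_continuous_torus ?_
          exact (Complex.continuous_re.comp (continuous_comp_mul_fourier
            (differentiableOn_herglotz hfi).continuousOn hr)).pow p
        · simp only
          rw [re_herglotz_eq hfi hr]
          exact pow_integral_le (hcont x) (fun t => poissonKernel_nonneg hr _)
            (integral_poissonKernel_sub hr x) hf hf0 hfM p
    _ = ∫ t, (∫ x, poissonKernel r (x - t) * f t ^ p ∂m) ∂m := integral_integral_swap hprod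
    _ = ∫ t, f t ^ p ∂m := by
        congr 1; ext t
        rw [integral_mul_const, integral_sub_right_eq_self (poissonKernel r) t,
          integral_poissonKernel hr, one_mul]

/-- M. Riesz's estimate for Cauchy integrals of nonnegative functions, for even exponents. -/
theorem exists_integral_norm_cauchyInt_pow_le (k : ℕ) (hk : 1 ≤ k) : ∃ B : ℝ, 0 < B ∧
    ∀ (f : Torus → ℝ) (M : ℝ), Measurable f → (∀ t, 0 ≤ f t) → (∀ t, f t ≤ M) →
      ∀ r ∈ Set.Ico (0 : ℝ) 1,
        ∫ x, ‖cauchyInt (fun t => (f t : ℂ)) (r * fourier 1 x)‖ ^ (2 * k) ∂m ≤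
          B * ∫ t, f t ^ (2 * k) ∂m := by
  set K : ℝ := 3 * (8 * k) ^ (2 * k) with hK
  have hK0 : 0 ≤ K := by positivity
  refine ⟨3 + K, by positivity, fun f M hf hf0 hfM r hr => ?_⟩
  have hfi : Integrable f m := Integrable.of_bound hf.aestronglyMeasurable M
    (Eventually.of_forall fun t => by rw [Real.norm_of_nonneg (hf0 t)]; exact hfM t)
  have hF := differentiableOn_herglotz hfi
  have hFc := continuous_comp_mul_fourier hF.continuousOn hr
  have hCc := continuous_comp_mul_fourier
    (differentiableOn_cauchyInt (integrable_ofReal hfi)).continuousOn hr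
  set F0 := ∫ t, f t ∂m with hF0def
  have hF0 : 0 ≤ F0 := integral_nonneg hf0
  have hF0p : F0 ^ (2 * k) ≤ ∫ t, f t ^ (2 * k) ∂m := by
    have := pow_integral_le (k := fun _ => 1) continuous_const (fun _ => zero_le_one)
      (by simp) hf hf0 hfM (2 * k)
    simpa using this
  have hpt : ∀ x : Torus, ‖cauchyInt (fun t => (f t : ℂ)) (r * fourier 1 x)‖ ^ (2 * k) ≤
      ‖herglotz f (r * fourier 1 x)‖ ^ (2 * k) + F0 ^ (2 * k) := by
    intro x
    have h1 : ‖cauchyInt (fun t => (f t : ℂ)) (r * fourier 1 x)‖ ≤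
        max ‖herglotz f (r * fourier 1 x)‖ F0 := by
      have h2 : 2 * cauchyInt (fun t => (f t : ℂ)) (r * fourier 1 x) =
          herglotz f (r * fourier 1 x) + (F0 : ℂ) := by
        rw [herglotz, fourierCoeff_ofReal_zero]; ring
      have h3 := congrArg norm h2
      rw [norm_mul, Complex.norm_ofNat] at h3
      have h4 := norm_add_le (herglotz f (r * fourier 1 x)) (F0 : ℂ)
      rw [Complex.norm_real, Real.norm_of_nonneg hF0] at h4
      have h5 := le_max_left ‖herglotz f (r * fourier 1 x)‖ F0
      have h6 := le_max_right ‖herglotz f (r * fourier 1 x)‖ F0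
      linarith
    refine (pow_le_pow_left₀ (norm_nonneg _) h1 _).trans ?_
    rcases max_cases ‖herglotz f (r * fourier 1 x)‖ F0 with ⟨h, -⟩ | ⟨h, -⟩ <;> rw [h]
    · have : 0 ≤ F0 ^ (2 * k) := by positivity
      linarith
    · have : 0 ≤ ‖herglotz f (r * fourier 1 x)‖ ^ (2 * k) := by positivity
      linarith
  have hpi : Integrable (fun x : Torus => herglotz f (r * fourier 1 x) ^ (2 * k)) m :=
    (hFc.pow _).integrable_of_hasCompactSupport (HasCompactSupport.of_compactSpace _)
  -- The mean value property evaluates this integral exactly. An even natural exponent keeps F^{2k}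
  -- holomorphic and lets its real part control |F|^{2k}.
  have hre : ∫ x, (herglotz f (r * fourier 1 x) ^ (2 * k)).re ∂m = F0 ^ (2 * k) := by
    have h1 := integral_re hpi
    simp only [RCLike.re_to_complex] at h1
    rw [h1, integral_comp_mul_fourier (Φ := fun z => herglotz f z ^ (2 * k)) (hF.pow _) hr,
      herglotz_zero, ← Complex.ofReal_pow, Complex.ofReal_re]
  have hi1 : Integrable (fun x : Torus => (herglotz f (r * fourier 1 x) ^ (2 * k)).re) m := hpi.re
  have hi2 : Integrable (fun x : Torus => (herglotz f (r * fourier 1 x)).re ^ (2 * k)) m :=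
    integrable_of_continuous_torus ((Complex.continuous_re.comp hFc).pow _)
  calc ∫ x, ‖cauchyInt (fun t => (f t : ℂ)) (r * fourier 1 x)‖ ^ (2 * k) ∂m
      ≤ ∫ x, (2 * ((-1) ^ k * (herglotz f (r * fourier 1 x) ^ (2 * k)).re) +
          K * (herglotz f (r * fourier 1 x)).re ^ (2 * k) + F0 ^ (2 * k)) ∂m := by
        refine integral_mono (integrable_of_continuous_torus (hCc.norm.pow _)) ?_ fun x =>
          (hpt x).trans ?_
        · exact ((((hi1.const_mul _).const_mul _)).add (hi2.const_mul _)).add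
            (integrable_const _)
        · have := norm_pow_le_re_pow_add k hk (herglotz f (r * fourier 1 x))
          simp only [← hK] at this
          simpa using this
    _ = 2 * ((-1) ^ k * F0 ^ (2 * k)) +
          K * ∫ x, (herglotz f (r * fourier 1 x)).re ^ (2 * k) ∂m + F0 ^ (2 * k) := by
        have hj : Integrable (fun x : Torus =>
            2 * ((-1) ^ k * (herglotz f (r * fourier 1 x) ^ (2 * k)).re) +
              K * (herglotz f (r * fourier 1 x)).re ^ (2 * k)) m :=
          ((hi1.const_mul _).const_mul _).add (hi2.const_mul _)
        rw [integral_add hj (integrable_const _),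
          integral_add ((hi1.const_mul _).const_mul _) (hi2.const_mul _), integral_const_mul, integral_const_mul, integral_const_mul, hre]
        simp
    _ ≤ 2 * F0 ^ (2 * k) + K * (∫ t, f t ^ (2 * k) ∂m) + F0 ^ (2 * k) := by
        have h1 : ((-1 : ℝ)) ^ k * F0 ^ (2 * k) ≤ F0 ^ (2 * k) := by
          have : (-1 : ℝ) ^ k ≤ 1 := by
            rcases neg_one_pow_eq_or ℝ k with h | h <;> norm_num [h]
          nlinarith [pow_nonneg hF0 (2 * k)]
        have h2 := integral_pow_re_herglotz_le hf hf0 hfM (2 * k) hr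
        have h3 := mul_le_mul_of_nonneg_left h2 hK0
        linarith
    _ ≤ (3 + K) * ∫ t, f t ^ (2 * k) ∂m := by nlinarith

/-! ### Riesz projections of integrable functions -/

/-- The four nonnegative parts of a complex number: `z = ∑ k, I ^ k * part k z`. -/
def part (k : Fin 4) (z : ℂ) : ℝ := max ((-Complex.I) ^ (k : ℕ) * z).re 0

theorem part_nonneg (k : Fin 4) (z : ℂ) : 0 ≤ part k z := le_max_right _ _

theorem part_le_norm (k : Fin 4) (z : ℂ) : part k z ≤ ‖z‖ := by
  refine max_le ?_ (norm_nonneg z)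
  refine (Complex.re_le_norm _).trans_eq ?_
  rw [norm_mul, norm_pow, norm_neg, Complex.norm_I, one_pow, one_mul]

theorem continuous_part (k : Fin 4) : Continuous (part k) :=
  (Complex.continuous_re.comp (continuous_const.mul continuous_id)).max continuous_const

theorem sum_part (z : ℂ) : ∑ k : Fin 4, Complex.I ^ (k : ℕ) * (part k z : ℂ) = z := by
  have h : ∀ a : ℝ, max a 0 - max (-a) 0 = a := fun a => by
    rcases le_total a 0 with h | h <;> simp [h]
  have h1 := h z.re
  have h2 := h z.im
  rw [Fin.sum_univ_four]
  have e2 : (-Complex.I) ^ 2 = -1 := by rw [neg_sq, Complex.I_sq]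
  have e3 : (-Complex.I) ^ 3 = Complex.I := by rw [pow_succ, e2]; ring
  have f3 : Complex.I ^ 3 = -Complex.I := by rw [pow_succ, Complex.I_sq]; ring
  apply Complex.ext
  · simp [part, e2, e3, f3]; linarith
  · simp [part, e2, e3, f3]; linarith

theorem integrable_part {f : Torus → ℂ} (hf : Integrable f m) (k : Fin 4) :
    Integrable (fun t => part k (f t)) m :=
  hf.mono ((continuous_part k).comp_aestronglyMeasurable hf.1)
    (Eventually.of_forall fun t => by
      rw [Real.norm_of_nonneg (part_nonneg _ _)]; exact part_le_norm _ _)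

theorem cauchyInt_eq_sum_part {f : Torus → ℂ} (hf : Integrable f m) {z : ℂ} (hz : ‖z‖ < 1) :
    cauchyInt f z = ∑ k : Fin 4, Complex.I ^ (k : ℕ) *
      cauchyInt (fun t => (part k (f t) : ℂ)) z := by
  simp only [cauchyInt]
  simp only [← integral_const_mul]
  rw [← integral_finsetSum]
  · refine integral_congr_ae (Eventually.of_forall fun t => ?_)
    simp only
    nth_rewrite 1 [← sum_part (f t)]
    rw [Finset.mul_sum]
    refine Finset.sum_congr rfl fun k _ => ?_
    ring
  · intro k _
    exact (integrable_cauchyKernel_mul (integrable_ofReal (integrable_part hf k)) hz).const_mul _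

theorem norm_mul_fourier_lt_one {r : ℝ} (hr : r ∈ Set.Ioo (0 : ℝ) 1) (x : Torus) :
    ‖(r : ℂ) * fourier 1 x‖ < 1 :=
  mem_ball_zero_iff.1 (mul_fourier_mem_ball ⟨hr.1.le, hr.2⟩ 1 x)

/-- `g` is the radial limit of the Cauchy integral of `f`. -/
def IsCauchyLimit (f g : Torus → ℂ) : Prop :=
  ∀ᵐ x ∂m, Tendsto (fun r : ℝ => cauchyInt f (r * fourier 1 x)) (𝓝[<] 1) (𝓝 (g x))

theorem ae_exists_tendsto_cauchyInt {f : Torus → ℂ} (hf : Integrable f m) :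
    ∀ᵐ x ∂m, ∃ l, Tendsto (fun r : ℝ => cauchyInt f (r * fourier 1 x)) (𝓝[<] 1) (𝓝 l) := by
  have h : ∀ᵐ x ∂m, ∀ k : Fin 4, ∃ l, Tendsto (fun r : ℝ =>
      cauchyInt (fun t => (part k (f t) : ℂ)) (r * fourier 1 x)) (𝓝[<] 1) (𝓝 l) :=
    ae_all_iff.2 fun k => ae_exists_tendsto_cauchyInt_of_nonneg (integrable_part hf k)
      fun t => part_nonneg _ _
  filter_upwards [h] with x hx
  choose l hl using hx
  refine ⟨∑ k : Fin 4, Complex.I ^ (k : ℕ) * l k,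
    (tendsto_finsetSum _ fun k _ => (hl k).const_mul _).congr' ?_⟩
  filter_upwards [eventually_mem_Ioo] with r hr
  exact (cauchyInt_eq_sum_part hf (norm_mul_fourier_lt_one hr x)).symm

theorem continuous_cauchyInt_circle {f : Torus → ℂ} (hf : Integrable f m) {r : ℝ}
    (hr : r ∈ Set.Ioo (0 : ℝ) 1) : Continuous fun x : Torus => cauchyInt f (r * fourier 1 x) :=
  continuous_comp_mul_fourier (differentiableOn_cauchyInt hf).continuousOn ⟨hr.1.le, hr.2⟩

theorem exists_isCauchyLimit {f : Torus → ℂ} (hf : Integrable f m) :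
    ∃ g : L0, IsCauchyLimit f g := by
  obtain ⟨u, hu1, hu⟩ := exists_seq_tendsto_one
  have h := ae_exists_tendsto_cauchyInt hf
  obtain ⟨g, hg, hlim⟩ := measurable_limit_of_tendsto_metrizable_ae (μ := m) (L := atTop)
    (f := fun (n : ℕ) (x : Torus) => cauchyInt f (u n * fourier 1 x))
    (fun n => (continuous_cauchyInt_circle hf (hu1 n)).aemeasurable)
    (h.mono fun x ⟨l, hl⟩ => ⟨l, hl.comp hu⟩)
  refine ⟨AEEqFun.mk g hg.aestronglyMeasurable, ?_⟩
  filter_upwards [h, hlim, AEEqFun.coeFn_mk g hg.aestronglyMeasurable] with x ⟨l, hl⟩ hx hgx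
  rw [hgx, tendsto_nhds_unique hx (hl.comp hu)]
  exact hl

/-- Fatou's theorem supplies the limit of the Poisson part, so the limits of the conjugate Poisson
integral and of the Cauchy integral determine each other: the conjugate function is -i(2g - f -
f^(0)). From here on, P is handled as a radial limit of Cauchy integrals. -/
theorem isRieszProjection_iff {f g : L0} :
    IsRieszProjection f g ↔ Integrable f m ∧ IsCauchyLimit f g := by
  have key : Integrable f m → ∀ r ∈ Set.Ioo (0 : ℝ) 1, ∀ x,
      2 * cauchyInt f (r * fourier 1 x) - fourierCoeff f 0 =
        poissonInt f r x + Complex.I * conjPoisson f r x := fun hf r hr x =>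
    two_mul_cauchyInt_sub hf ⟨hr.1.le, hr.2⟩ x
  constructor
  · rintro ⟨hf, h, hh, rfl⟩
    refine ⟨hf, ?_⟩
    filter_upwards [ae_tendsto_poissonInt hf, hh,
      AEEqFun.coeFn_smul (1 / 2 : ℂ)
        (f + Complex.I • h + AEEqFun.const Torus (fourierCoeff f 0)),
      AEEqFun.coeFn_add (f + Complex.I • h) (AEEqFun.const Torus (fourierCoeff f 0)),
      AEEqFun.coeFn_add f (Complex.I • h), AEEqFun.coeFn_smul Complex.I h,
      AEEqFun.coeFn_const (μ := m) Torus (fourierCoeff f 0)] with x h1 h2 e1 e2 e3 e4 e5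
    rw [e1, Pi.smul_apply, e2, Pi.add_apply, e3, Pi.add_apply, e4, Pi.smul_apply, e5,
      Function.const_apply, smul_eq_mul, smul_eq_mul]
    refine (((h1.add (h2.const_mul Complex.I)).add_const (fourierCoeff f 0)).const_mul
      (1 / 2 : ℂ)).congr' ?_
    filter_upwards [eventually_mem_Ioo] with r hr
    rw [← key hf r hr x]; ring
  · rintro ⟨hf, hg⟩
    refine ⟨hf, (-Complex.I) • ((2 : ℂ) • g - f - AEEqFun.const Torus (fourierCoeff f 0)), ?_, ?_⟩
    · filter_upwards [ae_tendsto_poissonInt hf, hg,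
        AEEqFun.coeFn_smul (-Complex.I)
          ((2 : ℂ) • g - f - AEEqFun.const Torus (fourierCoeff f 0)),
        AEEqFun.coeFn_sub ((2 : ℂ) • g - f) (AEEqFun.const Torus (fourierCoeff f 0)),
        AEEqFun.coeFn_sub ((2 : ℂ) • g) f, AEEqFun.coeFn_smul (2 : ℂ) g,
        AEEqFun.coeFn_const (μ := m) Torus (fourierCoeff f 0)] with x h1 h2 e1 e2 e3 e4 e5
      rw [e1, Pi.smul_apply, e2, Pi.sub_apply, e3, Pi.sub_apply, e4, Pi.smul_apply, e5,
        Function.const_apply, smul_eq_mul, smul_eq_mul]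
      refine ((((h2.const_mul 2).sub h1).sub_const (fourierCoeff f 0)).const_mul
        (-Complex.I)).congr' ?_
      filter_upwards [eventually_mem_Ioo] with r hr
      have := key hf r hr x
      have h3 : 2 * cauchyInt f (r * fourier 1 x) - poissonInt f r x - fourierCoeff f 0 =
          Complex.I * conjPoisson f r x := by linear_combination this
      rw [h3, ← mul_assoc]
      simp
    · rw [smul_smul, mul_neg, Complex.I_mul_I, neg_neg, one_smul]
      have : f + ((2 : ℂ) • g - f - AEEqFun.const Torus (fourierCoeff f 0)) +
          AEEqFun.const Torus (fourierCoeff f 0) = (2 : ℂ) • g := by abel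
      rw [this, smul_smul]
      norm_num

/-- The weak type `(1, 1)` estimate for radial limits of Cauchy integrals. -/
theorem measure_lt_norm_of_isCauchyLimit {f g : Torus → ℂ} (hf : Integrable f m)
    (hg : IsCauchyLimit f g) {lam : ℝ} (hl : 0 < lam) :
    m {x | 4 * lam < ‖g x‖} ≤ ENNReal.ofReal (8 * (∫ t, ‖f t‖ ∂m) / lam) := by
  obtain ⟨u, hu1, hu⟩ := exists_seq_tendsto_one
  have h1 : m {x | 4 * lam < ‖g x‖} = m ({x | 4 * lam < ‖g x‖} ∩
      {x | Tendsto (fun r : ℝ => cauchyInt f (r * fourier 1 x)) (𝓝[<] 1) (𝓝 (g x))}) :=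
    (measure_inter_conull hg).symm
  rw [h1]
  refine measure_le_of_eventually_mem
    (S := fun n => {x : Torus | 4 * lam < ‖cauchyInt f (u n * fourier 1 x)‖}) ?_ ?_
  · rintro x ⟨hx1, hx2⟩
    exact ((hx2.comp hu).norm).eventually (lt_mem_nhds hx1)
  · intro n
    have h2 : {x : Torus | 4 * lam < ‖cauchyInt f (u n * fourier 1 x)‖} ⊆
        ⋃ k : Fin 4, {x : Torus | lam <
          ‖cauchyInt (fun t => (part k (f t) : ℂ)) (u n * fourier 1 x)‖} := by
      intro x hx
      by_contra hcon
      simp only [Set.mem_iUnion, Set.mem_ofPred_eq, not_exists, not_lt] at hcon hx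
      rw [cauchyInt_eq_sum_part hf (norm_mul_fourier_lt_one (hu1 n) x)] at hx
      have h3 : ‖∑ k : Fin 4, Complex.I ^ (k : ℕ) *
          cauchyInt (fun t => (part k (f t) : ℂ)) (u n * fourier 1 x)‖ ≤ 4 * lam := by
        refine (norm_sum_le _ _).trans ((Finset.sum_le_card_nsmul _ _ lam fun k _ => ?_).trans_eq
          (by simp))
        rw [norm_mul, norm_pow, Complex.norm_I, one_pow, one_mul]
        exact hcon k
      linarith
    refine (measure_mono h2).trans ((measure_iUnion_fintype_le _ _).trans ?_)
    have h4 : ∀ k : Fin 4, m {x : Torus | lam <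
        ‖cauchyInt (fun t => (part k (f t) : ℂ)) (u n * fourier 1 x)‖} ≤
        ENNReal.ofReal (2 * (∫ t, ‖f t‖ ∂m) / lam) := fun k => by
      refine (measure_lt_norm_cauchyInt (integrable_part hf k) (fun t => part_nonneg _ _)
        ⟨(hu1 n).1.le, (hu1 n).2⟩ hl).trans (ENNReal.ofReal_le_ofReal ?_)
      have := integral_mono (integrable_part hf k) hf.norm fun t => part_le_norm k (f t)
      exact div_le_div_of_nonneg_right (mul_le_mul_of_nonneg_left this zero_le_two) hl.le
    refine (Finset.sum_le_card_nsmul _ _ _ fun k _ => h4 k).trans_eq ?_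
    rw [← ENNReal.ofReal_nsmul]
    congr 1
    simp; ring

/-! ### Shifted Riesz projections recover the function -/

/-- `p` is reproduced by the Riesz projection after multiplication by a high power of `e^{ix}`. -/
def IsShiftAnalytic (p : Torus → ℂ) : Prop :=
  ∃ n₀ : ℕ, ∀ n : ℕ, n₀ ≤ n →
    IsCauchyLimit (fun t => fourier n t * p t) (fun x => fourier n x * p x)

theorem cauchyInt_fourier (n : ℕ) {z : ℂ} (hz : ‖z‖ < 1) :
    cauchyInt (fun t => fourier n t) z = z ^ n := by
  have hInt : Integrable (fun t : Torus => (fourier n t : ℂ)) m :=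
    (fourier n).continuous.integrable_of_hasCompactSupport (HasCompactSupport.of_compactSpace _)
  refine (hasSum_cauchyInt hInt hz).unique ?_
  have e : (fun k : ℕ => fourierCoeff (fun t : Torus => (fourier n t : ℂ)) k * z ^ k) =
      fun k => if k = n then z ^ n else 0 := by
    funext k
    have := congrFun (fourierCoeff_fourier (T := 2 * π) (n : ℤ)) k
    refine (congrArg (· * z ^ k) this).trans ?_
    by_cases h : k = n
    · subst h; simp
    · simp [h]
  rw [e]
  exact hasSum_ite_eq n _

/-- Once n ≥ |k| the shifted character has nonnegative frequency j, its Cauchy integral is z^j, and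
its radial limit is itself. -/
theorem isShiftAnalytic_fourier (k : ℤ) : IsShiftAnalytic (fun t => fourier k t) := by
  refine ⟨k.natAbs, fun n hn => Eventually.of_forall fun x => ?_⟩
  obtain ⟨j, hj⟩ : ∃ j : ℕ, (n : ℤ) + k = j := ⟨((n : ℤ) + k).toNat, by omega⟩
  simp only [← fourier_add, hj]
  have h : ContinuousAt (fun r : ℝ => ((r : ℂ) * fourier 1 x) ^ j) 1 := by fun_prop
  have h2 := h.tendsto.mono_left (nhdsWithin_le_nhds (s := Set.Iio 1))
  rw [Complex.ofReal_one, one_mul, fourier_one_pow] at h2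
  refine h2.congr' ?_
  filter_upwards [eventually_mem_Ioo] with r hr
  exact (cauchyInt_fourier j (norm_mul_fourier_lt_one hr x)).symm

theorem integrable_of_continuousMap (p : C(Torus, ℂ)) : Integrable p m :=
  p.continuous.integrable_of_hasCompactSupport (HasCompactSupport.of_compactSpace _)

theorem integrable_fourier_mul (n : ℤ) {f : Torus → ℂ} (hf : Integrable f m) :
    Integrable (fun t => fourier n t * f t) m :=
  hf.bdd_mul (c := 1) (fourier n).continuous.aestronglyMeasurable
    (Eventually.of_forall fun t => (norm_fourier_apply n t).le)

theorem IsCauchyLimit.add {f g f' g' : Torus → ℂ} (hf : Integrable f m) (hf' : Integrable f' m)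
    (h : IsCauchyLimit f g) (h' : IsCauchyLimit f' g') :
    IsCauchyLimit (fun t => f t + f' t) (fun x => g x + g' x) := by
  filter_upwards [h, h'] with x hx hx'
  refine (hx.add hx').congr' ?_
  filter_upwards [eventually_mem_Ioo] with r hr
  exact (cauchyInt_add hf hf' (norm_mul_fourier_lt_one hr x)).symm

theorem IsCauchyLimit.const_mul {f g : Torus → ℂ} (c : ℂ) (h : IsCauchyLimit f g) :
    IsCauchyLimit (fun t => c * f t) (fun x => c * g x) := by
  filter_upwards [h] with x hx
  simp only [cauchyInt_const_mul]
  exact hx.const_mul c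

theorem isShiftAnalytic_of_mem_span {p : C(Torus, ℂ)}
    (hp : p ∈ Submodule.span ℂ (Set.range (fourier (T := 2 * π)))) : IsShiftAnalytic p := by
  induction hp using Submodule.span_induction with
  | mem p hp => obtain ⟨k, rfl⟩ := hp; exact isShiftAnalytic_fourier k
  | zero =>
    refine ⟨0, fun n _ => Eventually.of_forall fun x => ?_⟩
    simp [cauchyInt]
  | add p q _ _ hp hq =>
    obtain ⟨n₀, h⟩ := hp
    obtain ⟨n₁, h'⟩ := hq
    refine ⟨max n₀ n₁, fun n hn => ?_⟩
    have := (h n ((le_max_left _ _).trans hn)).add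
      (integrable_fourier_mul n (integrable_of_continuousMap p))
      (integrable_fourier_mul n (integrable_of_continuousMap q))
      (h' n ((le_max_right _ _).trans hn))
    simpa only [ContinuousMap.add_apply, mul_add] using this
  | smul c p _ hp =>
    obtain ⟨n₀, h⟩ := hp
    refine ⟨n₀, fun n hn => ?_⟩
    have := (h n hn).const_mul c
    simpa only [ContinuousMap.smul_apply, smul_eq_mul, mul_left_comm c] using this

/-- Continuous functions are dense in L¹, and trigonometric polynomials are uniformly dense among
them; half of η is spent on each approximation. -/
theorem exists_isShiftAnalytic_lintegral_le {h : Torus → ℂ} (hh : Integrable h m) {η : ℝ}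
    (hη : 0 < η) : ∃ p : C(Torus, ℂ), IsShiftAnalytic p ∧ ∫ t, ‖h t - p t‖ ∂m ≤ η := by
  obtain ⟨g, hg, hgi⟩ := hh.exists_boundedContinuous_integral_sub_le (half_pos hη)
  have hmem : g.toContinuousMap ∈
      (Submodule.span ℂ (Set.range (fourier (T := 2 * π)))).topologicalClosure := by
    rw [span_fourier_closure_eq_top]; trivial
  obtain ⟨p, hp, hpg⟩ := Metric.mem_closure_iff.1 hmem (η / 2) (half_pos hη)
  refine ⟨p, isShiftAnalytic_of_mem_span hp, ?_⟩
  have hpi := integrable_of_continuousMap p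
  have h1 : ∀ t, ‖g t - p t‖ ≤ η / 2 := fun t => by
    have := (ContinuousMap.dist_apply_le_dist (f := g.toContinuousMap) (g := p) t).trans hpg.le
    rwa [dist_eq_norm] at this
  calc ∫ t, ‖h t - p t‖ ∂m ≤ ∫ t, (‖h t - g t‖ + η / 2) ∂m := by
        refine integral_mono (hh.sub hpi).norm
          ((hh.sub hgi).norm.add (integrable_const _)) fun t => ?_
        have := norm_add_le (h t - g t) (g t - p t)
        rw [sub_add_sub_cancel] at this
        simp only
        linarith [h1 t]
    _ = (∫ t, ‖h t - g t‖ ∂m) + η / 2 := by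
        have hj : Integrable (fun t => ‖h t - g t‖) m := (hh.sub hgi).norm
        rw [integral_add hj (integrable_const _)]; simp
    _ ≤ η := by linarith

/-- For a trigonometric polynomial p close to h in L¹, the projection reproduces e^{inx} p for large
n. The remainder e^{inx}(h - p) has an L¹ norm independent of n, so the weak type estimate controls
its projection uniformly in n. -/
theorem tendstoInMeasure_shift {h : Torus → ℂ} (hh : Integrable h m) {q : ℕ → Torus → ℂ}
    (hq : ∀ n : ℕ, IsCauchyLimit (fun t => fourier n t * h t) (q n)) :
    TendstoInMeasure m (fun (n : ℕ) x => fourier (-(n : ℤ)) x * q n x) atTop h := by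
  rw [tendstoInMeasure_iff_norm]
  intro ε hε
  rw [ENNReal.tendsto_atTop_zero]
  intro δ hδ
  obtain ⟨δ', hδ'0, hδ'⟩ : ∃ δ' : ℝ, 0 < δ' ∧ ENNReal.ofReal δ' ≤ δ := by
    rcases eq_or_ne δ ∞ with rfl | h
    · exact ⟨1, one_pos, le_top⟩
    · exact ⟨δ.toReal, ENNReal.toReal_pos hδ.ne' h, ENNReal.ofReal_toReal_le⟩
  -- The weak type term costs 128 η/ε and Chebyshev's inequality 2 η/ε, in total 130 δ'/200 < δ'.
  set η := δ' * ε / 200 with hηdef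
  have hη : 0 < η := by positivity
  obtain ⟨p, ⟨n₀, hp⟩, hpη⟩ := exists_isShiftAnalytic_lintegral_le hh hη
  refine ⟨n₀, fun n hn => le_trans ?_ hδ'⟩
  have hpi := integrable_of_continuousMap p
  have hhp : Integrable (fun t => h t - p t) m := hh.sub hpi
  have hdiff : IsCauchyLimit (fun t => fourier n t * (h t - p t))
      (fun x => q n x - fourier n x * p x) := by
    have := (hq n).add (integrable_fourier_mul n hh)
      ((integrable_fourier_mul n hpi).const_mul (-1)) ((hp n hn).const_mul (-1))
    refine (iff_of_eq ?_).1 this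
    congr 1 <;> funext t <;> ring
  have hw := measure_lt_norm_of_isCauchyLimit (integrable_fourier_mul n hhp) hdiff
    (lam := ε / 16) (by positivity)
  have hmk := mul_meas_ge_le_integral_of_nonneg (μ := m) (f := fun t => ‖h t - p t‖)
    (Eventually.of_forall fun t => norm_nonneg _) hhp.norm (ε / 2)
  have hmk2 : m {x | ε / 2 ≤ ‖h x - p x‖} ≤ ENNReal.ofReal (2 * η / ε) := by
    rw [← ENNReal.ofReal_toReal (measure_ne_top m {x | ε / 2 ≤ ‖h x - p x‖})]
    refine ENNReal.ofReal_le_ofReal ?_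
    rw [le_div_iff₀ hε]
    rw [Measure.real] at hmk
    linarith
  have hsub : {x | ε ≤ ‖fourier (-(n : ℤ)) x * q n x - h x‖} ⊆
      {x | 4 * (ε / 16) < ‖q n x - fourier n x * p x‖} ∪ {x | ε / 2 ≤ ‖h x - p x‖} := by
    intro x hx
    by_contra hcon
    simp only [Set.mem_union, Set.mem_ofPred_eq, not_or, not_lt, not_le] at hcon hx
    have e : fourier (-(n : ℤ)) x * q n x - h x =
        fourier (-(n : ℤ)) x * (q n x - fourier n x * p x) - (h x - p x) := by
      have := fourier_mul_fourier_neg n x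
      linear_combination (p x) * this
    have h1 := norm_sub_le (fourier (-(n : ℤ)) x * (q n x - fourier n x * p x)) (h x - p x)
    rw [norm_mul, norm_fourier_apply, one_mul, ← e] at h1
    linarith [hcon.1, hcon.2]
  refine (measure_mono hsub).trans ((measure_union_le _ _).trans
    ((add_le_add hw hmk2).trans ?_))
  rw [← ENNReal.ofReal_add (by positivity) (by positivity)]
  refine ENNReal.ofReal_le_ofReal ?_
  have e1 : ∫ t, ‖fourier n t * (h t - p t)‖ ∂m = ∫ t, ‖h t - p t‖ ∂m := by
    congr 1; ext t; rw [norm_mul, norm_fourier_apply, one_mul]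
  rw [e1]
  have e2 : 8 * (∫ t, ‖h t - p t‖ ∂m) / (ε / 16) ≤ 8 * η / (ε / 16) := by gcongr
  have e3 : 8 * η / (ε / 16) + 2 * η / ε = 130 * (δ' / 200) := by
    rw [hηdef]; field_simp; ring
  linarith

/-! ### Elementary properties of Banach function spaces -/

namespace BanachFunctionSpace

variable (X : BanachFunctionSpace)

theorem N_zero : X.N 0 = 0 := by
  have h := X.norm_smul 0 0
  have e : (0 : ℂ) • (0 : L0) = 0 := zero_smul ℂ (0 : L0)
  rw [e] at h
  simpa using h

theorem N_congr {f g : L0} (h : ∀ᵐ t ∂m, ‖f t‖ = ‖g t‖) : X.N f = X.N g :=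
  le_antisymm (X.ideal g f (h.mono fun _ ht => ht.le)) (X.ideal f g (h.mono fun _ ht => ht.ge))

theorem N_sub_comm (f g : L0) : X.N (f - g) = X.N (g - f) := by
  refine X.N_congr ?_
  filter_upwards [AEEqFun.coeFn_sub f g, AEEqFun.coeFn_sub g f] with t h1 h2
  rw [h1, h2, Pi.sub_apply, Pi.sub_apply, norm_sub_rev]

theorem N_sum_le {ι : Type*} (s : Finset ι) (u : ι → L0) :
    X.N (∑ i ∈ s, u i) ≤ ∑ i ∈ s, X.N (u i) := by
  classical
  induction s using Finset.induction_on with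
  | empty => simp [X.N_zero]
  | insert i s hi ih =>
    rw [Finset.sum_insert hi, Finset.sum_insert hi]
    exact (X.norm_add_le _ _).trans (by gcongr)

/-- The constant function `1`. -/
theorem N_one_ne_zero : X.N (AEEqFun.const Torus (1 : ℂ)) ≠ 0 := by
  intro h
  have h1 := X.eq_zero_of_norm_eq_zero _ h
  have h2 : (AEEqFun.const Torus (1 : ℂ) : Torus →ₘ[m] ℂ) =ᵐ[m] (0 : L0) := by rw [h1]
  have h3 : ∀ᵐ t : Torus ∂m, False := by
    filter_upwards [h2, AEEqFun.coeFn_const (μ := m) Torus (1 : ℂ),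
      AEEqFun.coeFn_zero (μ := m) (β := ℂ) (α := Torus)] with t e1 e2 e3
    rw [e2, e3] at e1
    simp at e1
  rw [eventually_false_iff_eq_bot, ae_eq_bot] at h3
  exact NeZero.ne _ h3

theorem N_one_ne_top : X.N (AEEqFun.const Torus (1 : ℂ)) ≠ ∞ := by
  refine (X.norm_lt_top_of_memLp_top _ ?_).ne
  exact (memLp_congr_ae (AEEqFun.coeFn_const Torus (1 : ℂ))).2 (memLp_const 1)

end BanachFunctionSpace

/-- The modulus of an element of `L⁰`. -/
def absL0 (f : L0) : L0 :=
  AEEqFun.mk (fun t => ((‖f t‖ : ℝ) : ℂ))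
    (Complex.continuous_ofReal.comp_aestronglyMeasurable f.aestronglyMeasurable.norm)

theorem absL0_ae (f : L0) : ∀ᵐ t ∂m, absL0 f t = ((‖f t‖ : ℝ) : ℂ) := AEEqFun.coeFn_mk _ _

theorem coeFn_sum_ae {ι : Type*} (s : Finset ι) (u : ι → L0) :
    ∀ᵐ t ∂m, (∑ i ∈ s, u i) t = ∑ i ∈ s, u i t := by
  classical
  induction s using Finset.induction_on with
  | empty =>
    filter_upwards [AEEqFun.coeFn_zero (μ := m) (β := ℂ) (α := Torus)] with t ht
    simp [ht]
  | insert i s hi ih =>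
    rw [Finset.sum_insert hi]
    filter_upwards [ih, AEEqFun.coeFn_add (u i) (∑ i ∈ s, u i)] with t h1 h2
    rw [h2, Pi.add_apply, h1, Finset.sum_insert hi]

namespace BanachFunctionSpace

variable (X : BanachFunctionSpace)

theorem N_absL0 (f : L0) : X.N (absL0 f) = X.N f :=
  X.N_congr ((absL0_ae f).mono fun t ht => by rw [ht]; simp)

/-- The Riesz–Fischer property: an absolutely convergent series is dominated by an element of
the space. -/
theorem exists_dominating {u : ℕ → L0} (hu : ∑' k, X.N (u k) ≠ ∞) :
    ∃ G : L0, X.N G ≤ ∑' k, X.N (u k) ∧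
      ∀ᵐ t ∂m, ∀ n, ∑ k ∈ Finset.range n, ‖u k t‖ ≤ ‖G t‖ := by
  set v : ℕ → L0 := fun k => absL0 (u k) with hv
  have hvN : ∀ k, X.N (v k) = X.N (u k) := fun k => X.N_absL0 _
  set S : ℕ → L0 := fun n => ∑ k ∈ Finset.range n, v k with hS
  have hSN : ∀ n, X.N (S n) ≤ ∑' k, X.N (u k) := fun n =>
    (X.N_sum_le _ _).trans (by simp only [hvN]; exact ENNReal.sum_le_tsum _)
  have hdiff : ∀ k l, k ≤ l → X.N (S l - S k) ≤ ∑' j, X.N (u (j + k)) := by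
    intro k l hkl
    have : S l - S k = ∑ j ∈ Finset.range (l - k), v (j + k) := by
      rw [sub_eq_iff_eq_add, add_comm]
      simp only [hS]
      have e := Finset.sum_range_add v k (l - k)
      rw [Nat.add_sub_cancel' hkl] at e
      rw [e]
      congr 1
      exact Finset.sum_congr rfl fun j _ => by rw [add_comm]
    rw [this]
    refine (X.N_sum_le _ _).trans ?_
    simp only [hvN]
    exact ENNReal.sum_le_tsum _
  have htail : Tendsto (fun k => ∑' j, X.N (u (j + k))) atTop (𝓝 0) :=
    ENNReal.tendsto_sum_nat_add _ hu
  obtain ⟨G, hGfin, hG⟩ := X.complete S (fun n => (hSN n).trans_lt (lt_top_iff_ne_top.2 hu)) (by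
    intro ε hε
    obtain ⟨n₀, hn₀⟩ := eventually_atTop.1 (htail.eventually (gt_mem_nhds hε))
    refine ⟨n₀, fun k hk l hl => ?_⟩
    rcases le_total k l with h | h
    · rw [X.N_sub_comm]; exact (hdiff k l h).trans_lt (hn₀ k hk)
    · exact (hdiff l k h).trans_lt (hn₀ l hl))
  refine ⟨G, ?_, ?_⟩
  · have h1 : ∀ n, X.N G ≤ (∑' k, X.N (u k)) + X.N (S n - G) := fun n => by
      have : G = S n + (G - S n) := by abel
      calc X.N G = X.N (S n + (G - S n)) := by rw [← this]
        _ ≤ X.N (S n) + X.N (G - S n) := X.norm_add_le _ _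
        _ ≤ _ := by rw [X.N_sub_comm G]; gcongr; exact hSN n
    have h2 := hG.const_add (∑' k, X.N (u k))
    rw [add_zero] at h2
    exact ge_of_tendsto' h2 h1
  · have hSae : ∀ᵐ t ∂m, ∀ n, S n t = ((∑ k ∈ Finset.range n, ‖u k t‖ : ℝ) : ℂ) := by
      refine ae_all_iff.2 fun n => ?_
      filter_upwards [coeFn_sum_ae (Finset.range n) v,
        ae_all_iff.2 fun k => absL0_ae (u k)] with t h1 h2
      simp only [hS, hv] at h1 ⊢
      rw [h1]; push_cast
      exact Finset.sum_congr rfl fun k _ => h2 k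
    rw [ae_all_iff]
    intro n
    -- Completeness gives only a norm limit G. The excess (S_n - Re G)⁺ is dominated by |S_l - G|
    -- for all l ≥ n, so its norm is 0, whence S_n ≤ |G| a.e. without any a.e. convergent
    -- subsequence.
    let w : L0 := AEEqFun.mk (fun t => ((max ((S n t).re - (G t).re) 0 : ℝ) : ℂ))
      (Complex.continuous_ofReal.comp_aestronglyMeasurable
        (((Complex.continuous_re.comp_aestronglyMeasurable (S n).aestronglyMeasurable).sub
          (Complex.continuous_re.comp_aestronglyMeasurable G.aestronglyMeasurable)).sup
            aestronglyMeasurable_const))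
    have hwae : ∀ᵐ t ∂m, w t = ((max ((S n t).re - (G t).re) 0 : ℝ) : ℂ) := AEEqFun.coeFn_mk _ _
    have hw : X.N w = 0 := by
      refine le_antisymm (ge_of_tendsto hG ?_) bot_le
      filter_upwards [eventually_ge_atTop n] with l hl
      refine X.ideal _ _ ?_
      filter_upwards [hSae, hwae, AEEqFun.coeFn_sub (S l) G] with t h1 h2 h3
      rw [h2, h3, Pi.sub_apply, Complex.norm_real, Real.norm_of_nonneg (le_max_right _ _)]
      refine max_le ?_ (norm_nonneg _)
      refine le_trans ?_ (Complex.re_le_norm _)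
      rw [Complex.sub_re, h1 n, h1 l, Complex.ofReal_re, Complex.ofReal_re]
      refine sub_le_sub_right (Finset.sum_le_sum_of_subset_of_nonneg ?_ ?_) _
      · exact Finset.range_subset_range.2 hl
      · intro _ _ _; exact norm_nonneg _
    have hw0 : w =ᵐ[m] (0 : L0) := by rw [X.eq_zero_of_norm_eq_zero w hw]
    filter_upwards [hw0, hwae, hSae, AEEqFun.coeFn_zero (μ := m) (β := ℂ) (α := Torus)]
      with t h1 h2 h3 h4
    rw [h1, h4, Pi.zero_apply] at h2
    have h5 : max ((S n t).re - (G t).re) 0 = 0 := by exact_mod_cast h2.symm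
    have h6 := le_max_left ((S n t).re - (G t).re) 0
    rw [h5, h3 n, Complex.ofReal_re] at h6
    linarith [Complex.re_le_norm (G t)]

end BanachFunctionSpace

/-! ### The decreasing rearrangement -/

/-- The decreasing rearrangement of `f` on `(0, ∞)`, extended by zero. -/
def rearr (f : L0) (t : ℝ) : ℝ :=
  open Classical in
  if 0 < t then sInf {lam | 0 ≤ lam ∧ distribution f lam ≤ ENNReal.ofReal t} else 0

theorem distribution_anti (f : L0) {a b : ℝ} (h : a ≤ b) : distribution f b ≤ distribution f a :=
  measure_mono fun _ ht => lt_of_le_of_lt h ht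

theorem tendsto_distribution (f : L0) :
    Tendsto (fun n : ℕ => distribution f n) atTop (𝓝 0) := by
  have h := tendsto_measure_iInter_atTop (μ := m) (s := fun n : ℕ => {t | (n : ℝ) < ‖f t‖})
    (fun n => (measurableSet_lt measurable_const
      f.stronglyMeasurable.measurable.norm).nullMeasurableSet)
    (fun i j hij t (ht : (j : ℝ) < ‖f t‖) =>
      show (i : ℝ) < ‖f t‖ from lt_of_le_of_lt (Nat.cast_le.2 hij) ht) ⟨0, measure_ne_top _ _⟩
  have h2 : ⋂ n : ℕ, {t | (n : ℝ) < ‖f t‖} = ∅ := by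
    ext t
    simp only [Set.mem_iInter, Set.mem_ofPred_eq, Set.mem_empty_iff_false, iff_false, not_forall,
      not_lt]
    exact exists_nat_ge _
  rw [h2, measure_empty] at h
  exact h

theorem rearr_set_nonempty (f : L0) {t : ℝ} (ht : 0 < t) :
    {lam | 0 ≤ lam ∧ distribution f lam ≤ ENNReal.ofReal t}.Nonempty := by
  obtain ⟨n, hn⟩ := ((tendsto_distribution f).eventually
    (gt_mem_nhds (ENNReal.ofReal_pos.2 ht))).exists
  exact ⟨n, Nat.cast_nonneg n, hn.le⟩

theorem rearr_nonneg (f : L0) (t : ℝ) : 0 ≤ rearr f t := by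
  rw [rearr]
  split_ifs
  · exact Real.sInf_nonneg fun _ h => h.1
  · exact le_rfl

theorem rearr_le {f : L0} {t lam : ℝ} (hl : 0 ≤ lam)
    (h : distribution f lam ≤ ENNReal.ofReal t) : rearr f t ≤ lam := by
  rw [rearr]
  split_ifs
  · exact csInf_le ⟨0, fun _ h => h.1⟩ ⟨hl, h⟩
  · exact hl

/-- Right continuity of the distribution function: the infimum defining f* is attained. -/
theorem distribution_rearr_le (f : L0) {t : ℝ} (ht : 0 < t) :
    distribution f (rearr f t) ≤ ENNReal.ofReal t := by
  refine measure_le_of_eventually_mem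
    (S := fun n : ℕ => {x | rearr f t + 1 / ((n : ℝ) + 1) < ‖f x‖}) ?_ ?_
  · intro x hx
    have h1 : Tendsto (fun n : ℕ => rearr f t + 1 / ((n : ℝ) + 1)) atTop (𝓝 (rearr f t)) := by
      simpa using tendsto_one_div_add_atTop_nhds_zero_nat.const_add (rearr f t)
    exact h1.eventually (gt_mem_nhds hx)
  · intro n
    have h1 : rearr f t < rearr f t + 1 / ((n : ℝ) + 1) := by
      have : (0 : ℝ) < 1 / ((n : ℝ) + 1) := by positivity
      linarith
    have h2 : sInf {lam | 0 ≤ lam ∧ distribution f lam ≤ ENNReal.ofReal t} <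
        rearr f t + 1 / ((n : ℝ) + 1) := by
      refine lt_of_eq_of_lt ?_ h1
      rw [rearr, if_pos ht]
    obtain ⟨lam, ⟨-, h3⟩, h4⟩ := exists_lt_of_csInf_lt (rearr_set_nonempty f ht) h2
    exact (distribution_anti f h4.le).trans h3

theorem lt_rearr_iff {f : L0} {t lam : ℝ} (ht : 0 < t) (hl : 0 ≤ lam) :
    lam < rearr f t ↔ ENNReal.ofReal t < distribution f lam := by
  constructor
  · intro h
    by_contra hcon
    exact absurd (rearr_le hl (not_lt.1 hcon)) (not_le.2 h)
  · intro h
    by_contra hcon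
    exact absurd ((distribution_anti f (not_lt.1 hcon)).trans (distribution_rearr_le f ht))
      (not_le.2 h)

theorem rearr_anti (f : L0) {s t : ℝ} (hs : 0 < s) (hst : s ≤ t) : rearr f t ≤ rearr f s :=
  rearr_le (rearr_nonneg f s)
    ((distribution_rearr_le f hs).trans (ENNReal.ofReal_le_ofReal hst))

theorem rearr_eq_zero (f : L0) {t : ℝ} (ht : 1 ≤ t) : rearr f t = 0 := by
  refine le_antisymm (rearr_le le_rfl ?_) (rearr_nonneg f t)
  refine prob_le_one.trans ?_
  rw [← ENNReal.ofReal_one]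
  exact ENNReal.ofReal_le_ofReal ht

theorem measurable_rearr (f : L0) : Measurable (rearr f) := by
  refine measurable_of_Ioi fun lam => ?_
  rcases lt_or_ge lam 0 with h | h
  · convert MeasurableSet.univ
    ext t
    simpa using h.trans_le (rearr_nonneg f t)
  · have : rearr f ⁻¹' Set.Ioi lam =
        Set.Ioi 0 ∩ {t | ENNReal.ofReal t < distribution f lam} := by
      ext t
      simp only [Set.mem_preimage, Set.mem_Ioi, Set.mem_inter_iff, Set.mem_ofPred_eq]
      rcases lt_or_ge 0 t with ht | ht
      · rw [lt_rearr_iff ht h]; simp [ht]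
      · rw [rearr, if_neg (not_lt.2 ht)]
        simp [not_lt.2 h, not_lt.2 ht]
    rw [this]
    exact measurableSet_Ioi.inter (measurableSet_lt ENNReal.measurable_ofReal measurable_const)

/-! ### Transport of the rearrangement to the circle -/

theorem arg_coe {y : ℝ} (hy : y ∈ Set.Ico 0 (2 * π)) : arg (y : Torus) = y := by
  have hy' : y ∈ Set.Ico 0 (0 + 2 * π) := by rwa [zero_add]
  exact congrArg Subtype.val
    ((AddCircle.equivIco (2 * π) 0).apply_symm_apply ⟨y, hy'⟩)

theorem measure_arg_preimage {A : Set ℝ} (hA : MeasurableSet A) :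
    m (arg ⁻¹' A) = (ENNReal.ofReal (2 * π))⁻¹ * volume (A ∩ Set.Ioo 0 (2 * π)) := by
  have h1 : volume (arg ⁻¹' A) = volume (A ∩ Set.Ioo 0 (2 * π)) := by
    rw [AddCircle.add_projection_respects_measure (2 * π) 0 (measurable_arg hA), zero_add]
    have e : ((QuotientAddGroup.mk ⁻¹' (arg ⁻¹' A) ∩ Set.Ioc 0 (2 * π) : Set ℝ)) =ᵐ[volume]
        ((QuotientAddGroup.mk ⁻¹' (arg ⁻¹' A) ∩ Set.Ioo 0 (2 * π) : Set ℝ)) :=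
      (ae_eq_refl _).inter Ioo_ae_eq_Ioc.symm
    rw [measure_congr e]
    congr 1
    ext y
    simp only [Set.mem_inter_iff, Set.mem_preimage, and_congr_left_iff]
    intro hy
    rw [show arg (QuotientAddGroup.mk y) = y from arg_coe ⟨hy.1.le, hy.2⟩]
  rw [← h1, AddCircle.volume_eq_smul_haarAddCircle, Measure.smul_apply, smul_eq_mul, ← mul_assoc,
    ENNReal.inv_mul_cancel (by simp [Real.pi_pos]) ENNReal.ofReal_ne_top, one_mul]

theorem ae_arg_pos : ∀ᵐ x ∂m, 0 < arg x := by
  rw [ae_iff]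
  have : {x | ¬ 0 < arg x} = arg ⁻¹' (Set.Iic 0) := by ext x; simp
  rw [this, measure_arg_preimage measurableSet_Iic]
  have : Set.Iic 0 ∩ Set.Ioo 0 (2 * π) = ∅ := by
    ext y
    simp only [Set.mem_inter_iff, Set.mem_Iic, Set.mem_Ioo, Set.mem_empty_iff_false, iff_false]
    rintro ⟨h1, h2, -⟩; linarith
  rw [this]; simp

/-- The rearrangement of `f`, dilated by `a` and moved to the circle. -/
def rdil (f : L0) (a : ℝ) : L0 :=
  AEEqFun.mk (fun x => ((rearr f (a * arg x / (2 * π)) : ℝ) : ℂ))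
    (Complex.measurable_ofReal.comp ((measurable_rearr f).comp
      ((measurable_arg.const_mul a).div_const _))).aestronglyMeasurable

theorem rdil_ae (f : L0) (a : ℝ) :
    ∀ᵐ x ∂m, rdil f a x = ((rearr f (a * arg x / (2 * π)) : ℝ) : ℂ) := AEEqFun.coeFn_mk _ _

/-- A superlevel set of the transported rearrangement is, up to a null set, the arc (0, 2πd), where
d is the measure of the corresponding set for f. -/
theorem equimeasurable_rdil_one (f : L0) : Equimeasurable (rdil f 1) f := by
  intro lam hl
  have h1 : distribution (rdil f 1) lam =
      m (arg ⁻¹' {y | ENNReal.ofReal (y / (2 * π)) < distribution f lam}) := by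
    refine measure_congr ?_
    filter_upwards [rdil_ae f 1, ae_arg_pos] with x hx hpos
    refine propext ?_
    simp only [Set.preimage_ofPred_eq]
    change lam < ‖rdil f 1 x‖ ↔ _ < _
    rw [hx, Complex.norm_real, Real.norm_of_nonneg (rearr_nonneg _ _), one_mul,
      lt_rearr_iff (div_pos hpos Real.two_pi_pos) hl]
  have hfin : distribution f lam ≠ ∞ := measure_ne_top _ _
  set d := (distribution f lam).toReal with hd
  have hd0 : 0 ≤ d := ENNReal.toReal_nonneg
  have hd1 : d ≤ 1 := ENNReal.toReal_le_of_le_ofReal zero_le_one (by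
    rw [ENNReal.ofReal_one]; exact prob_le_one)
  have hdd : distribution f lam = ENNReal.ofReal d := (ENNReal.ofReal_toReal hfin).symm
  have hmeas : MeasurableSet {y : ℝ | ENNReal.ofReal (y / (2 * π)) < distribution f lam} :=
    measurableSet_lt (ENNReal.measurable_ofReal.comp (measurable_id.div_const _))
      measurable_const
  rw [h1, measure_arg_preimage hmeas]
  have h2 : {y | ENNReal.ofReal (y / (2 * π)) < distribution f lam} ∩ Set.Ioo 0 (2 * π) =
      Set.Ioo 0 (2 * π * d) := by
    ext y
    simp only [Set.mem_inter_iff, Set.mem_ofPred_eq, Set.mem_Ioo]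
    rw [hdd]
    have hpi := Real.two_pi_pos
    constructor
    · rintro ⟨h3, h4, -⟩
      refine ⟨h4, ?_⟩
      have h5 := (ENNReal.ofReal_lt_ofReal_iff_of_nonneg (div_nonneg h4.le hpi.le)).1 h3
      rw [div_lt_iff₀ hpi] at h5
      linarith
    · rintro ⟨h3, h4⟩
      refine ⟨?_, h3, by nlinarith⟩
      rw [ENNReal.ofReal_lt_ofReal_iff_of_nonneg (div_nonneg h3.le hpi.le), div_lt_iff₀ hpi]
      linarith
  rw [h2, Real.volume_Ioo, sub_zero, ENNReal.ofReal_mul Real.two_pi_pos.le, ← mul_assoc,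
    ENNReal.inv_mul_cancel (by simp [Real.pi_pos]) ENNReal.ofReal_ne_top, one_mul, hdd]

/-- Dilations act on classes: any representative may be used. -/
theorem dilation_ae {s : ℝ} (hs : 0 < s) {f : L0} {φ : Torus → ℂ} (h : f =ᵐ[m] φ) :
    ∀ᵐ x ∂m, dilation s f x = open Classical in
      if s * arg x ∈ Set.Ico 0 (2 * π) then φ ((s * arg x : ℝ) : Torus) else 0 := by
  set Z := toMeasurable m {y | ¬ f y = φ y} with hZ
  have hZm : MeasurableSet Z := measurableSet_toMeasurable _ _
  have hZ0 : m Z = 0 := by rw [hZ, measure_toMeasurable]; exact h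
  have hvol : volume (Set.Ioc 0 (2 * π) ∩ QuotientAddGroup.mk ⁻¹' Z : Set ℝ) = 0 := by
    have := AddCircle.add_projection_respects_measure (2 * π) 0 hZm
    rw [AddCircle.volume_eq_smul_haarAddCircle, Measure.smul_apply, hZ0, smul_zero, zero_add]
      at this
    rw [Set.inter_comm]; exact this.symm
  set B : Set ℝ := Set.Ioc 0 (2 * π) ∩ QuotientAddGroup.mk ⁻¹' Z with hB
  have hBm : MeasurableSet B := measurableSet_Ioc.inter (AddCircle.measurable_mk' hZm)
  have hnull : m (arg ⁻¹' ((fun y => s * y) ⁻¹' B)) = 0 := by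
    rw [measure_arg_preimage ((measurable_const_mul s) hBm)]
    have : volume ((fun y => s * y) ⁻¹' B) = 0 := by
      rw [Real.volume_preimage_mul_left hs.ne', hvol, mul_zero]
    rw [measure_mono_null Set.inter_subset_left this, mul_zero]
  filter_upwards [AEEqFun.coeFn_mk (dilationFun s f)
    (measurable_dilationFun s f).aestronglyMeasurable, ae_arg_pos,
    measure_eq_zero_iff_ae_notMem.1 hnull] with x h1 h2 h3
  rw [dilation, h1, dilationFun]
  split_ifs with hx
  · by_contra hne
    refine h3 ⟨⟨mul_pos hs h2, hx.2.le⟩, ?_⟩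
    exact subset_toMeasurable m _ hne
  · rfl

/-- The value 0 that a dilation takes outside its range agrees with f*, which vanishes from 1 on
because the circle has mass one. -/
theorem dilation_rdil {s : ℝ} (hs : 0 < s) (f : L0) : dilation s (rdil f 1) = rdil f s := by
  refine AEEqFun.ext ?_
  filter_upwards [dilation_ae hs (rdil_ae f 1), rdil_ae f s, ae_arg_pos] with x h1 h2 h3
  rw [h1, h2]
  split_ifs with hx
  · rw [arg_coe hx, one_mul]
  · rw [rearr_eq_zero, Complex.ofReal_zero]
    rw [le_div_iff₀ Real.two_pi_pos, one_mul]
    by_contra hcon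
    exact hx ⟨(mul_pos hs h3).le, not_le.1 hcon⟩

theorem dilation_smul {s : ℝ} (hs : 0 < s) (c : ℂ) (f : L0) :
    dilation s (c • f) = c • dilation s f := by
  refine AEEqFun.ext ?_
  filter_upwards [dilation_ae hs (AEEqFun.coeFn_smul c f),
    dilation_ae hs (ae_eq_refl f), AEEqFun.coeFn_smul c (dilation s f)] with x h1 h2 h3
  rw [h1, h3]
  change _ = c • dilation s f x
  rw [h2]
  split_ifs
  · rfl
  · simp

/-! ### Boyd indices and dilated rearrangements -/

namespace BanachFunctionSpace

theorem N_dilation_le (X : BanachFunctionSpace) {s : ℝ} (hs : 0 < s) {f : L0} (hf : X.N f ≠ ∞) :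
    X.N (dilation s f) ≤ X.dilationNorm s * X.N f := by
  rcases eq_or_ne (X.N f) 0 with h0 | h0
  · have e : f = (0 : ℂ) • f := by
      rw [X.eq_zero_of_norm_eq_zero f h0]; exact (zero_smul ℂ (0 : L0)).symm
    have : X.N (dilation s f) = 0 := by
      rw [e, dilation_smul hs, X.norm_smul]; simp
    rw [this]; exact bot_le
  · set c : ℂ := (((X.N f).toReal⁻¹ : ℝ) : ℂ) with hc
    have hpos : 0 < (X.N f).toReal := ENNReal.toReal_pos h0 hf
    have hcn : ‖c‖ₑ = (X.N f)⁻¹ := by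
      rw [hc, ← ofReal_norm, Complex.norm_real, Real.norm_of_nonneg (inv_nonneg.2 hpos.le),
        ENNReal.ofReal_inv_of_pos hpos, ENNReal.ofReal_toReal hf]
    have h1 : X.N (dilation s (c • f)) ≤ X.dilationNorm s := by
      refine le_iSup₂_of_le (c • f) ?_ le_rfl
      rw [X.norm_smul, hcn, ENNReal.inv_mul_cancel h0 hf]
    rw [dilation_smul hs, X.norm_smul, hcn, ENNReal.inv_mul_le_iff h0 hf] at h1
    rwa [mul_comm]

/-- Both `toReal` and `Real.log` have default values: operator norms 0 and ∞ alike give logarithm 0.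
A nonzero logarithm therefore certifies that D is positive and finite. -/
theorem le_of_log_div_lt {D : ℝ≥0∞} {s c : ℝ} (h0 : Real.log D.toReal ≠ 0)
    (h : Real.log D.toReal ≤ c * Real.log s) (hs : 0 < s) : D ≤ ENNReal.ofReal (s ^ c) := by
  have hne : D.toReal ≠ 0 := fun h => h0 (by rw [h, Real.log_zero])
  have hpos : 0 < D.toReal := lt_of_le_of_ne ENNReal.toReal_nonneg hne.symm
  have hfin : D ≠ ∞ := fun h => hne (by rw [h]; rfl)
  rw [← ENNReal.ofReal_toReal hfin]
  refine ENNReal.ofReal_le_ofReal ?_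
  rw [← Real.log_rpow hs] at h
  exact (Real.log_le_log_iff hpos (Real.rpow_pos_of_pos hs c)).1 h

theorem exists_dilationNorm_le {Y : BanachFunctionSpace} (h : Y.HasNontrivialBoydIndices) :
    ∃ θ τ : ℝ, 0 < θ ∧ θ < 1 ∧ 1 ≤ τ ∧ τ < 2 ∧ ∃ k₀ : ℕ, ∀ k ≥ k₀,
      Y.dilationNorm (2 ^ k) ≤ ENNReal.ofReal (θ ^ k) ∧
      Y.dilationNorm (2 ^ k)⁻¹ ≤ ENNReal.ofReal (τ ^ k) := by
  obtain ⟨α, β, hα, hβ, ⟨hα0, hα1⟩, ⟨hβ0, hβ1⟩⟩ := h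
  have hpow : Tendsto (fun k : ℕ => (2 : ℝ) ^ k) atTop atTop :=
    tendsto_pow_atTop_atTop_of_one_lt one_lt_two
  have hinv : Tendsto (fun k : ℕ => ((2 : ℝ) ^ k)⁻¹) atTop (𝓝[>] 0) :=
    tendsto_inv_atTop_nhdsGT_zero.comp hpow
  have e1 := (hα.comp hinv).eventually (lt_mem_nhds (show α / 2 < α by linarith))
  -- Positivity of β serves only to make the logarithm nonzero, which rules out an infinite dilation
  -- norm.
  have e2 := (hβ.comp hpow).eventually (lt_mem_nhds hβ0)
  have e3 := (hβ.comp hpow).eventually (gt_mem_nhds (show β < (1 + β) / 2 by linarith))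
  obtain ⟨k₀, hk₀⟩ := eventually_atTop.1 (e1.and (e2.and (e3.and (eventually_ge_atTop 1))))
  -- The exponents leave room on both sides: α/2 lies between 0 and α, and (1+β)/2 between β and 1.
  refine ⟨2 ^ (-(α / 2)), 2 ^ ((1 + β) / 2), by positivity,
    Real.rpow_lt_one_of_one_lt_of_neg one_lt_two (by linarith),
    Real.one_le_rpow one_le_two (by linarith), ?_, k₀, fun k hk => ?_⟩
  · calc (2 : ℝ) ^ ((1 + β) / 2) < 2 ^ (1 : ℝ) :=
        Real.rpow_lt_rpow_of_exponent_lt one_lt_two (by linarith)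
      _ = 2 := Real.rpow_one 2
  obtain ⟨h1, h2, h3, h4⟩ := hk₀ k hk
  simp only [Function.comp, one_div, inv_inv] at h1 h2 h3
  have hk1 : (1 : ℝ) ≤ k := by exact_mod_cast h4
  have hlog2 := Real.log_pos one_lt_two
  have hlogk : 0 < Real.log ((2 : ℝ) ^ k) := by rw [Real.log_pow]; positivity
  constructor
  · rw [Real.log_inv, div_neg, lt_neg, div_lt_iff₀ hlogk] at h1
    have hne : Real.log (Y.dilationNorm (2 ^ k)).toReal ≠ 0 := by
      intro h0; rw [h0] at h1; nlinarith
    have := le_of_log_div_lt (s := 2 ^ k) (c := -(α / 2)) hne h1.le (by positivity)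
    refine this.trans_eq ?_
    congr 1
    rw [← Real.rpow_natCast, ← Real.rpow_natCast, ← Real.rpow_mul zero_le_two,
      ← Real.rpow_mul zero_le_two, mul_comm]
  · rw [div_lt_iff₀ hlogk] at h3
    have hne : Real.log (Y.dilationNorm (2 ^ k)⁻¹).toReal ≠ 0 := by
      intro h0; rw [h0, zero_div] at h2; exact lt_irrefl _ h2
    have := le_of_log_div_lt (s := 2 ^ k) (c := (1 + β) / 2) hne h3.le (by positivity)
    refine this.trans_eq ?_
    congr 1
    rw [← Real.rpow_natCast, ← Real.rpow_natCast, ← Real.rpow_mul zero_le_two,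
      ← Real.rpow_mul zero_le_two, mul_comm]

theorem N_rdil_anti (X : BanachFunctionSpace) (f : L0) {a b : ℝ} (ha : 0 < a) (hab : a ≤ b) :
    X.N (rdil f b) ≤ X.N (rdil f a) := by
  refine X.ideal _ _ ?_
  filter_upwards [rdil_ae f a, rdil_ae f b, ae_arg_pos] with x h1 h2 h3
  rw [h1, h2, Complex.norm_real, Complex.norm_real, Real.norm_of_nonneg (rearr_nonneg _ _),
    Real.norm_of_nonneg (rearr_nonneg _ _)]
  refine rearr_anti f (by positivity) ?_
  gcongr

theorem N_rdil_one {X : BanachFunctionSpace} (hX : X.IsRI) {f : L0} (hf : X.N f < ∞) :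
    X.N (rdil f 1) = X.N f :=
  ((hX f (rdil f 1) (fun lam hl => (equimeasurable_rdil_one f lam hl).symm) hf).2).symm

theorem N_eq_of_N_rdil_lt_top {X : BanachFunctionSpace} (hX : X.IsRI) {f : L0}
    (hf : X.N (rdil f 1) < ∞) : X.N f = X.N (rdil f 1) :=
  ((hX (rdil f 1) f (equimeasurable_rdil_one f) hf).2).symm

/-- `Y` has dilation exponents `θ < 1` and `τ < 2`: dilated rearrangements have geometrically
controlled norms. -/
def HasDilationBounds (Y : BanachFunctionSpace) (K θ τ : ℝ≥0) : Prop :=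
  ∀ f, Y.N f < ∞ → ∀ k : ℕ,
    Y.N (rdil f (2 ^ k)) ≤ K * θ ^ k * Y.N f ∧ Y.N (rdil f (2 ^ k)⁻¹) ≤ K * τ ^ k * Y.N f

theorem exists_hasDilationBounds {Y : BanachFunctionSpace} (hY : Y.IsRI)
    (h : Y.HasNontrivialBoydIndices) :
    ∃ K θ τ : ℝ≥0, θ < 1 ∧ τ < 2 ∧ Y.HasDilationBounds K θ τ := by
  obtain ⟨θ, τ, hθ0, hθ1, hτ1, hτ2, k₀, hk⟩ := exists_dilationNorm_le h
  lift θ to ℝ≥0 using hθ0.le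
  lift τ to ℝ≥0 using (zero_le_one.trans hτ1)
  have hθ0' : 0 < θ := by exact_mod_cast hθ0
  have hθ1' : θ < 1 := by exact_mod_cast hθ1
  have hτ1' : 1 ≤ τ := by exact_mod_cast hτ1
  have hco : ∀ (a : ℝ≥0) (k : ℕ), ENNReal.ofReal ((a : ℝ) ^ k) = (a : ℝ≥0∞) ^ k := fun a k => by
    rw [← NNReal.coe_pow, ENNReal.ofReal_coe_nnreal, ENNReal.coe_pow]
  simp only [hco] at hk
  -- The constant absorbs the finitely many k < k₀. There f* being decreasing gives a comparison
  -- with the undilated rearrangement for θ and with the dilation by 2^{-k₀} for τ.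
  refine ⟨(θ ^ k₀)⁻¹ + τ ^ k₀ + 1, θ, τ, hθ1', by exact_mod_cast hτ2, fun f hf k => ?_⟩
  have hN := N_rdil_one hY hf
  have hD : ∀ a : ℝ, 0 < a → Y.N (rdil f a) ≤ Y.dilationNorm a * Y.N f := fun a ha => by
    have := Y.N_dilation_le ha (f := rdil f 1) (by rw [hN]; exact hf.ne)
    rwa [dilation_rdil ha, hN] at this
  rcases le_or_gt k₀ k with hkk | hkk
  · refine ⟨(hD _ (by positivity)).trans ?_, (hD _ (by positivity)).trans ?_⟩
    · gcongr
      refine (hk k hkk).1.trans ?_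
      refine le_mul_of_one_le_left bot_le ?_
      push_cast; exact le_add_self
    · gcongr
      refine (hk k hkk).2.trans ?_
      refine le_mul_of_one_le_left bot_le ?_
      push_cast; exact le_add_self
  · constructor
    · refine (Y.N_rdil_anti f one_pos (one_le_pow₀ one_le_two)).trans ?_
      rw [hN]
      refine le_mul_of_one_le_left bot_le ?_
      have : (1 : ℝ≥0) ≤ ((θ ^ k₀)⁻¹ + τ ^ k₀ + 1) * θ ^ k := by
        calc (1 : ℝ≥0) = (θ ^ k₀)⁻¹ * θ ^ k₀ := (inv_mul_cancel₀ (by positivity)).symm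
          _ ≤ ((θ ^ k₀)⁻¹ + τ ^ k₀ + 1) * θ ^ k := by
            refine mul_le_mul' ?_ (pow_le_pow_of_le_one bot_le hθ1'.le hkk.le)
            rw [add_assoc]; exact le_self_add
      exact_mod_cast this
    · refine (Y.N_rdil_anti f (b := (2 ^ k)⁻¹) (a := (2 ^ k₀)⁻¹) (by positivity) ?_).trans ?_
      · gcongr
        · norm_num
      · refine (hD _ (by positivity)).trans ?_
        gcongr
        refine (hk k₀ le_rfl).2.trans ?_
        have : τ ^ k₀ ≤ ((θ ^ k₀)⁻¹ + τ ^ k₀ + 1) * τ ^ k := by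
          calc τ ^ k₀ = τ ^ k₀ * 1 := (mul_one _).symm
            _ ≤ ((θ ^ k₀)⁻¹ + τ ^ k₀ + 1) * τ ^ k := by
              gcongr
              · rw [add_assoc, add_left_comm]; exact le_self_add
              · exact one_le_pow₀ hτ1'
        exact_mod_cast this

end BanachFunctionSpace

/-! ### Dyadic estimates of integrals by the rearrangement -/

theorem measure_lt_norm_le (f : L0) {t : ℝ} (ht : 0 < t) :
    m {x | rearr f t < ‖f x‖} ≤ ENNReal.ofReal t := distribution_rearr_le f ht

theorem measurableSet_lt_norm (f : L0) (c : ℝ) : MeasurableSet {x | c < ‖f x‖} :=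
  measurableSet_lt measurable_const f.stronglyMeasurable.measurable.norm

/-- On A the function g is dominated by ∑ c_k times the indicator of {|f| > f*(t_k)}, a set of
measure at most t_k. -/
theorem lintegral_tsum_indicator_le (f : L0) (c : ℕ → ℝ≥0∞) (t : ℕ → ℝ) (ht : ∀ k, 0 < t k)
    {A : Set Torus} {g : Torus → ℝ≥0∞}
    (h : ∀ᵐ x ∂m, x ∈ A → ∃ k, g x ≤ c k ∧ rearr f (t k) < ‖f x‖) (hA : MeasurableSet A) :
    ∫⁻ x in A, g x ∂m ≤ ∑' k, c k * ENNReal.ofReal (t k) := by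
  calc ∫⁻ x in A, g x ∂m
      ≤ ∫⁻ x in A, ∑' k, ({x | rearr f (t k) < ‖f x‖}.indicator (fun _ => c k) x) ∂m := by
        refine setLIntegral_mono_ae' hA ?_
        filter_upwards [h] with x hx hxA
        obtain ⟨k, h1, h2⟩ := hx hxA
        refine h1.trans (le_trans ?_ (ENNReal.le_tsum k))
        rw [Set.indicator_of_mem (by exact h2)]
    _ ≤ ∫⁻ x, ∑' k, ({x | rearr f (t k) < ‖f x‖}.indicator (fun _ => c k) x) ∂m :=
        setLIntegral_le_lintegral _ _
    _ = ∑' k, c k * m {x | rearr f (t k) < ‖f x‖} := by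
        rw [lintegral_tsum fun k =>
          (measurable_const.indicator (measurableSet_lt_norm f _)).aemeasurable]
        congr 1; ext k
        rw [lintegral_indicator_const (measurableSet_lt_norm f _)]
    _ ≤ _ := by
        refine ENNReal.tsum_le_tsum fun k => ?_
        gcongr
        exact measure_lt_norm_le f (ht k)

/-- Almost every x of the set has a first k with |f(x)| ≤ f*(2^{-k}s), and k ≥ 1. Then |f(x)| still
exceeds the previous level f*(2^{-(k-1)}s), which bounds the measure of the layer. -/
theorem lintegral_large_le (f : L0) {s : ℝ} (hs : 0 < s) :
    ∫⁻ x in {x | rearr f s < ‖f x‖}, ‖f x‖ₑ ∂m ≤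
      ∑' k : ℕ, ENNReal.ofReal (rearr f ((2 ^ (k + 1))⁻¹ * s)) *
        ENNReal.ofReal ((2 ^ k)⁻¹ * s) := by
  refine lintegral_tsum_indicator_le f _ _ (fun k => by positivity) ?_ (measurableSet_lt_norm f _)
  have hnull : ∀ᵐ x ∂m, ∃ k : ℕ, ‖f x‖ ≤ rearr f ((2 ^ k)⁻¹ * s) := by
    rw [ae_iff]
    have hlim : Tendsto (fun k : ℕ => ENNReal.ofReal ((2 ^ k)⁻¹ * s)) atTop (𝓝 0) := by
      rw [← ENNReal.ofReal_zero]
      refine ENNReal.tendsto_ofReal ?_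
      have h1 : Tendsto (fun k : ℕ => ((2 : ℝ) ^ k)⁻¹) atTop (𝓝 0) :=
        tendsto_inv_atTop_zero.comp (tendsto_pow_atTop_atTop_of_one_lt one_lt_two)
      simpa using h1.mul_const s
    refine le_antisymm (ge_of_tendsto' hlim fun k => ?_) bot_le
    refine (measure_mono fun x hx => ?_).trans (measure_lt_norm_le f (by positivity))
    simp only [Set.mem_ofPred_eq, not_exists, not_le] at hx
    exact hx k
  filter_upwards [hnull] with x hx hxA
  classical
  have hmem := Nat.find_spec hx
  have hpos : Nat.find hx ≠ 0 := fun h0 => by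
    rw [h0] at hmem
    simp only [pow_zero, inv_one, one_mul] at hmem
    exact absurd hxA (not_lt.2 hmem)
  obtain ⟨j, hj⟩ := Nat.exists_eq_succ_of_ne_zero hpos
  refine ⟨j, ?_, ?_⟩
  · rw [hj] at hmem
    rw [← ofReal_norm]
    exact ENNReal.ofReal_le_ofReal hmem
  · exact not_le.1 (Nat.find_min hx (m := j) (by omega))

/-- The same slicing towards small values: the first k with f*(2^k s) < |f(x)| exists wherever f(x)
≠ 0, since f* vanishes from 1 on. -/
theorem lintegral_small_le (f : L0) {s : ℝ} (hs : 0 < s) {p : ℕ} (hp : p ≠ 0) :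
    ∫⁻ x in {x | rearr f s < ‖f x‖}ᶜ, ‖f x‖ₑ ^ p ∂m ≤
      ∑' k : ℕ, ENNReal.ofReal (rearr f (2 ^ k * s)) ^ p *
        ENNReal.ofReal (2 ^ (k + 1) * s) := by
  have hmeas := measurableSet_lt_norm f (rearr f s)
  have hz : MeasurableSet {x | (0 : ℝ) < ‖f x‖} := measurableSet_lt_norm f 0
  have e : ∫⁻ x in {x | rearr f s < ‖f x‖}ᶜ, ‖f x‖ₑ ^ p ∂m =
      ∫⁻ x in {x | rearr f s < ‖f x‖}ᶜ ∩ {x | 0 < ‖f x‖}, ‖f x‖ₑ ^ p ∂m := by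
    rw [← lintegral_indicator hmeas.compl, ← lintegral_indicator (hmeas.compl.inter hz)]
    congr 1; ext x
    by_cases h0 : 0 < ‖f x‖
    · by_cases h1 : x ∈ {x | rearr f s < ‖f x‖}ᶜ
      · rw [Set.indicator_of_mem h1, Set.indicator_of_mem (show x ∈ _ ∩ _ from ⟨h1, h0⟩)]
      · rw [Set.indicator_of_notMem h1, Set.indicator_of_notMem fun h => h1 h.1]
    · have hf0 : f x = 0 := by simpa using h0
      simp [Set.indicator, hf0, hp]
  rw [e]
  refine lintegral_tsum_indicator_le f _ _ (fun k => by positivity) ?_ (hmeas.compl.inter hz)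
  refine Eventually.of_forall fun x hx => ?_
  have hex : ∃ k : ℕ, rearr f (2 ^ k * s) < ‖f x‖ := by
    obtain ⟨k, hk⟩ := pow_unbounded_of_one_lt s⁻¹ (one_lt_two (α := ℝ))
    refine ⟨k, ?_⟩
    rw [rearr_eq_zero f]
    · exact hx.2
    · rw [inv_lt_iff_one_lt_mul₀ hs] at hk
      exact hk.le
  classical
  have hmem := Nat.find_spec hex
  have hpos : Nat.find hex ≠ 0 := fun h0 => by
    rw [h0] at hmem
    simp only [pow_zero, one_mul] at hmem
    exact hx.1 hmem
  obtain ⟨j, hj⟩ := Nat.exists_eq_succ_of_ne_zero hpos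
  refine ⟨j, ?_, ?_⟩
  · have := not_lt.1 (Nat.find_min hex (m := j) (by omega))
    rw [← ofReal_norm]
    gcongr
  · rw [hj] at hmem; exact hmem

theorem tsum_pow_le_pow_tsum (a : ℕ → ℝ≥0∞) {p : ℕ} (hp : p ≠ 0) :
    ∑' k, a k ^ p ≤ (∑' k, a k) ^ p := by
  obtain ⟨q, rfl⟩ := Nat.exists_eq_succ_of_ne_zero hp
  calc ∑' k, a k ^ (q + 1) ≤ ∑' k, (∑' j, a j) ^ q * a k := by
        refine ENNReal.tsum_le_tsum fun k => ?_
        rw [pow_succ]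
        gcongr
        exact ENNReal.le_tsum k
    _ = (∑' k, a k) ^ (q + 1) := by rw [ENNReal.tsum_mul_left, pow_succ]

/-! ### The Calderón estimate for Cauchy integrals -/

/-- The first half of the Calderón operator, in dyadic form. -/
def calderonLow (f : L0) (t : ℝ) : ℝ≥0∞ :=
  ∑' k : ℕ, ((2⁻¹ : ℝ≥0) : ℝ≥0∞) ^ k * ENNReal.ofReal (rearr f ((2 ^ k)⁻¹ * t))

/-- The second half of the Calderón operator, in dyadic form and with growing weights. -/
def calderonHigh (ρ : ℝ≥0) (f : L0) (t : ℝ) : ℝ≥0∞ :=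
  ∑' k : ℕ, (ρ : ℝ≥0∞) ^ k * ENNReal.ofReal (rearr f (2 ^ k * t))

theorem ofReal_two_pow_inv_mul (k : ℕ) (t : ℝ) :
    ENNReal.ofReal ((2 ^ k)⁻¹ * t) = ((2⁻¹ : ℝ≥0) : ℝ≥0∞) ^ k * ENNReal.ofReal t := by
  rw [ENNReal.ofReal_mul (by positivity)]
  congr 1
  rw [← inv_pow, ENNReal.ofReal_pow (by positivity)]
  congr 1
  rw [← ENNReal.ofReal_coe_nnreal]; simp

theorem lintegral_large_le_calderonLow (f : L0) {s : ℝ} (hs : 0 < s) :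
    ∫⁻ x in {x | rearr f s < ‖f x‖}, ‖f x‖ₑ ∂m ≤ ENNReal.ofReal (2 * s) * calderonLow f s := by
  refine (lintegral_large_le f hs).trans ?_
  rw [calderonLow, ← ENNReal.tsum_mul_left]
  calc ∑' k : ℕ, ENNReal.ofReal (rearr f ((2 ^ (k + 1))⁻¹ * s)) * ENNReal.ofReal ((2 ^ k)⁻¹ * s)
      = ∑' k : ℕ, (fun k : ℕ => ENNReal.ofReal (2 * s) * (((2⁻¹ : ℝ≥0) : ℝ≥0∞) ^ k *
          ENNReal.ofReal (rearr f ((2 ^ k)⁻¹ * s)))) (k + 1) := by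
        refine tsum_congr fun k => ?_
        simp only
        rw [← mul_assoc, mul_comm (ENNReal.ofReal (2 * s)), ← ofReal_two_pow_inv_mul, mul_comm]
        congr 2
        rw [pow_succ]; field_simp
    _ ≤ _ := ENNReal.tsum_comp_le_tsum_of_injective (add_left_injective 1) _

/-- With ρ^p = 2 the weights 2^k become p-th powers, and the ℓ^p norm is at most the ℓ¹ norm. A
large p makes ρ close to 1. -/
theorem lintegral_small_le_calderonHigh (f : L0) {s : ℝ} (hs : 0 < s) {p : ℕ} (hp : p ≠ 0)
    {ρ : ℝ≥0} (hρ : ρ ^ p = 2) :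
    ∫⁻ x in {x | rearr f s < ‖f x‖}ᶜ, ‖f x‖ₑ ^ p ∂m ≤
      ENNReal.ofReal (2 * s) * calderonHigh ρ f s ^ p := by
  refine (lintegral_small_le f hs hp).trans ?_
  refine le_trans (le_of_eq ?_) (mul_le_mul_right (tsum_pow_le_pow_tsum _ hp) _)
  rw [← ENNReal.tsum_mul_left]
  refine tsum_congr fun k => ?_
  have e : ((ρ : ℝ≥0∞) ^ k) ^ p = ENNReal.ofReal (2 ^ k) := by
    rw [← pow_mul, mul_comm, pow_mul, ← ENNReal.coe_pow, hρ, ENNReal.ofReal_pow zero_le_two]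
    simp
  rw [mul_pow, e, mul_comm, ← mul_assoc, ← ENNReal.ofReal_mul (by positivity)]
  congr 2
  rw [pow_succ]; ring

/-- Cut |f| at the height f*(t). The weak (1,1) estimate for the large part and Chebyshev's
inequality with the L^{2k} estimate for the bounded part each leave an exceptional set of measure at
most t/2. -/
theorem exists_rearr_cauchyInt_le {k : ℕ} (hk : 1 ≤ k) : ∃ A : ℝ≥0,
    ∀ (ρ : ℝ≥0), ρ ^ (2 * k) = 2 → ∀ f : L0, Integrable f m → ∀ r ∈ Set.Ioo (0 : ℝ) 1,
      ∀ g : L0, (∀ᵐ x ∂m, g x = cauchyInt (fun t => ((‖f t‖ : ℝ) : ℂ)) (r * fourier 1 x)) →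
      ∀ t : ℝ, 0 < t → ENNReal.ofReal (rearr g t) ≤
        A * (calderonLow f t + calderonHigh ρ f t) := by
  obtain ⟨B, hB, hLp⟩ := exists_integral_norm_cauchyInt_pow_le k hk
  -- The weak type part needs A₀ ≥ 8, the L^{2k} part needs A₀^{2k} ≥ 4B, and A₀ ≥ 1 gives A₀ ≤
  -- A₀^{2k}.
  set A₀ : ℝ := 9 + 4 * B with hA₀
  have hA₀pos : 0 < A₀ := by positivity
  have hp : 2 * k ≠ 0 := by omega
  have hApos : (2 * A₀).toNNReal ≠ 0 := by
    rw [Ne, Real.toNNReal_eq_zero, not_le]; positivity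
  refine ⟨(2 * A₀).toNNReal, fun ρ hρ f hf r hr g hg t ht => ?_⟩
  set S := calderonLow f t + calderonHigh ρ f t with hS
  rcases eq_or_ne S ∞ with hSt | hSt
  · rw [hSt, ENNReal.mul_top (by exact_mod_cast hApos)]
    exact le_top
  set Sr := S.toReal with hSr
  have hSr0 : 0 ≤ Sr := ENNReal.toReal_nonneg
  have hSS : S = ENNReal.ofReal Sr := (ENNReal.ofReal_toReal hSt).symm
  set lam := rearr f t
  set E : Set Torus := {x | lam < ‖f x‖} with hE
  have hEm : MeasurableSet E := measurableSet_lt_norm f lam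
  set φ : Torus → ℝ := fun x => ‖f x‖ with hφ
  have hφm : Measurable φ := f.stronglyMeasurable.measurable.norm
  set φ₁ : Torus → ℝ := E.indicator φ with hφ₁
  set φ₂ : Torus → ℝ := Eᶜ.indicator φ with hφ₂
  have hφ₁0 : ∀ x, 0 ≤ φ₁ x := fun x => Set.indicator_nonneg (fun _ _ => norm_nonneg _) x
  have hφ₂0 : ∀ x, 0 ≤ φ₂ x := fun x => Set.indicator_nonneg (fun _ _ => norm_nonneg _) x
  have hφ₂m : Measurable φ₂ := hφm.indicator hEm.compl
  have hlam0 : 0 ≤ lam := rearr_nonneg f t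
  have hφ₂b : ∀ x, φ₂ x ≤ lam := fun x => by
    refine Set.indicator_le' (f := φ) (g := fun _ => lam) (fun y hy => not_lt.1 hy)
      (fun y _ => hlam0) x
  have hφi : Integrable φ m := hf.norm
  have hφ₁i : Integrable φ₁ m := hφi.indicator hEm
  have hφ₂i : Integrable φ₂ m := hφi.indicator hEm.compl
  have hsum : ∀ x, φ x = φ₁ x + φ₂ x := fun x => by
    simp only [hφ₁, hφ₂]; rw [Set.indicator_self_add_compl_apply]
  have hInt1 : ∫ x, φ₁ x ∂m ≤ 2 * t * Sr := by
    rw [integral_eq_lintegral_of_nonneg_ae (Eventually.of_forall hφ₁0) hφ₁i.1]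
    refine ENNReal.toReal_le_of_le_ofReal (by positivity) ?_
    rw [ENNReal.ofReal_mul (by positivity), ← hSS]
    have e : ∫⁻ x, ENNReal.ofReal (φ₁ x) ∂m = ∫⁻ x in E, ‖f x‖ₑ ∂m := by
      rw [← lintegral_indicator hEm]
      congr 1; ext x
      by_cases hx : x ∈ E
      · simp [hφ₁, hφ, hx]
      · simp [hφ₁, hx]
    rw [e]
    refine (lintegral_large_le_calderonLow f ht).trans ?_
    gcongr
    exact le_self_add
  have hInt2 : ∫ x, φ₂ x ^ (2 * k) ∂m ≤ 2 * t * Sr ^ (2 * k) := by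
    rw [integral_eq_lintegral_of_nonneg_ae
      (Eventually.of_forall fun x => pow_nonneg (hφ₂0 x) _)
      (hφ₂m.pow_const _).aestronglyMeasurable]
    refine ENNReal.toReal_le_of_le_ofReal (by positivity) ?_
    rw [ENNReal.ofReal_mul (by positivity), ENNReal.ofReal_pow hSr0, ← hSS]
    have e : ∫⁻ x, ENNReal.ofReal (φ₂ x ^ (2 * k)) ∂m = ∫⁻ x in Eᶜ, ‖f x‖ₑ ^ (2 * k) ∂m := by
      rw [← lintegral_indicator hEm.compl]
      congr 1; ext x
      rw [ENNReal.ofReal_pow (hφ₂0 x)]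
      by_cases hx : x ∈ Eᶜ
      · rw [hφ₂, Set.indicator_of_mem hx, Set.indicator_of_mem hx, hφ, ofReal_norm]
      · rw [hφ₂, Set.indicator_of_notMem hx, Set.indicator_of_notMem hx, ENNReal.ofReal_zero,
          zero_pow hp]
    rw [e]
    refine (lintegral_small_le_calderonHigh f ht hp hρ).trans ?_
    gcongr
    exact le_add_self
  -- The slack ε keeps the level μ positive when the Calderón sum is zero.
  have key : ∀ ε > 0, rearr g t ≤ 2 * (A₀ * Sr + ε) := by
    intro ε hε
    set μ := A₀ * Sr + ε with hμ
    have hμ0 : 0 < μ := by positivity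
    refine rearr_le (by positivity) ?_
    have hr' : r ∈ Set.Ico (0 : ℝ) 1 := ⟨hr.1.le, hr.2⟩
    have hw1 := measure_lt_norm_cauchyInt hφ₁i hφ₁0 hr' hμ0
    have hcont2 := continuous_cauchyInt_circle (integrable_ofReal hφ₂i) hr
    have hmk := mul_meas_ge_le_integral_of_nonneg (μ := m)
      (f := fun x : Torus => ‖cauchyInt (fun t => (φ₂ t : ℂ)) (r * fourier 1 x)‖ ^ (2 * k))
      (Eventually.of_forall fun x => by positivity)
      (integrable_of_continuous_torus (hcont2.norm.pow _)) (μ ^ (2 * k))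
    have hLp' := hLp φ₂ lam hφ₂m hφ₂0 hφ₂b r hr'
    have hw2 : m {x : Torus | μ < ‖cauchyInt (fun t => (φ₂ t : ℂ)) (r * fourier 1 x)‖} ≤
        ENNReal.ofReal (t / 2) := by
      refine (measure_mono (t := {x : Torus | μ ^ (2 * k) ≤
        ‖cauchyInt (fun t => (φ₂ t : ℂ)) (r * fourier 1 x)‖ ^ (2 * k)})
        fun x (hx : μ < _) => pow_le_pow_left₀ hμ0.le hx.le _).trans ?_
      rw [← ENNReal.ofReal_toReal (measure_ne_top m {x : Torus | μ ^ (2 * k) ≤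
        ‖cauchyInt (fun t => (φ₂ t : ℂ)) (r * fourier 1 x)‖ ^ (2 * k)})]
      refine ENNReal.ofReal_le_ofReal ?_
      rw [Measure.real] at hmk
      have h1 : 4 * B * Sr ^ (2 * k) ≤ μ ^ (2 * k) := by
        calc 4 * B * Sr ^ (2 * k) ≤ A₀ ^ (2 * k) * Sr ^ (2 * k) := by
              gcongr
              calc 4 * B ≤ A₀ := by linarith
                _ ≤ A₀ ^ (2 * k) := le_self_pow₀ (by linarith) hp
          _ = (A₀ * Sr) ^ (2 * k) := (mul_pow _ _ _).symm
          _ ≤ μ ^ (2 * k) := by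
              gcongr
              linarith
      have h2 : μ ^ (2 * k) * (m {x : Torus | μ ^ (2 * k) ≤
          ‖cauchyInt (fun t => (φ₂ t : ℂ)) (r * fourier 1 x)‖ ^ (2 * k)}).toReal ≤
          μ ^ (2 * k) * (t / 2) := by
        calc _ ≤ B * (2 * t * Sr ^ (2 * k)) :=
              hmk.trans (hLp'.trans (mul_le_mul_of_nonneg_left hInt2 hB.le))
          _ = (4 * B * Sr ^ (2 * k)) * (t / 2) := by ring
          _ ≤ _ := by gcongr
      exact le_of_mul_le_mul_left h2 (by positivity)
    have hw1' : ENNReal.ofReal (2 * (∫ x, φ₁ x ∂m) / μ) ≤ ENNReal.ofReal (t / 2) := by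
      refine ENNReal.ofReal_le_ofReal ?_
      rw [div_le_iff₀ hμ0]
      have : 8 * Sr ≤ μ := by rw [hμ, hA₀]; nlinarith
      nlinarith
    have hsub : distribution g (2 * μ) ≤
        m ({x : Torus | μ < ‖cauchyInt (fun t => (φ₁ t : ℂ)) (r * fourier 1 x)‖} ∪
          {x : Torus | μ < ‖cauchyInt (fun t => (φ₂ t : ℂ)) (r * fourier 1 x)‖}) := by
      refine measure_mono_ae ?_
      filter_upwards [hg] with x hx
      intro (hx2 : 2 * μ < ‖g x‖)
      have e : cauchyInt (fun t => ((‖f t‖ : ℝ) : ℂ)) (r * fourier 1 x) =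
          cauchyInt (fun t => (φ₁ t : ℂ)) (r * fourier 1 x) +
            cauchyInt (fun t => (φ₂ t : ℂ)) (r * fourier 1 x) := by
        rw [← cauchyInt_add (integrable_ofReal hφ₁i) (integrable_ofReal hφ₂i)
          (norm_mul_fourier_lt_one hr x)]
        congr 1; ext y
        rw [← Complex.ofReal_add, ← hsum]
      rw [hx, e] at hx2
      by_contra hcon
      have hcon' : ¬ (μ < ‖cauchyInt (fun t => (φ₁ t : ℂ)) (r * fourier 1 x)‖ ∨
        μ < ‖cauchyInt (fun t => (φ₂ t : ℂ)) (r * fourier 1 x)‖) := hcon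
      rw [not_or, not_lt, not_lt] at hcon'
      have := norm_add_le (cauchyInt (fun t => (φ₁ t : ℂ)) (r * fourier 1 x))
        (cauchyInt (fun t => (φ₂ t : ℂ)) (r * fourier 1 x))
      linarith [hcon'.1, hcon'.2]
    refine hsub.trans ((measure_union_le _ _).trans
      ((add_le_add (hw1.trans hw1') hw2).trans_eq ?_))
    rw [← ENNReal.ofReal_add (by positivity) (by positivity)]
    congr 1; ring
  have hfinal : rearr g t ≤ 2 * A₀ * Sr := by
    refine le_of_forall_pos_le_add fun ε hε => ?_
    have := key (ε / 2) (by positivity)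
    linarith
  refine (ENNReal.ofReal_le_ofReal hfinal).trans_eq ?_
  rw [ENNReal.ofReal_mul (by positivity), ← hSS]
  rfl

namespace BanachFunctionSpace

variable {Y : BanachFunctionSpace} {K θ τ : ℝ≥0}

/-- Weighted series of dilated rearrangements are dominated in the space. -/
theorem exists_dominating_rdil (Y : BanachFunctionSpace) (f : L0) (c : ℕ → ℝ≥0) (a : ℕ → ℝ)
    {M : ℝ≥0∞} (hM : ∑' k, (c k : ℝ≥0∞) * Y.N (rdil f (a k)) ≤ M) (hM' : M ≠ ∞) :
    ∃ G : L0, Y.N G ≤ M ∧ ∀ᵐ x ∂m,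
      ∑' k, (c k : ℝ≥0∞) * ENNReal.ofReal (rearr f (a k * (arg x / (2 * π)))) ≤ ‖G x‖ₑ := by
  set u : ℕ → L0 := fun k => ((c k : ℝ) : ℂ) • rdil f (a k) with hu
  have huN : ∀ k, Y.N (u k) = (c k : ℝ≥0∞) * Y.N (rdil f (a k)) := fun k => by
    simp only [hu]
    rw [Y.norm_smul]
    congr 1
    rw [← ofReal_norm, Complex.norm_real, Real.norm_of_nonneg (c k).coe_nonneg, ENNReal.ofReal_coe_nnreal]
  have hsum : ∑' k, Y.N (u k) ≤ M := by simpa only [huN] using hM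
  obtain ⟨G, hG1, hG2⟩ := Y.exists_dominating (hsum.trans_lt (lt_top_iff_ne_top.2 hM')).ne
  refine ⟨G, hG1.trans hsum, ?_⟩
  filter_upwards [hG2, ae_all_iff.2 fun k => rdil_ae f (a k),
    ae_all_iff.2 fun k => AEEqFun.coeFn_smul ((c k : ℝ) : ℂ) (rdil f (a k))] with x h1 h2 h3
  rw [ENNReal.tsum_eq_iSup_nat]
  refine iSup_le fun n => ?_
  rw [← ofReal_norm (G x)]
  refine le_trans (le_of_eq ?_) (ENNReal.ofReal_le_ofReal (h1 n))
  rw [ENNReal.ofReal_sum_of_nonneg fun _ _ => norm_nonneg _]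
  refine Finset.sum_congr rfl fun k _ => ?_
  simp only [hu]
  rw [h3 k]
  change _ = ENNReal.ofReal ‖((c k : ℝ) : ℂ) • rdil f (a k) x‖
  rw [h2 k, _root_.norm_smul, Complex.norm_real, Complex.norm_real, Real.norm_of_nonneg (c k).coe_nonneg,
    Real.norm_of_nonneg (rearr_nonneg _ _), ENNReal.ofReal_mul (c k).coe_nonneg,
    ENNReal.ofReal_coe_nnreal, mul_div_assoc]

/-- Cauchy integrals of nonnegative functions are uniformly bounded in `Y`. -/
theorem exists_N_cauchyInt_abs_le (hY : Y.IsRI) (hθ : θ < 1) (hτ : τ < 2)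
    (hD : Y.HasDilationBounds K θ τ) : ∃ M : ℝ≥0, ∀ f : L0, Y.N f < ∞ → Integrable f m →
      ∀ r ∈ Set.Ioo (0 : ℝ) 1, ∀ g : L0,
        (∀ᵐ x ∂m, g x = cauchyInt (fun t => ((‖f t‖ : ℝ) : ℂ)) (r * fourier 1 x)) →
        Y.N g ≤ M * Y.N f := by
  -- With θ^k < 1/2 and ρ = 2^{1/(2k)} one has (ρθ)^{2k} = 2 θ^{2k} ≤ 2 θ^k < 1. This is where the
  -- lower Boyd index decides which L^{2k} estimate is used.
  obtain ⟨k, hk1, ρ, hρ, hρθ⟩ : ∃ k : ℕ, 1 ≤ k ∧ ∃ ρ : ℝ≥0, ρ ^ (2 * k) = 2 ∧ ρ * θ < 1 := by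
    rcases eq_or_ne θ 0 with rfl | hθ0
    · refine ⟨1, le_rfl, NNReal.sqrt 2, by simp, by simp⟩
    · have hθ0' : 0 < θ := pos_iff_ne_zero.2 hθ0
      obtain ⟨k, hk⟩ := exists_pow_lt_of_lt_one (show (0 : ℝ≥0) < 2⁻¹ by positivity) hθ
      have hk1 : 1 ≤ k := by
        by_contra h
        have : k = 0 := by omega
        rw [this, pow_zero] at hk
        exact absurd hk (by rw [not_lt]; exact inv_le_one_of_one_le₀ one_le_two)
      refine ⟨k, hk1, 2 ^ (((2 * k : ℕ) : ℝ)⁻¹), ?_, ?_⟩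
      · rw [NNReal.rpow_inv_natCast_pow _ (by omega)]
      · by_contra hcon
        have h1 := one_le_pow₀ (not_lt.1 hcon) (n := 2 * k)
        rw [mul_pow, NNReal.rpow_inv_natCast_pow _ (by omega)] at h1
        have h2 : θ ^ (2 * k) ≤ θ ^ k := pow_le_pow_of_le_one bot_le hθ.le (by omega)
        have h3 : 2 * θ ^ (2 * k) < 1 := by
          calc 2 * θ ^ (2 * k) ≤ 2 * θ ^ k := by gcongr
            _ < 2 * 2⁻¹ := by gcongr
            _ = 1 := mul_inv_cancel₀ two_ne_zero
        exact absurd h1 (not_le.2 h3)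
  obtain ⟨A, hA⟩ := exists_rearr_cauchyInt_le hk1
  have hτ' : 2⁻¹ * τ < 1 := by
    calc 2⁻¹ * τ < 2⁻¹ * 2 := by gcongr
      _ = 1 := inv_mul_cancel₀ two_ne_zero
  have hgeo : ∀ a : ℝ≥0, a < 1 → ∑' k : ℕ, ((K * a ^ k : ℝ≥0) : ℝ≥0∞) ≠ ∞ := fun a ha => by
    refine ENNReal.tsum_coe_ne_top_iff_summable.2 ?_
    exact (NNReal.summable_geometric ha).mul_left K
  set M₁ := ∑' k : ℕ, ((K * (2⁻¹ * τ) ^ k : ℝ≥0) : ℝ≥0∞) with hM₁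
  set M₂ := ∑' k : ℕ, ((K * (ρ * θ) ^ k : ℝ≥0) : ℝ≥0∞) with hM₂
  refine ⟨A * (M₁.toNNReal + M₂.toNNReal), fun f hf hfi r hr g hg => ?_⟩
  have hb1 : ∑' k : ℕ, (((2⁻¹ : ℝ≥0) ^ k : ℝ≥0) : ℝ≥0∞) * Y.N (rdil f (2 ^ k)⁻¹) ≤
      M₁ * Y.N f := by
    rw [hM₁, ← ENNReal.tsum_mul_right]
    refine ENNReal.tsum_le_tsum fun k => ?_
    calc _ ≤ (((2⁻¹ : ℝ≥0) ^ k : ℝ≥0) : ℝ≥0∞) * (K * τ ^ k * Y.N f) := by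
          gcongr; exact (hD f hf k).2
      _ = _ := by push_cast; rw [mul_pow]; ring
  have hb2 : ∑' k : ℕ, ((ρ ^ k : ℝ≥0) : ℝ≥0∞) * Y.N (rdil f (2 ^ k)) ≤ M₂ * Y.N f := by
    rw [hM₂, ← ENNReal.tsum_mul_right]
    refine ENNReal.tsum_le_tsum fun k => ?_
    calc _ ≤ ((ρ ^ k : ℝ≥0) : ℝ≥0∞) * (K * θ ^ k * Y.N f) := by
          gcongr; exact (hD f hf k).1
      _ = _ := by push_cast; rw [mul_pow]; ring
  obtain ⟨G₁, hG₁, hG₁'⟩ := Y.exists_dominating_rdil f _ _ hb1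
    (ENNReal.mul_ne_top (hgeo _ hτ') hf.ne)
  obtain ⟨G₂, hG₂, hG₂'⟩ := Y.exists_dominating_rdil f _ _ hb2
    (ENNReal.mul_ne_top (hgeo _ hρθ) hf.ne)
  have hle : Y.N (rdil g 1) ≤ A * (M₁ + M₂) * Y.N f := by
    have h1 : Y.N (rdil g 1) ≤ Y.N (((A : ℝ) : ℂ) • (absL0 G₁ + absL0 G₂)) := by
      refine Y.ideal _ _ ?_
      filter_upwards [rdil_ae g 1, hG₁', hG₂', ae_arg_pos, absL0_ae G₁, absL0_ae G₂,
        AEEqFun.coeFn_smul ((A : ℝ) : ℂ) (absL0 G₁ + absL0 G₂),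
        AEEqFun.coeFn_add (absL0 G₁) (absL0 G₂)] with x h1 h2 h3 h4 h5 h6 h7 h8
      have h9 := hA ρ hρ f hfi r hr g hg (arg x / (2 * π)) (div_pos h4 Real.two_pi_pos)
      rw [calderonLow, calderonHigh] at h9
      simp only [ENNReal.coe_pow] at h2 h3
      have h10 := h9.trans (mul_le_mul_right (add_le_add h2 h3) (A : ℝ≥0∞))
      have h11 : ((A : ℝ) : ℂ) • ((‖G₁ x‖ : ℝ) + (‖G₂ x‖ : ℝ) : ℂ) =
          ((A * (‖G₁ x‖ + ‖G₂ x‖) : ℝ) : ℂ) := by push_cast; rw [smul_eq_mul]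
      rw [h1, h7]
      change _ ≤ ‖((A : ℝ) : ℂ) • (absL0 G₁ + absL0 G₂) x‖
      rw [h8, Pi.add_apply, h5, h6, h11, Complex.norm_real, Complex.norm_real,
        Real.norm_of_nonneg (rearr_nonneg _ _), Real.norm_of_nonneg (by positivity), one_mul]
      rw [← ENNReal.ofReal_le_ofReal_iff (by positivity), ENNReal.ofReal_mul A.coe_nonneg,
        ENNReal.ofReal_coe_nnreal, ENNReal.ofReal_add (norm_nonneg _) (norm_nonneg _),
        ofReal_norm, ofReal_norm]
      exact h10
    refine h1.trans ?_
    rw [Y.norm_smul]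
    have hAn : ‖((A : ℝ) : ℂ)‖ₑ = A := by
      rw [← ofReal_norm, Complex.norm_real, Real.norm_of_nonneg A.coe_nonneg, ENNReal.ofReal_coe_nnreal]
    rw [hAn, mul_assoc]
    gcongr
    refine (Y.norm_add_le _ _).trans ?_
    rw [Y.N_absL0, Y.N_absL0, add_mul]
    exact add_le_add hG₁ hG₂
  -- Rearrangement invariance speaks only of members of the space, so finiteness is established on
  -- the rearrangement before passing to g.
  have hfin : Y.N (rdil g 1) < ∞ := by
    refine hle.trans_lt (lt_top_iff_ne_top.2 ?_)
    exact ENNReal.mul_ne_top (ENNReal.mul_ne_top ENNReal.coe_ne_top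
      (ENNReal.add_ne_top.2 ⟨hgeo _ hτ', hgeo _ hρθ⟩)) hf.ne
  rw [N_eq_of_N_rdil_lt_top hY hfin]
  refine hle.trans_eq ?_
  push_cast
  rw [ENNReal.coe_toNNReal (hgeo _ hτ'), ENNReal.coe_toNNReal (hgeo _ hρθ)]

end BanachFunctionSpace

/-! ### Uniform integrability and the Riesz projection on `Y` -/

theorem arg_lt_two_pi (x : Torus) : arg x < 2 * π := by
  have h : arg x < 0 + 2 * π := (AddCircle.equivIco (2 * π) 0 x).2.2
  rwa [zero_add] at h

theorem const_ae (c : ℂ) : ∀ᵐ x ∂m, (AEEqFun.const Torus c : L0) x = c :=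
  AEEqFun.coeFn_const (μ := m) Torus c

theorem smul_ae (c : ℂ) (f : L0) : ∀ᵐ x ∂m, (c • f) x = c * f x :=
  AEEqFun.coeFn_smul c f

theorem mul_ae (f g : L0) : ∀ᵐ x ∂m, (f * g) x = f x * g x :=
  AEEqFun.coeFn_mul f g

theorem add_ae (f g : L0) : ∀ᵐ x ∂m, (f + g) x = f x + g x :=
  AEEqFun.coeFn_add f g

namespace BanachFunctionSpace

variable {X Y : BanachFunctionSpace} {K θ τ : ℝ≥0}

/-- The number f*(2^{-k}) is a lower bound of x ↦ f*(2^{-k} x) on (0, 1), so the corresponding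
constant function is dominated by the dilated rearrangement. -/
theorem rearr_mul_N_one_le (hD : Y.HasDilationBounds K θ τ) {f : L0} (hf : Y.N f < ∞) (k : ℕ) :
    ENNReal.ofReal (rearr f (2 ^ k)⁻¹) * Y.N (AEEqFun.const Torus (1 : ℂ)) ≤
      K * τ ^ k * Y.N f := by
  refine le_trans ?_ (hD f hf k).2
  have e : ‖((rearr f (2 ^ k)⁻¹ : ℝ) : ℂ)‖ₑ = ENNReal.ofReal (rearr f (2 ^ k)⁻¹) := by
    rw [← ofReal_norm, Complex.norm_real, Real.norm_of_nonneg (rearr_nonneg _ _)]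
  rw [← e, ← Y.norm_smul]
  refine Y.ideal _ _ ?_
  filter_upwards [rdil_ae f (2 ^ k)⁻¹, smul_ae ((rearr f (2 ^ k)⁻¹ : ℝ) : ℂ)
    (AEEqFun.const Torus (1 : ℂ)), const_ae 1, ae_arg_pos] with x h1 h2 h3 h4
  rw [h1, h2, h3, mul_one, Complex.norm_real, Complex.norm_real,
    Real.norm_of_nonneg (rearr_nonneg _ _), Real.norm_of_nonneg (rearr_nonneg _ _)]
  refine rearr_anti f (by positivity) ?_
  rw [div_le_iff₀ Real.two_pi_pos]
  exact mul_le_mul_of_nonneg_left (arg_lt_two_pi x).le (by positivity)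

/-- Since f*(2^{-k}) grows at most like τ^k and the dyadic layers have measure 2^{-k}, the tails
decay like (τ/2)^k. This gives both the inclusion of Y in L¹ and uniform integrability of its
bounded sets. -/
theorem exists_setLIntegral_le (hτ : τ < 2) (hD : Y.HasDilationBounds K θ τ) :
    ∃ C κ : ℝ≥0, κ < 1 ∧ ∀ f : L0, Y.N f < ∞ → ∀ (j : ℕ) (E : Set Torus), MeasurableSet E →
      m E ≤ ((2⁻¹ : ℝ≥0) : ℝ≥0∞) ^ j → ∫⁻ x in E, ‖f x‖ₑ ∂m ≤ C * κ ^ j * Y.N f := by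
  have hτ' : 2⁻¹ * τ < 1 := by
    calc 2⁻¹ * τ < 2⁻¹ * 2 := by gcongr
      _ = 1 := inv_mul_cancel₀ two_ne_zero
  set N₁ := Y.N (AEEqFun.const Torus (1 : ℂ)) with hN₁
  have hN₁0 : N₁ ≠ 0 := Y.N_one_ne_zero
  have hN₁t : N₁ ≠ ∞ := Y.N_one_ne_top
  set M := ∑' k : ℕ, ((K * (2⁻¹ * τ) ^ k : ℝ≥0) : ℝ≥0∞) with hM
  have hMt : M ≠ ∞ := ENNReal.tsum_coe_ne_top_iff_summable.2
    ((NNReal.summable_geometric hτ').mul_left K)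
  have hCt : (2 * M + K) / N₁ ≠ ∞ := ENNReal.div_ne_top
    (ENNReal.add_ne_top.2 ⟨ENNReal.mul_ne_top ENNReal.ofNat_ne_top hMt, ENNReal.coe_ne_top⟩) hN₁0
  refine ⟨((2 * M + K) / N₁).toNNReal, 2⁻¹ * τ, hτ', fun f hf j E hE hmE => ?_⟩
  rw [ENNReal.coe_toNNReal hCt]
  have hr : ∀ k : ℕ, ENNReal.ofReal (rearr f (2 ^ k)⁻¹) ≤ K * τ ^ k * Y.N f / N₁ := fun k => by
    rw [ENNReal.le_div_iff_mul_le (Or.inl hN₁0) (Or.inl hN₁t)]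
    exact rearr_mul_N_one_le hD hf k
  set s : ℝ := (2 ^ j)⁻¹ with hs
  have hs0 : 0 < s := by positivity
  have hsE : ENNReal.ofReal s = ((2⁻¹ : ℝ≥0) : ℝ≥0∞) ^ j := by
    have := ofReal_two_pow_inv_mul j 1
    rwa [mul_one, ENNReal.ofReal_one, mul_one] at this
  have hlow : calderonLow f s ≤ M * (τ ^ j * Y.N f / N₁) := by
    rw [calderonLow, hM, ← ENNReal.tsum_mul_right]
    refine ENNReal.tsum_le_tsum fun k => ?_
    have e : ((2 : ℝ) ^ k)⁻¹ * s = (2 ^ (k + j))⁻¹ := by rw [hs, pow_add, mul_inv]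
    rw [e]
    calc _ ≤ ((2⁻¹ : ℝ≥0) : ℝ≥0∞) ^ k * (K * τ ^ (k + j) * Y.N f / N₁) := by
          gcongr; exact hr _
      _ = _ := by
        push_cast
        simp only [div_eq_mul_inv]
        rw [mul_pow, pow_add]; ring
  have hlarge : MeasurableSet {x | rearr f s < ‖f x‖} := measurableSet_lt_norm f _
  have hsplit : ∫⁻ x in E, ‖f x‖ₑ ∂m ≤
      (∫⁻ x in {x | rearr f s < ‖f x‖}, ‖f x‖ₑ ∂m) + ENNReal.ofReal (rearr f s) * m E := by
    rw [← lintegral_inter_add_sdiff (fun x => ‖f x‖ₑ) E hlarge]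
    gcongr
    · exact Set.inter_subset_right
    · calc ∫⁻ x in E \ {x | rearr f s < ‖f x‖}, ‖f x‖ₑ ∂m
          ≤ ∫⁻ _ in E \ {x | rearr f s < ‖f x‖}, ENNReal.ofReal (rearr f s) ∂m := by
            refine setLIntegral_mono' (hE.diff hlarge) fun x hx => ?_
            rw [← ofReal_norm]
            exact ENNReal.ofReal_le_ofReal (not_lt.1 hx.2)
        _ = ENNReal.ofReal (rearr f s) * m (E \ {x | rearr f s < ‖f x‖}) :=
            setLIntegral_const _ _
        _ ≤ _ := by gcongr; exact Set.sdiff_subset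
  refine hsplit.trans ?_
  calc _ ≤ 2 * ((2⁻¹ : ℝ≥0) : ℝ≥0∞) ^ j * (M * (τ ^ j * Y.N f / N₁)) +
        K * τ ^ j * Y.N f / N₁ * ((2⁻¹ : ℝ≥0) : ℝ≥0∞) ^ j := by
        refine add_le_add ((lintegral_large_le_calderonLow f hs0).trans ?_)
          (mul_le_mul' (hr j) hmE)
        rw [ENNReal.ofReal_mul zero_le_two, hsE, ENNReal.ofReal_ofNat]
        gcongr
    _ = _ := by
        push_cast
        simp only [div_eq_mul_inv]
        rw [mul_pow]; ring

theorem integrable_of_N_lt_top (hτ : τ < 2) (hD : Y.HasDilationBounds K θ τ) {f : L0}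
    (hf : Y.N f < ∞) : Integrable f m := by
  obtain ⟨C, κ, -, h⟩ := exists_setLIntegral_le hτ hD
  refine ⟨f.aestronglyMeasurable, ?_⟩
  have := h f hf 0 Set.univ MeasurableSet.univ (by simp)
  rw [Measure.restrict_univ] at this
  refine this.trans_lt ?_
  rw [pow_zero, mul_one]
  exact ENNReal.mul_lt_top ENNReal.coe_lt_top hf

/-- Norm-bounded families in `Y` are uniformly integrable. -/
theorem unifIntegrable_of_N_le (hτ : τ < 2) (hD : Y.HasDilationBounds K θ τ) {u : ℕ → L0}
    {M : ℝ≥0∞} (hM : M ≠ ∞) (hu : ∀ n, Y.N (u n) ≤ M) :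
    UnifIntegrable (fun n => (u n : Torus → ℂ)) 1 m := by
  obtain ⟨C, κ, hκ, h⟩ := exists_setLIntegral_le hτ hD
  intro ε hε
  have hlim : Tendsto (fun j : ℕ => (C : ℝ≥0∞) * κ ^ j * M) atTop (𝓝 0) := by
    have h1 : Tendsto (fun j : ℕ => (κ : ℝ≥0∞) ^ j) atTop (𝓝 0) :=
      ENNReal.tendsto_pow_atTop_nhds_zero_of_lt_one (by exact_mod_cast hκ)
    have h2 := ENNReal.Tendsto.mul_const (b := M)
      (ENNReal.Tendsto.const_mul (a := (C : ℝ≥0∞)) h1 (Or.inr ENNReal.coe_ne_top)) (Or.inr hM)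
    simpa using h2
  obtain ⟨j, hj⟩ := (hlim.eventually (gt_mem_nhds (ENNReal.ofReal_pos.2 hε))).exists
  refine ⟨(2 ^ j)⁻¹, by positivity, fun n E hE hmE => ?_⟩
  rw [eLpNorm_one_eq_lintegral_enorm]
  simp only [enorm_indicator_eq_indicator_enorm]
  rw [lintegral_indicator hE]
  have hsE : ENNReal.ofReal (2 ^ j)⁻¹ = ((2⁻¹ : ℝ≥0) : ℝ≥0∞) ^ j := by
    have := ofReal_two_pow_inv_mul j 1
    rwa [mul_one, ENNReal.ofReal_one, mul_one] at this
  rw [hsE] at hmE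
  refine (h (u n) ((hu n).trans_lt (lt_top_iff_ne_top.2 hM)) j E hE hmE).trans (le_trans ?_ hj.le)
  gcongr
  exact hu n

/-- The Fatou property for sequences converging a.e. -/
theorem N_le_of_tendsto_ae (hF : Y.HasFatou) {u : ℕ → L0} {f : L0} {C : ℝ≥0∞}
    (hu : ∀ n, Y.N (u n) ≤ C)
    (hlim : ∀ᵐ x ∂m, Tendsto (fun n => u n x) atTop (𝓝 (f x))) : Y.N f ≤ C := by
  rcases eq_or_ne C ∞ with rfl | hC
  · exact le_top
  have hbdd : ∀ n x, BddBelow (Set.range fun k => ‖u (n + k) x‖) := fun n x =>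
    ⟨0, by rintro _ ⟨k, rfl⟩; exact norm_nonneg _⟩
  -- The running infimum of |u_k| over k ≥ n is below |u_n| and increases to |f|, which brings the
  -- sequence into the form required by the Fatou property.
  set v : ℕ → Torus → ℝ := fun n x => ⨅ k, ‖u (n + k) x‖ with hv
  have hvm : ∀ n, Measurable (v n) := fun n =>
    Measurable.iInf fun k => (u (n + k)).stronglyMeasurable.measurable.norm
  have hv0 : ∀ n x, 0 ≤ v n x := fun n x => le_ciInf fun k => norm_nonneg _
  have hvu : ∀ n x, v n x ≤ ‖u n x‖ := fun n x => ciInf_le (hbdd n x) 0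
  let V : ℕ → L0 := fun n => AEEqFun.mk (fun x => ((v n x : ℝ) : ℂ))
    (Complex.measurable_ofReal.comp (hvm n)).aestronglyMeasurable
  have hVae : ∀ᵐ x ∂m, ∀ n, V n x = ((v n x : ℝ) : ℂ) :=
    ae_all_iff.2 fun n => AEEqFun.coeFn_mk _ _
  have hVN : ∀ n, Y.N (V n) ≤ C := fun n => by
    refine (Y.ideal _ _ ?_).trans (hu n)
    filter_upwards [hVae] with x hx
    rw [hx n, Complex.norm_real, Real.norm_of_nonneg (hv0 n x)]
    exact hvu n x
  have hinc : IncreasesTo V (absL0 f) := by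
    filter_upwards [hVae, absL0_ae f, hlim] with x h1 h2 h3
    simp only [h1, h2]
    refine ⟨fun n => by exact_mod_cast hv0 n x, fun i j hij => ?_, ?_⟩
    · have : v i x ≤ v j x := by
        refine le_ciInf fun k => ?_
        refine (ciInf_le (hbdd i x) (j - i + k)).trans_eq ?_
        congr 2; congr 1; omega
      simp only
      exact_mod_cast this
    · refine (Complex.continuous_ofReal.tendsto _).comp ?_
      refine tendsto_order.2 ⟨fun c hc => ?_, fun c hc => ?_⟩
      · obtain ⟨c', hc', hc''⟩ := exists_between hc
        obtain ⟨n₀, hn₀⟩ := eventually_atTop.1 (h3.norm.eventually (lt_mem_nhds hc''))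
        filter_upwards [eventually_ge_atTop n₀] with n hn
        exact hc'.trans_le (le_ciInf fun k => (hn₀ (n + k) (by omega)).le)
      · filter_upwards [h3.norm.eventually (gt_mem_nhds hc)] with n hn
        exact (hvu n x).trans_lt hn
  have hfin : ⨆ n, Y.N (V n) < ∞ := (iSup_le hVN).trans_lt (lt_top_iff_ne_top.2 hC)
  have := (hF V (absL0 f) (fun n => (hVN n).trans_lt (lt_top_iff_ne_top.2 hC)) hinc hfin).2
  rw [Y.N_absL0] at this
  rw [this]
  exact iSup_le hVN

/-- Cauchy integrals are uniformly bounded in `Y`. -/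
theorem exists_N_cauchyInt_le (hY : Y.IsRI) (hθ : θ < 1) (hτ : τ < 2)
    (hD : Y.HasDilationBounds K θ τ) : ∃ M : ℝ≥0, ∀ h : L0, Y.N h < ∞ →
      ∀ r ∈ Set.Ioo (0 : ℝ) 1, ∀ g : L0,
        (∀ᵐ x ∂m, g x = cauchyInt h (r * fourier 1 x)) → Y.N g ≤ M * Y.N h := by
  obtain ⟨M, hM⟩ := exists_N_cauchyInt_abs_le hY hθ hτ hD
  refine ⟨4 * M, fun h hh r hr g hg => ?_⟩
  have hhi := integrable_of_N_lt_top hτ hD hh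
  let f : Fin 4 → L0 := fun k => AEEqFun.mk (fun t => ((part k (h t) : ℝ) : ℂ))
    (Complex.continuous_ofReal.comp_aestronglyMeasurable
      ((continuous_part k).comp_aestronglyMeasurable h.aestronglyMeasurable))
  have hfae : ∀ k, ∀ᵐ t ∂m, f k t = ((part k (h t) : ℝ) : ℂ) := fun k => AEEqFun.coeFn_mk _ _
  have hfN : ∀ k, Y.N (f k) ≤ Y.N h := fun k => by
    refine Y.ideal _ _ ?_
    filter_upwards [hfae k] with t ht
    rw [ht, Complex.norm_real, Real.norm_of_nonneg (part_nonneg _ _)]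
    exact part_le_norm _ _
  have hfabs : ∀ k, (fun t => ((‖f k t‖ : ℝ) : ℂ)) =ᵐ[m] fun t => ((part k (h t) : ℝ) : ℂ) :=
    fun k => by
      filter_upwards [hfae k] with t ht
      rw [ht, Complex.norm_real, Real.norm_of_nonneg (part_nonneg _ _)]
  have hcont : ∀ k : Fin 4, Continuous fun x : Torus =>
      cauchyInt (fun t => ((part k (h t) : ℝ) : ℂ)) (r * fourier 1 x) := fun k =>
    continuous_cauchyInt_circle (integrable_ofReal (integrable_part hhi k)) hr
  let G : Fin 4 → L0 := fun k => AEEqFun.mk _ (hcont k).aestronglyMeasurable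
  have hGae : ∀ k, ∀ᵐ x ∂m, G k x =
      cauchyInt (fun t => ((part k (h t) : ℝ) : ℂ)) (r * fourier 1 x) :=
    fun k => AEEqFun.coeFn_mk _ _
  have hGN : ∀ k, Y.N (G k) ≤ M * Y.N h := fun k => by
    have hfk : Y.N (f k) < ∞ := (hfN k).trans_lt hh
    refine (hM (f k) hfk (integrable_of_N_lt_top hτ hD hfk) r hr (G k) ?_).trans
      (by gcongr; exact hfN k)
    filter_upwards [hGae k] with x hx
    rw [hx]
    exact cauchyInt_congr (hfabs k).symm _
  have hgsum : Y.N g = Y.N (∑ k : Fin 4, (Complex.I ^ (k : ℕ)) • G k) := by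
    refine Y.N_congr ?_
    filter_upwards [hg, coeFn_sum_ae Finset.univ fun k : Fin 4 => (Complex.I ^ (k : ℕ)) • G k,
      ae_all_iff.2 hGae, ae_all_iff.2 fun k : Fin 4 => smul_ae (Complex.I ^ (k : ℕ)) (G k)]
      with x h1 h2 h3 h4
    rw [h1, h2, cauchyInt_eq_sum_part hhi (norm_mul_fourier_lt_one hr x)]
    congr 1
    refine Finset.sum_congr rfl fun k _ => ?_
    rw [h4, h3]
  rw [hgsum]
  refine (Y.N_sum_le _ _).trans ?_
  have : ∀ k : Fin 4, Y.N ((Complex.I ^ (k : ℕ)) • G k) ≤ M * Y.N h := fun k => by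
    rw [Y.norm_smul]
    have e : ‖Complex.I ^ (k : ℕ)‖ₑ = 1 := by
      rw [← ofReal_norm, norm_pow, Complex.norm_I, one_pow, ENNReal.ofReal_one]
    rw [e, one_mul]
    exact hGN k
  refine (Finset.sum_le_card_nsmul _ _ _ fun k _ => this k).trans_eq ?_
  simp only [Finset.card_univ, Fintype.card_fin, nsmul_eq_mul]
  push_cast
  ring

/-- The class of the Cauchy integral of `h` on the circle of radius `r`. -/
theorem exists_cauchyInt_class (hτ : τ < 2) (hD : Y.HasDilationBounds K θ τ) {h : L0}
    (hh : Y.N h < ∞) {r : ℝ} (hr : r ∈ Set.Ioo (0 : ℝ) 1) :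
    ∃ g : L0, ∀ᵐ x ∂m, g x = cauchyInt h (r * fourier 1 x) :=
  ⟨AEEqFun.mk _ (continuous_cauchyInt_circle (integrable_of_N_lt_top hτ hD hh)
    hr).aestronglyMeasurable, AEEqFun.coeFn_mk _ _⟩

/-- The Riesz projection maps `Y` boundedly into `H[Y]`. -/
theorem exists_N_le_of_isCauchyLimit (hY : Y.IsRI) (hF : Y.HasFatou) (hθ : θ < 1) (hτ : τ < 2)
    (hD : Y.HasDilationBounds K θ τ) : ∃ M : ℝ≥0, ∀ h g : L0, Y.N h < ∞ → IsCauchyLimit h g →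
      Y.N g ≤ M * Y.N h ∧ ∀ n : ℤ, n < 0 → fourierCoeff g n = 0 := by
  obtain ⟨M, hM⟩ := exists_N_cauchyInt_le hY hθ hτ hD
  refine ⟨M, fun h g hh hg => ?_⟩
  obtain ⟨r, hr, hrlim⟩ := exists_seq_tendsto_one
  choose u hu using fun n => exists_cauchyInt_class hτ hD hh (hr n)
  have hhi := integrable_of_N_lt_top hτ hD hh
  have huN : ∀ n, Y.N (u n) ≤ M * Y.N h := fun n => hM h hh (r n) (hr n) (u n) (hu n)
  have hulim : ∀ᵐ x ∂m, Tendsto (fun n => u n x) atTop (𝓝 (g x)) := by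
    filter_upwards [hg, ae_all_iff.2 hu] with x h1 h2
    simp only [h2]
    exact h1.comp hrlim
  have hgN := N_le_of_tendsto_ae hF huN hulim
  have hMt : (M : ℝ≥0∞) * Y.N h ≠ ∞ := ENNReal.mul_ne_top ENNReal.coe_ne_top hh.ne
  refine ⟨hgN, fun n hn => ?_⟩
  have hgi : Integrable g m := integrable_of_N_lt_top hτ hD
    (hgN.trans_lt (lt_top_iff_ne_top.2 hMt))
  -- Vitali's theorem: boundedness in Y gives uniform integrability, which upgrades a.e. convergence
  -- to L¹ convergence, and Fourier coefficients pass to the limit.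
  have hconv := tendsto_Lp_finite_of_tendsto_ae (le_refl (1 : ℝ≥0∞)) ENNReal.one_ne_top
    (fun n => (u n).aestronglyMeasurable) (memLp_one_iff_integrable.2 hgi)
    (unifIntegrable_of_N_le hτ hD hMt huN) hulim
  have hcoef : ∀ k, ∫ x, fourier (-n) x * u k x ∂m = 0 := fun k => by
    obtain ⟨j, hj⟩ : ∃ j : ℕ, -n = (j : ℤ) := ⟨(-n).toNat, by omega⟩
    have h1 := integral_fourier_mul_comp (differentiableOn_cauchyInt hhi) (hr k) (n := j)
      (by omega)
    rw [← h1, hj]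
    refine integral_congr_ae ?_
    filter_upwards [hu k] with x hx
    rw [hx]
  have hui : ∀ k, Integrable (u k) m := fun k => integrable_of_N_lt_top hτ hD
    ((huN k).trans_lt (lt_top_iff_ne_top.2 hMt))
  have hle : ∀ k, ‖fourierCoeff g n‖ₑ ≤ eLpNorm (⇑(u k) - ⇑g) 1 m := fun k => by
    have e : fourierCoeff g n = ∫ x, fourier (-n) x * (g x - u k x) ∂m := by
      simp only [mul_sub]
      rw [integral_sub (integrable_fourier_mul _ hgi) (integrable_fourier_mul _ (hui k)),
        hcoef k, sub_zero]
      rfl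
    rw [e, eLpNorm_one_eq_lintegral_enorm]
    refine (enorm_integral_le_lintegral_enorm _).trans_eq ?_
    congr 1; ext x
    rw [enorm_mul, ← ofReal_norm (fourier (-n) x : ℂ), norm_fourier_apply, ENNReal.ofReal_one,
      one_mul, Pi.sub_apply, enorm_sub_rev]
  have h0 : ‖fourierCoeff g n‖ₑ ≤ 0 := ge_of_tendsto' hconv hle
  simpa using h0

end BanachFunctionSpace

/-! ### Outer functions -/

/-- An outer function with prescribed modulus bounded above and bounded away from zero. -/
theorem exists_outer {ψ : Torus → ℝ} (hψ : Measurable ψ) {ε M : ℝ} (hε : 0 < ε)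
    (hle : ∀ t, ε ≤ ψ t) (hM : ∀ t, ψ t ≤ M) :
    ∃ f : L0, (∀ᵐ t ∂m, ‖f t‖ = ψ t) ∧ ∀ n : ℤ, n < 0 → fourierCoeff f n = 0 := by
  set u : Torus → ℝ := fun t => Real.log (ψ t) with hu
  have hpos : ∀ t, 0 < ψ t := fun t => hε.trans_le (hle t)
  have huM : ∀ t, u t ≤ Real.log M := fun t => Real.log_le_log (hpos t) (hM t)
  have hui : Integrable u m := by
    refine Integrable.of_bound (Real.measurable_log.comp hψ).aestronglyMeasurable
      (max |Real.log ε| |Real.log M|) (Eventually.of_forall fun t => ?_)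
    exact abs_le_max_abs_abs (Real.log_le_log hε (hle t)) (huM t)
  have huc : Integrable (fun t => (u t : ℂ)) m := integrable_ofReal hui
  obtain ⟨g, hg⟩ := exists_isCauchyLimit huc
  set c : ℂ := fourierCoeff (fun t => (u t : ℂ)) 0 with hc
  -- The outer function is the boundary value of exp(F), with F the Herglotz integral of log ψ; its
  -- modulus is the exponential of the radial limit of a Poisson integral, namely ψ.
  have hfm : AEStronglyMeasurable (fun t => Complex.exp (2 * g t - c)) m :=
    Complex.continuous_exp.comp_aestronglyMeasurable
      ((g.aestronglyMeasurable.const_mul 2).sub aestronglyMeasurable_const)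
  have hlim : ∀ᵐ x ∂m, Tendsto (fun r : ℝ => herglotz u (r * fourier 1 x)) (𝓝[<] 1)
      (𝓝 (2 * g x - c)) := by
    filter_upwards [hg] with x hx
    exact (hx.const_mul 2).sub_const c
  have hre : ∀ᵐ x ∂m, (2 * g x - c).re = u x := by
    filter_upwards [hlim, ae_tendsto_poissonInt huc] with x h1 h2
    refine tendsto_nhds_unique ((Complex.continuous_re.tendsto _).comp h1) ?_
    have h3 := (Complex.continuous_re.tendsto _).comp h2
    rw [Complex.ofReal_re] at h3
    refine h3.congr' ?_
    filter_upwards [eventually_mem_Ioo] with r hr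
    simp only [Function.comp_apply]
    rw [re_herglotz_eq hui ⟨hr.1.le, hr.2⟩, poissonInt]
    simp only [← Complex.ofReal_mul]
    rw [integral_complex_ofReal, Complex.ofReal_re]
  have hbound : ∀ r ∈ Set.Ioo (0 : ℝ) 1, ∀ x : Torus,
      ‖Complex.exp (herglotz u (r * fourier 1 x))‖ ≤ M := by
    intro r hr x
    have hr' : r ∈ Set.Ico (0 : ℝ) 1 := ⟨hr.1.le, hr.2⟩
    have hki : Integrable (fun t => poissonKernel r (x - t)) m :=
      integrable_of_continuous_torus
        ((continuous_poissonKernel hr').comp (continuous_const.sub continuous_id))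
    have hM0 : 0 < M := (hpos 0).trans_le (hM 0)
    rw [Complex.norm_exp, re_herglotz_eq hui hr', ← Real.le_log_iff_exp_le hM0]
    by_cases hi : Integrable (fun t => poissonKernel r (x - t) * u t) m
    · calc ∫ t, poissonKernel r (x - t) * u t ∂m
          ≤ ∫ t, poissonKernel r (x - t) * Real.log M ∂m :=
            integral_mono hi (hki.mul_const _) fun t =>
              mul_le_mul_of_nonneg_left (huM t) (poissonKernel_nonneg hr' _)
        _ = Real.log M := by
            rw [integral_mul_const, integral_poissonKernel_sub hr', one_mul]
    · refine absurd ?_ hi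
      obtain ⟨C, hC⟩ := isCompact_univ.exists_bound_of_continuousOn
        (continuous_poissonKernel hr').continuousOn
      exact hui.bdd_mul (c := C) ((continuous_poissonKernel hr').comp
        (continuous_const.sub continuous_id)).aestronglyMeasurable
        (Eventually.of_forall fun t => hC _ (Set.mem_univ _))
  refine ⟨AEEqFun.mk _ hfm, ?_, fun n hn => ?_⟩
  · filter_upwards [AEEqFun.coeFn_mk _ hfm, hre] with t h1 h2
    rw [h1, Complex.norm_exp, h2, hu, Real.exp_log (hpos t)]
  obtain ⟨k, rfl⟩ : ∃ k : ℕ, n = -(k : ℤ) := ⟨n.natAbs, by omega⟩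
  have hk : k ≠ 0 := by rintro rfl; simp at hn
  have e : fourierCoeff (AEEqFun.mk _ hfm : L0) (-(k : ℤ)) =
      ∫ x, fourier k x * Complex.exp (2 * g x - c) ∂m := by
    rw [fourierCoeff]
    refine integral_congr_ae ?_
    filter_upwards [AEEqFun.coeFn_mk _ hfm] with t h1
    rw [h1, neg_neg, smul_eq_mul]
  rw [e]
  obtain ⟨r, hr, hrlim⟩ := exists_seq_tendsto_one
  have hdiff : DifferentiableOn ℂ (fun z => Complex.exp (herglotz u z)) (Metric.ball 0 1) :=
    (differentiableOn_herglotz hui).cexp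
  have hzero : ∀ j, ∫ x, fourier k x * Complex.exp (herglotz u (r j * fourier 1 x)) ∂m = 0 :=
    fun j => integral_fourier_mul_comp hdiff (hr j) hk
  have hconv : Tendsto
      (fun j => ∫ x, fourier k x * Complex.exp (herglotz u (r j * fourier 1 x)) ∂m) atTop
      (𝓝 (∫ x, fourier k x * Complex.exp (2 * g x - c) ∂m)) := by
    -- The upper bound on ψ passes to |exp F| throughout the disc, since the Poisson integral of log
    -- ψ stays below log M.
    refine tendsto_integral_of_dominated_convergence (fun _ => M) (fun j => ?_)
      (integrable_const _) (fun j => Eventually.of_forall fun x => ?_) ?_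
    · exact ((fourier k).continuous.mul (continuous_comp_mul_fourier hdiff.continuousOn
        ⟨(hr j).1.le, (hr j).2⟩)).aestronglyMeasurable
    · rw [norm_mul, norm_fourier_apply, one_mul]
      exact hbound _ (hr j) x
    · filter_upwards [hlim] with x hx
      exact ((Complex.continuous_exp.tendsto _).comp (hx.comp hrlim)).const_mul _
  simp only [hzero] at hconv
  exact (tendsto_nhds_unique hconv tendsto_const_nhds)

/-! ### Toeplitz operators and multipliers -/

/-- The character `e^{int}` as an element of `L⁰`. -/
def character (n : ℤ) : L0 := AEEqFun.mk (fourier n) (fourier n).continuous.aestronglyMeasurable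

theorem character_mul_ae (n : ℤ) (f : L0) :
    ∀ᵐ x ∂m, (character n * f) x = fourier n x * f x := by
  filter_upwards [mul_ae (character n) f,
    AEEqFun.coeFn_mk _ (fourier n).continuous.aestronglyMeasurable] with x h1 h2
  rw [h1, character, h2]

theorem fourierCoeff_character_mul (n k : ℤ) (f : L0) :
    fourierCoeff (character n * f) k = fourierCoeff f (k - n) := by
  rw [fourierCoeff, fourierCoeff]
  refine integral_congr_ae ?_
  filter_upwards [character_mul_ae n f] with x hx
  rw [hx, smul_eq_mul, smul_eq_mul, ← mul_assoc, ← fourier_add]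
  congr 3
  ring

variable {X Y : BanachFunctionSpace}

theorem N_character_mul (n : ℤ) (f : L0) : X.N (character n * f) = X.N f :=
  X.N_congr ((character_mul_ae n f).mono fun x hx => by
    rw [hx, norm_mul, norm_fourier_apply, one_mul])

theorem character_mul_mem_hardy (n : ℕ) {f : L0} (hf : f ∈ X.hardy) :
    character n * f ∈ X.hardy := by
  refine ⟨?_, fun k hk => ?_⟩
  · change X.N _ < ∞
    rw [N_character_mul]
    exact hf.1
  · rw [fourierCoeff_character_mul]
    exact hf.2 _ (by omega)

/-! ### From a bounded Toeplitz operator to a multiplier -/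

theorem N_mul_mono {a f g : L0} (h : ∀ᵐ t ∂m, ‖f t‖ ≤ ‖g t‖) : Y.N (a * f) ≤ Y.N (a * g) := by
  refine Y.ideal _ _ ?_
  filter_upwards [h, mul_ae a f, mul_ae a g] with t h1 h2 h3
  rw [h2, h3, norm_mul, norm_mul]
  exact mul_le_mul_of_nonneg_left h1 (norm_nonneg _)

theorem N_mul_zero (a : L0) : Y.N (a * 0) = 0 := by
  rw [← Y.N_zero]
  refine Y.N_congr ?_
  filter_upwards [mul_ae a 0, AEEqFun.coeFn_zero (μ := m) (β := ℂ) (α := Torus)] with t h1 h2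
  rw [h1, h2, Pi.zero_apply, mul_zero]

/-- Characters do not change norms and nonnegative powers preserve H[X], so all e^{-inx} P(e^{inx} a
f) obey one bound. A subsequence converges a.e. to a f, and the Fatou property transfers the bound.
-/
theorem ToeplitzBoundedBy.N_mul_le_of_mem_hardy (hF : Y.HasFatou) {a : L0} {C : ℝ≥0∞}
    (hC : ToeplitzBoundedBy X Y a C) {f : L0} (hf : f ∈ X.hardy) :
    Y.N (a * f) ≤ C * X.N f := by
  choose g hg hgP hgN using fun n : ℕ => hC _ (character_mul_mem_hardy n hf)
  have hafi : Integrable (a * f : L0) m := by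
    obtain ⟨g, -, hP, -⟩ := hC f hf
    exact hP.1
  have hlim : ∀ n : ℕ, IsCauchyLimit (fun t => fourier n t * (a * f : L0) t) (g n) := by
    intro n
    have h := (isRieszProjection_iff.1 (hgP n)).2
    have e : ((a * (character n * f) : L0) : Torus → ℂ) =ᵐ[m]
        fun t => fourier n t * (a * f : L0) t := by
      filter_upwards [mul_ae a (character n * f), character_mul_ae n f, mul_ae a f]
        with t h1 h2 h3
      rw [h1, h2, h3]
      ring
    filter_upwards [h] with x hx
    simpa only [cauchyInt_congr e] using hx
  obtain ⟨ns, -, hns⟩ := (tendstoInMeasure_shift hafi hlim).exists_seq_tendsto_ae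
  refine Y.N_le_of_tendsto_ae hF (u := fun k => character (-(ns k : ℤ)) * g (ns k))
    (fun k => ?_) ?_
  · rw [N_character_mul]
    exact (hgN _).trans_eq (by rw [N_character_mul])
  · filter_upwards [hns, ae_all_iff.2 fun k => character_mul_ae (-(ns k : ℤ)) (g (ns k))]
      with x h1 h2
    simpa only [h2] using h1

/-- Only the modulus of g matters. An outer function of modulus min(|g|, n) + ε lies in H[X], and
its norm is at most ‖g‖ + ε‖1‖; then ε tends to 0 and n to infinity without loss in the constant. -/
theorem ToeplitzBoundedBy.N_mul_le (hF : Y.HasFatou) {a : L0} {C : ℝ≥0∞}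
    (hC : ToeplitzBoundedBy X Y a C) {g : L0} (hg : X.N g < ∞) :
    Y.N (a * g) ≤ C * X.N g := by
  rcases eq_or_ne C ∞ with rfl | hCtop
  · rcases eq_or_ne (X.N g) 0 with h0 | h0
    · rw [X.eq_zero_of_norm_eq_zero g h0, N_mul_zero]
      exact zero_le
    · rw [ENNReal.top_mul h0]
      exact le_top
  have hgm : Measurable fun t => ‖g t‖ := g.stronglyMeasurable.measurable.norm
  have hwm : ∀ n : ℕ, AEStronglyMeasurable (fun t => ((min ‖g t‖ n : ℝ) : ℂ)) m := fun n =>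
    (Complex.measurable_ofReal.comp (hgm.min measurable_const)).aestronglyMeasurable
  set w : ℕ → L0 := fun n => AEEqFun.mk _ (hwm n) with hw
  have hwae : ∀ n, ∀ᵐ t ∂m, w n t = ((min ‖g t‖ n : ℝ) : ℂ) := fun n =>
    AEEqFun.coeFn_mk _ (hwm n)
  set e1 : L0 := AEEqFun.const Torus (1 : ℂ) with he1
  have hstep : ∀ (n : ℕ) (ε : ℝ≥0), 0 < ε →
      Y.N (a * w n) ≤ C * (X.N g + ε * X.N e1) := by
    intro n ε hε
    have hε' : (0 : ℝ) < ε := hε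
    have hmin0 : ∀ t, 0 ≤ min ‖g t‖ (n : ℝ) := fun t =>
      le_min (norm_nonneg _) n.cast_nonneg
    obtain ⟨f, hfabs, hfc⟩ := exists_outer (ψ := fun t => min ‖g t‖ n + ε)
      ((hgm.min measurable_const).add_const _) (M := n + ε) hε'
      (fun t => by linarith [hmin0 t]) (fun t => by linarith [min_le_right ‖g t‖ (n : ℝ)])
    have hfN : X.N f ≤ X.N g + ε * X.N e1 := by
      have e : ‖((ε : ℝ) : ℂ)‖ₑ = ε := by
        rw [← ofReal_norm, Complex.norm_real, Real.norm_of_nonneg ε.coe_nonneg,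
          ENNReal.ofReal_coe_nnreal]
      calc X.N f ≤ X.N (absL0 g + ((ε : ℝ) : ℂ) • e1) := by
            refine X.ideal _ _ ?_
            filter_upwards [hfabs, add_ae (absL0 g) (((ε : ℝ) : ℂ) • e1), absL0_ae g,
              smul_ae ((ε : ℝ) : ℂ) e1, const_ae 1] with t h1 h2 h3 h4 h5
            rw [h1, h2, h3, h4, he1, h5, mul_one, ← Complex.ofReal_add, Complex.norm_real,
              Real.norm_of_nonneg (by positivity)]
            linarith [min_le_left ‖g t‖ (n : ℝ)]
        _ ≤ X.N (absL0 g) + X.N (((ε : ℝ) : ℂ) • e1) := X.norm_add_le _ _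
        _ = X.N g + ε * X.N e1 := by rw [X.N_absL0, X.norm_smul, e]
    have hfX : f ∈ X.hardy := by
      refine ⟨hfN.trans_lt ?_, hfc⟩
      exact ENNReal.add_lt_top.2 ⟨hg, ENNReal.mul_lt_top ENNReal.coe_lt_top
        X.N_one_ne_top.lt_top⟩
    calc Y.N (a * w n) ≤ Y.N (a * f) := by
          refine N_mul_mono ?_
          filter_upwards [hwae n, hfabs] with t h1 h2
          rw [h1, h2, Complex.norm_real, Real.norm_of_nonneg (hmin0 t)]
          linarith
      _ ≤ C * X.N f := hC.N_mul_le_of_mem_hardy hF hfX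
      _ ≤ C * (X.N g + ε * X.N e1) := by gcongr
  have hwN : ∀ n, Y.N (a * w n) ≤ C * X.N g := by
    intro n
    have hT : Tendsto (fun ε : ℝ≥0 => C * (X.N g + ε * X.N e1)) (𝓝[>] 0)
        (𝓝 (C * (X.N g + 0 * X.N e1))) := by
      refine ENNReal.Tendsto.const_mul (Tendsto.const_add _ ?_) (Or.inr hCtop)
      refine ENNReal.Tendsto.mul_const ?_ (Or.inr X.N_one_ne_top)
      exact (ENNReal.tendsto_coe.2 tendsto_id).mono_left nhdsWithin_le_nhds
    rw [zero_mul, add_zero] at hT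
    exact ge_of_tendsto hT (eventually_nhdsWithin_of_forall fun ε hε => hstep n ε hε)
  have habs : Y.N (a * absL0 g) ≤ C * X.N g := by
    refine Y.N_le_of_tendsto_ae hF hwN ?_
    filter_upwards [ae_all_iff.2 hwae, ae_all_iff.2 fun n => mul_ae a (w n), absL0_ae g,
      mul_ae a (absL0 g)] with t h1 h2 h3 h4
    rw [h4, h3]
    refine tendsto_const_nhds.congr' ?_
    filter_upwards [eventually_ge_atTop ⌈‖g t‖⌉₊] with n hn
    rw [h2, h1, min_eq_left (Nat.ceil_le.1 hn)]
  refine (N_mul_mono ?_).trans habs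
  filter_upwards [absL0_ae g] with t ht
  rw [ht, Complex.norm_real, norm_norm]

/-! ### The multiplier norm -/

theorem N_mul_smul (a : L0) (c : ℂ) (f : L0) : Y.N (a * c • f) = ‖c‖ₑ * Y.N (a * f) := by
  rw [← Y.norm_smul]
  refine Y.N_congr ?_
  filter_upwards [mul_ae a (c • f), smul_ae c f, smul_ae c (a * f), mul_ae a f]
    with t h1 h2 h3 h4
  rw [h1, h2, h3, h4]
  congr 1
  ring

theorem N_mul_le_multiplierNorm (a : L0) {f : L0} (hf : X.N f < ∞) :
    Y.N (a * f) ≤ multiplierNorm X Y a * X.N f := by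
  rcases eq_or_ne (X.N f) 0 with h0 | h0
  · rw [X.eq_zero_of_norm_eq_zero f h0, N_mul_zero]
    exact zero_le
  set c : ℂ := (((X.N f).toReal⁻¹ : ℝ) : ℂ) with hc
  have hce : ‖c‖ₑ = (X.N f)⁻¹ := by
    rw [← ofReal_norm, hc, Complex.norm_real,
      Real.norm_of_nonneg (inv_nonneg.2 ENNReal.toReal_nonneg),
      ENNReal.ofReal_inv_of_pos (ENNReal.toReal_pos h0 hf.ne), ENNReal.ofReal_toReal hf.ne]
  have h1 : X.N (c • f) ≤ 1 := by
    rw [X.norm_smul, hce, ENNReal.inv_mul_cancel h0 hf.ne]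
  have h2 : Y.N (a * c • f) ≤ multiplierNorm X Y a :=
    le_iSup₂ (f := fun (g : L0) (_ : X.N g ≤ 1) => Y.N (a * g)) (c • f) h1
  rw [N_mul_smul, hce, mul_comm, ← div_eq_mul_inv] at h2
  exact (ENNReal.div_le_iff h0 hf.ne).1 h2

/-- A multiplier defines a bounded multiplication operator. -/
theorem multiplierNorm_lt_top {a : L0} (ha : a ∈ multipliers X Y) :
    multiplierNorm X Y a < ∞ := by
  by_contra hcon
  have hsup : multiplierNorm X Y a = ∞ := not_lt_top_iff.1 hcon
  -- Gliding hump: with weights 2^{-n} the series of these functions is dominated by one G in X,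
  -- while the n-th term alone forces ‖aG‖ ≥ 2^{-n} 4^n = 2^n.
  have hex : ∀ n : ℕ, ∃ g : L0, X.N g ≤ 1 ∧ (4 : ℝ≥0∞) ^ n < Y.N (a * g) := by
    intro n
    have h : (4 : ℝ≥0∞) ^ n < multiplierNorm X Y a := by
      rw [hsup]
      exact ENNReal.pow_lt_top (by simp)
    obtain ⟨g, hg⟩ := lt_iSup_iff.1 h
    obtain ⟨h1, h2⟩ := lt_iSup_iff.1 hg
    exact ⟨g, h1, h2⟩
  choose g hg1 hg2 using hex
  have hce : ∀ n : ℕ, ‖((2 : ℂ)⁻¹) ^ n‖ₑ = (2 : ℝ≥0∞)⁻¹ ^ n := by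
    intro n
    rw [enorm_pow, enorm_inv two_ne_zero]
    congr 2
    rw [← ofReal_norm]
    simp
  obtain ⟨G, hG, hdom⟩ := X.exists_dominating (u := fun n => ((2 : ℂ)⁻¹) ^ n • g n) (by
    refine ne_top_of_le_ne_top (b := ∑' n : ℕ, (2 : ℝ≥0∞)⁻¹ ^ n) ?_
      (ENNReal.tsum_le_tsum fun n => ?_)
    · rw [ENNReal.tsum_geometric]
      simp
    · rw [X.norm_smul, hce]
      exact mul_le_of_le_one_right' (hg1 n))
  have hGtop : X.N G < ∞ := by
    refine hG.trans_lt ?_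
    refine (ENNReal.tsum_le_tsum (g := fun n : ℕ => (2 : ℝ≥0∞)⁻¹ ^ n) fun n => ?_).trans_lt ?_
    · rw [X.norm_smul, hce]
      exact mul_le_of_le_one_right' (hg1 n)
    · rw [ENNReal.tsum_geometric]
      simp
  have haG : Y.N (a * G) < ∞ := ha G hGtop
  have hlow : ∀ n : ℕ, (2 : ℝ≥0∞) ^ n ≤ Y.N (a * G) := by
    intro n
    have h1 : Y.N (a * ((2 : ℂ)⁻¹) ^ n • g n) ≤ Y.N (a * G) := by
      refine N_mul_mono ?_
      filter_upwards [hdom] with t ht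
      refine le_trans ?_ (ht (n + 1))
      exact Finset.single_le_sum (f := fun k => ‖(((2 : ℂ)⁻¹) ^ k • g k : L0) t‖)
        (fun k _ => norm_nonneg _) (Finset.self_mem_range_succ n)
    rw [N_mul_smul, hce] at h1
    refine le_trans ?_ h1
    calc (2 : ℝ≥0∞) ^ n = (2 : ℝ≥0∞)⁻¹ ^ n * 4 ^ n := by
          rw [← mul_pow]
          congr 1
          rw [show (4 : ℝ≥0∞) = 2 * 2 by norm_num, ← mul_assoc,
            ENNReal.inv_mul_cancel two_ne_zero ENNReal.ofNat_ne_top, one_mul]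
      _ ≤ _ := by gcongr; exact (hg2 n).le
  obtain ⟨n, hn⟩ := ENNReal.exists_nat_gt haG.ne
  refine absurd (hlow n) (not_le.2 (hn.trans_le ?_))
  exact_mod_cast Nat.lt_two_pow_self.le

/-! ### Boundedness of P and the two-sided norm estimate -/

theorem exists_rieszBoundedBy (hY : Y.IsRI) (hBoyd : Y.HasNontrivialBoydIndices)
    (hF : Y.HasFatou) : ∃ M : ℝ≥0, RieszBoundedBy Y M := by
  obtain ⟨K, θ, τ, hθ, hτ, hD⟩ := BanachFunctionSpace.exists_hasDilationBounds hY hBoyd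
  obtain ⟨M, hM⟩ := BanachFunctionSpace.exists_N_le_of_isCauchyLimit hY hF hθ hτ hD
  refine ⟨M, fun f hf => ?_⟩
  have hfi := BanachFunctionSpace.integrable_of_N_lt_top hτ hD hf
  obtain ⟨g, hg⟩ := exists_isCauchyLimit hfi
  have hgN := (hM f g hf hg).1
  exact ⟨g, hgN.trans_lt (ENNReal.mul_lt_top ENNReal.coe_lt_top hf),
    isRieszProjection_iff.2 ⟨hfi, hg⟩, hgN⟩

theorem fourierCoeff_eq_zero_of_isRieszProjection (hY : Y.IsRI)
    (hBoyd : Y.HasNontrivialBoydIndices) (hF : Y.HasFatou) {f g : L0} (hf : f ∈ Y.space)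
    (hg : IsRieszProjection f g) {n : ℤ} (hn : n < 0) : fourierCoeff g n = 0 := by
  obtain ⟨K, θ, τ, hθ, hτ, hD⟩ := BanachFunctionSpace.exists_hasDilationBounds hY hBoyd
  obtain ⟨M, hM⟩ := BanachFunctionSpace.exists_N_le_of_isCauchyLimit hY hF hθ hτ hD
  exact (hM f g hf (isRieszProjection_iff.1 hg).2).2 n hn

theorem RieszBoundedBy.toeplitzBoundedBy (hY : Y.IsRI) (hBoyd : Y.HasNontrivialBoydIndices)
    (hF : Y.HasFatou) {R : ℝ≥0∞} (hR : RieszBoundedBy Y R) {a : L0}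
    (ha : a ∈ multipliers X Y) : ToeplitzBoundedBy X Y a (R * multiplierNorm X Y a) := by
  intro f hf
  have haf := ha f hf.1
  obtain ⟨g, hg, hP, hN⟩ := hR _ haf
  refine ⟨g, ⟨hg, fun n hn =>
    fourierCoeff_eq_zero_of_isRieszProjection hY hBoyd hF haf hP hn⟩, hP, hN.trans ?_⟩
  rw [mul_assoc]
  gcongr
  exact N_mul_le_multiplierNorm a hf.1

theorem rieszNorm_lt_top (hY : Y.IsRI) (hBoyd : Y.HasNontrivialBoydIndices)
    (hF : Y.HasFatou) : rieszNorm Y < ∞ := by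
  obtain ⟨M, hM⟩ := exists_rieszBoundedBy hY hBoyd hF
  exact (sInf_le hM).trans_lt ENNReal.coe_lt_top

theorem toeplitzBounded_iff (hY : Y.IsRI) (hBoyd : Y.HasNontrivialBoydIndices)
    (hF : Y.HasFatou) (a : L0) : ToeplitzBounded X Y a ↔ a ∈ multipliers X Y := by
  constructor
  · rintro ⟨C, hC⟩ g hg
    exact (hC.N_mul_le hF hg).trans_lt (ENNReal.mul_lt_top ENNReal.coe_lt_top hg)
  · intro ha
    obtain ⟨M, hM⟩ := exists_rieszBoundedBy hY hBoyd hF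
    refine ⟨M * (multiplierNorm X Y a).toNNReal, ?_⟩
    rw [ENNReal.coe_mul, ENNReal.coe_toNNReal (multiplierNorm_lt_top ha).ne]
    exact hM.toeplitzBoundedBy hY hBoyd hF ha

theorem multiplierNorm_le_toeplitzNorm (hF : Y.HasFatou) (a : L0) :
    multiplierNorm X Y a ≤ toeplitzNorm X Y a := by
  refine le_sInf fun C hC => iSup₂_le fun g hg => ?_
  exact (ToeplitzBoundedBy.N_mul_le hF hC (hg.trans_lt ENNReal.one_lt_top)).trans
    (mul_le_of_le_one_right' hg)

theorem toeplitzNorm_le (hY : Y.IsRI) (hBoyd : Y.HasNontrivialBoydIndices)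
    (hF : Y.HasFatou) {a : L0} (ha : a ∈ multipliers X Y) :
    toeplitzNorm X Y a ≤ rieszNorm Y * multiplierNorm X Y a := by
  obtain ⟨M, hM⟩ := exists_rieszBoundedBy hY hBoyd hF
  -- The product passes through the infimum because the multiplier norm is finite and, in case it is
  -- 0, because the set of bounds of P is nonempty.
  rw [rieszNorm, sInf_eq_iInf', ENNReal.iInf_mul' (fun h => absurd h (multiplierNorm_lt_top ha).ne)
    fun _ => ⟨⟨M, hM⟩⟩]
  exact le_iInf fun R => sInf_le (RieszBoundedBy.toeplitzBoundedBy hY hBoyd hF R.2 ha)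

end ToeplitzRI

end

theorem theorem4p3 (X Y : ToeplitzRI.BanachFunctionSpace) (hX : X.IsRI) (hY : Y.IsRI)
    (hXY : X.space ⊆ Y.space) (hBoyd : Y.HasNontrivialBoydIndices) (hFatou : Y.HasFatou) :
    ToeplitzRI.rieszNorm Y < ⊤ ∧
    ∀ a : ToeplitzRI.L0,
      (ToeplitzRI.ToeplitzBounded X Y a ↔ a ∈ ToeplitzRI.multipliers X Y) ∧
      (a ∈ ToeplitzRI.multipliers X Y →
        ToeplitzRI.multiplierNorm X Y a ≤ ToeplitzRI.toeplitzNorm X Y a ∧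
        ToeplitzRI.toeplitzNorm X Y a ≤
          ToeplitzRI.rieszNorm Y * ToeplitzRI.multiplierNorm X Y a) := by
  exact ⟨ToeplitzRI.rieszNorm_lt_top hY hBoyd hFatou, fun a =>
    ⟨ToeplitzRI.toeplitzBounded_iff hY hBoyd hFatou a, fun ha =>
      ⟨ToeplitzRI.multiplierNorm_le_toeplitzNorm hFatou a,
        ToeplitzRI.toeplitzNorm_le hY hBoyd hFatou ha⟩⟩⟩
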